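/- All manifolds are smooth $3$-manifolds (Hausdorff, second countable) with possibly empty boundary, and all metrics and embeddings are smooth up to the boundary. The distance to an empty boundary is $+\infty$. For a Riemannian metric $g$ on such a manifold: * the mean curvature of the boundary is taken with respect to the outward unit normal (it is positive for a Euclidean ball), and the boundary is strictly mean convex if its mean curvature is positive everywhere; * $g$ is called static on an open set $U$ if there is a smooth function $f$ on $U$, not identically zero, with $\nabla^2 f-(\Delta f)\,g-f\,\mathrm{Ric}(g)=0$ on $U$; * for a compact region $A$ of a manifold $M$, $\partial A$ is called strictly outer-minimising in $M$ if $|\partial A|<|\partial F|$ for every Borel set $F\supseteq A$ with compact closure in $M$ such that $F\setminus A$ has positive volume; here $|\partial F|$ is the perimeter $\sup_X\int_F \operatorname{div}X\,dV_g$ over the compactly supported smooth vector fields $X$ on $M$ with $|X|_g\le 1$ (the area of $\partial F$ if $F$ is compact with smooth boundary). **Proposition.** Let $(\Omega,\gamma)$ be a compact Riemannian $3$-manifold with nonnegative scalar curvature and strictly mean convex boundary $\partial\Omega$. Assume that there is a Riemannian $3$-manifold $(\Omega_o,\gamma_o)$ with nonnegative scalar curvature in which $(\Omega,\gamma)$ isometrically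 embeds with $\operatorname{dist}(\partial\Omega,\partial\Omega_o)>0$. Then there is a Riemannian $3$-manifold $(\widehat\Omega,\widehat\gamma)$ in which $(\Omega,\gamma)$ isometrically embeds with $\operatorname{dist}(\partial\Omega,\partial\widehat\Omega)>0$, such that 1. $\widehat\gamma$ has positive scalar curvature at every point of $\widehat\Omega\setminus\Omega$; 2. $\widehat\gamma$ is not static on $\widehat\Omega\setminus\Omega$; 3. $\partial\Omega$ is strictly outer-minimising in $\widehat\Omega$. -/

import Mathlib

open scoped Manifold ContDiff ENNReal

universe u v

noncomputable section

namespace Bartnik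

/-! ### Riemannian tensors of a metric written in coordinates

`G` is the matrix of a Riemannian metric in a coordinate system with values in the closed half-space
`{x ∈ ℝ³ | 0 ≤ x 0}`, the model of 3-manifolds with (possibly empty) boundary. Partial derivatives
are taken within this half-space, hence they are one-sided at the points with `x 0 = 0`. -/

/-- The model vector space of a 3-manifold. -/
abbrev E3 : Type := EuclideanSpace ℝ (Fin 3)

/-- The partial derivative `∂ᵢ f` (within the half-space). -/
def pd (i : Fin 3) (f : E3 → ℝ) (y : E3) : ℝ :=
  fderivWithin ℝ f (Set.range (𝓡∂ 3)) y (EuclideanSpace.single i 1)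

/-- The Christoffel symbol `Γᵏᵢⱼ` of the metric `G`. -/
def christoffel (G : E3 → Matrix (Fin 3) (Fin 3) ℝ) (k i j : Fin 3) (y : E3) : ℝ :=
  (1 / 2) * ∑ l, (G y)⁻¹ k l *
    (pd i (fun z => G z j l) y + pd j (fun z => G z i l) y - pd l (fun z => G z i j) y)

/-- The Ricci curvature `Ricᵢⱼ = ∂ₖΓᵏᵢⱼ - ∂ⱼΓᵏᵢₖ + ΓᵏₖₗΓˡᵢⱼ - ΓᵏⱼₗΓˡᵢₖ` of the metric `G`. -/
def ricci (G : E3 → Matrix (Fin 3) (Fin 3) ℝ) (i j : Fin 3) (y : E3) : ℝ :=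
  ∑ k, (pd k (christoffel G k i j) y - pd j (christoffel G k i k) y +
    ∑ l, (christoffel G k k l y * christoffel G l i j y -
      christoffel G k j l y * christoffel G l i k y))

/-- The scalar curvature `Gⁱʲ Ricᵢⱼ` of the metric `G`. -/
def scalar (G : E3 → Matrix (Fin 3) (Fin 3) ℝ) (y : E3) : ℝ :=
  ∑ i, ∑ j, (G y)⁻¹ i j * ricci G i j y

/-- The Hessian `∇²ᵢⱼ f = ∂ᵢ∂ⱼ f - Γᵏᵢⱼ ∂ₖ f`. -/
def hessian (G : E3 → Matrix (Fin 3) (Fin 3) ℝ) (f : E3 → ℝ) (i j : Fin 3) (y : E3) : ℝ :=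
  pd i (pd j f) y - ∑ k, christoffel G k i j y * pd k f y

/-- The Laplacian `Δ f = Gⁱʲ ∇²ᵢⱼ f`. -/
def laplacian (G : E3 → Matrix (Fin 3) (Fin 3) ℝ) (f : E3 → ℝ) (y : E3) : ℝ :=
  ∑ i, ∑ j, (G y)⁻¹ i j * hessian G f i j y

/-- The divergence `(det G)^(-1/2) ∂ₖ ((det G)^(1/2) Xᵏ)` of a vector field. -/
def divergence (G : E3 → Matrix (Fin 3) (Fin 3) ℝ) (X : E3 → Fin 3 → ℝ) (y : E3) : ℝ :=
  (√(G y).det)⁻¹ * ∑ k, pd k (fun z => √(G z).det * X z k) y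

/-- The unit normal `- ∇x⁰ / |∇x⁰|` of the level sets of the coordinate `x⁰`. At the points with
`x⁰ = 0` it is the outward unit normal of the half-space. -/
def outwardNormal (G : E3 → Matrix (Fin 3) (Fin 3) ℝ) (y : E3) (k : Fin 3) : ℝ :=
  -((G y)⁻¹ k 0 / √((G y)⁻¹ 0 0))

/-! ### Riemannian 3-manifolds with boundary -/

section Manifold

variable {M : Type u} [TopologicalSpace M] [ChartedSpace (EuclideanHalfSpace 3) M]
  [IsManifold (𝓡∂ 3) ∞ M]

/-- Smooth Riemannian metrics on a smooth 3-manifold with (possibly empty) boundary. -/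
abbrev RMetric (M : Type u) [TopologicalSpace M] [ChartedSpace (EuclideanHalfSpace 3) M]
    [IsManifold (𝓡∂ 3) ∞ M] : Type u :=
  Bundle.ContMDiffRiemannianMetric (𝓡∂ 3) ∞ E3 (fun x : M => TangentSpace (𝓡∂ 3) x)

/-- The coordinate vector `∂ᵢ` of the chart at `p`, at the point with coordinates `y`. -/
def coordVec (p : M) (y : E3) (i : Fin 3) :
    TangentSpace (𝓡∂ 3) ((extChartAt (𝓡∂ 3) p).symm y) :=
  mfderivWithin 𝓘(ℝ, E3) (𝓡∂ 3) (extChartAt (𝓡∂ 3) p).symm (Set.range (𝓡∂ 3)) y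
    (EuclideanSpace.single i (1 : ℝ) : E3)

/-- The matrix of the metric in the chart at `p`, as a function of the coordinates. -/
def gram (g : RMetric M) (p : M) (y : E3) : Matrix (Fin 3) (Fin 3) ℝ :=
  Matrix.of fun i j => g.inner ((extChartAt (𝓡∂ 3) p).symm y) (coordVec p y i) (coordVec p y j)

/-- The components of the vector field `X` in the chart at `p`. -/
def components (X : ∀ q : M, TangentSpace (𝓡∂ 3) q) (p : M) (y : E3) (k : Fin 3) : ℝ :=
  (show E3 from mfderiv (𝓡∂ 3) 𝓘(ℝ, E3) (extChartAt (𝓡∂ 3) p) ((extChartAt (𝓡∂ 3) p).symm y)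
    (X ((extChartAt (𝓡∂ 3) p).symm y))) k

/-- The scalar curvature of `(M, g)` at `p`. -/
def scalarCurvature (g : RMetric M) (p : M) : ℝ :=
  scalar (gram g p) (extChartAt (𝓡∂ 3) p p)

/-- The mean curvature of `∂M` at a boundary point `p` with respect to the outward unit normal `ν`:
the divergence of `ν`, extended as the unit normal field of the level sets of a boundary
coordinate. It is `2 / r` for the Euclidean ball of radius `r`. -/
def meanCurvature (g : RMetric M) (p : M) : ℝ :=
  divergence (gram g p) (outwardNormal (gram g p)) (extChartAt (𝓡∂ 3) p p)

/-- The divergence of the vector field `X` at `p`. -/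
def div (g : RMetric M) (X : ∀ q : M, TangentSpace (𝓡∂ 3) q) (p : M) : ℝ :=
  divergence (gram g p) (components X p) (extChartAt (𝓡∂ 3) p p)

/-- The components, in the chart at `p`, of the formal adjoint of the linearised scalar curvature
at `p`: `L*(f)ᵢⱼ = ∇²ᵢⱼ f - (Δ f) gᵢⱼ - f Ricᵢⱼ`. -/
def adjointLinScal (g : RMetric M) (f : M → ℝ) (p : M) (i j : Fin 3) : ℝ :=
  let y := extChartAt (𝓡∂ 3) p p
  let G := gram g p
  let F : E3 → ℝ := f ∘ (extChartAt (𝓡∂ 3) p).symm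
  hessian G F i j y - laplacian G F y * G y i j - f p * ricci G i j y

/-- The metric is static on the open set `U`: the equation `L*(f) = 0` has a non-trivial smooth
solution on `U`. -/
def IsStaticOn (g : RMetric M) (U : Set M) : Prop :=
  ∃ f : M → ℝ, ContMDiffOn (𝓡∂ 3) 𝓘(ℝ, ℝ) ∞ f U ∧ (∃ q ∈ U, f q ≠ 0) ∧
    ∀ q ∈ U, ∀ i j, adjointLinScal g f q i j = 0

open scoped Bundle in
/-- The Riemannian distance. -/
def riemDist (g : RMetric M) (p q : M) : ℝ≥0∞ :=
  letI : Bundle.RiemannianBundle (fun x : M => TangentSpace (𝓡∂ 3) x) := ⟨g.toRiemannianMetric⟩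
  Manifold.riemannianEDist (𝓡∂ 3) p q

/-- The Riemannian distance from the set `A` to the boundary `∂M` (`∞` if one of them is empty). -/
def distToBoundary (g : RMetric M) (A : Set M) : ℝ≥0∞ :=
  ⨅ p ∈ A, ⨅ q ∈ (𝓡∂ 3).boundary M, riemDist g p q

/-! ### Volume, perimeter and outer-minimising regions -/

variable [MeasurableSpace M] [BorelSpace M]

/-- The Riemannian volume `√(det G) dy` on the domain of the chart at `p`, as a measure on `M`. -/
def chartVolume (g : RMetric M) (p : M) : MeasureTheory.Measure M :=
  ((MeasureTheory.volume.restrict (extChartAt (𝓡∂ 3) p).target).withDensity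
    (fun y => ENNReal.ofReal √(gram g p y).det)).map (extChartAt (𝓡∂ 3) p).symm

/-- The Riemannian volume measure. The measures `chartVolume g p` agree on the intersections of
the chart domains; their supremum is the measure that restricts to each of them. -/
def riemVolume (g : RMetric M) : MeasureTheory.Measure M :=
  ⨆ p, chartVolume g p

/-- Smooth compactly supported vector fields of length at most one. They need not vanish
on `∂M`. -/
structure IsTestField (g : RMetric M) (X : ∀ q : M, TangentSpace (𝓡∂ 3) q) : Prop where
  smooth : ContMDiff (𝓡∂ 3) (𝓡∂ 3).tangent ∞ (fun q => (⟨q, X q⟩ : TangentBundle (𝓡∂ 3) M))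
  compactSupport : ∃ K : Set M, IsCompact K ∧ ∀ q ∉ K, X q = 0
  length_le : ∀ q, g.inner q (X q) (X q) ≤ 1

/-- The perimeter of `F ⊆ M` in the sense of Caccioppoli and De Giorgi, the supremum of
`∫_F div X` over the test fields `X`. It is the area of `∂F` if `F` is compact with smooth
boundary. Parts of `∂F` that lie on `∂M` are counted. -/
def perimeter (g : RMetric M) (F : Set M) : ℝ≥0∞ :=
  ⨆ X ∈ {X : ∀ q : M, TangentSpace (𝓡∂ 3) q | IsTestField g X},
    ENNReal.ofReal (∫ q in F, div g X q ∂(riemVolume g))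

/-- The boundary of the compact region `A` is strictly outer-minimising in `(M, g)`: every region
`F` with compact closure in `M` that contains `A`, and does not coincide with it up to a set of
measure zero, has a boundary of strictly larger area. -/
def IsStrictlyOuterMinimising (g : RMetric M) (A : Set M) : Prop :=
  ∀ F : Set M, MeasurableSet F → A ⊆ F → IsCompact (closure F) → riemVolume g (F \ A) ≠ 0 →
    perimeter g A < perimeter g F

end Manifold

/-! ### Isometric embeddings -/

/-- `ι` is a smooth embedding with `ι^* g = γ`. -/
structure IsIsometricEmbedding {Ω M : Type*}
    [TopologicalSpace Ω] [ChartedSpace (EuclideanHalfSpace 3) Ω] [IsManifold (𝓡∂ 3) ∞ Ω]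
    [TopologicalSpace M] [ChartedSpace (EuclideanHalfSpace 3) M] [IsManifold (𝓡∂ 3) ∞ M]
    (γ : RMetric Ω) (g : RMetric M) (ι : Ω → M) : Prop where
  isSmoothEmbedding : Manifold.IsSmoothEmbedding (𝓡∂ 3) (𝓡∂ 3) ∞ ι
  isometric : ∀ (p : Ω) (v w : TangentSpace (𝓡∂ 3) p),
    g.inner (ι p) (mfderiv (𝓡∂ 3) (𝓡∂ 3) ι p v) (mfderiv (𝓡∂ 3) (𝓡∂ 3) ι p w) = γ.inner p v w

end Bartnik

end

/-! Positive distance to the boundary puts the image of `Ω` in the interior of `Ω₀`. Hence the image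
is a sublevel set `{s ≤ 0}` of a smooth function `s` with zero set the image of `∂Ω` and `ds ≠ 0`
there (`exists_defining`). The divergence of `ν = ∇s/|∇s|` on the zero set is the mean curvature of
`∂Ω` (`meanCurvature_eq_div`), hence positive.

Let `ψ = e^{-1/s}` for `s > 0` and `ψ = 0` elsewhere. On a small neighbourhood `N` of the image the
new metric is `g_c = e^{-2cψ} γ₀` with `0 < c ≤ 1`; since `ψ` is flat at `s = 0`, the metric is
smooth and is unchanged on the image. The three conclusions hold for the following reasons.

Scalar curvature: `R_c = e^{2cψ} (R + 4cΔψ - 2c²|∇ψ|²)` by `scalar_conf`. As `s → 0+` the part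
`e^{-1/s} s^{-4} |∇s|²` of `Δψ` dominates all other terms in `ψ`, so `R_c > 0` close to the image
because `R ≥ 0`.

Not static: the divergence of the static equation, with the contracted Bianchi identity, gives `f dR
= 0`, so the scalar curvature has zero differential wherever the potential does not vanish
(`static_pd_scalar`). At a fixed point, `dR_c(v)` is a positive factor times a cubic polynomial in
`c` with leading coefficient `-4|∇ψ|² dψ(v)`. If `g_c` were static for every `c` in `(0, 1]`,
uncountably many `c` would have a potential that is nonzero at the same point of a countable dense
set, and the cubic with `v = ∇ψ` would have infinitely many roots
(`exists_not_isStaticOn_confFamily`).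

Outer-minimising: the `g_c`-unit normal of the level sets of `s` has divergence `e^{cψ} (div ν -
2cψ'(s)|∇s|)`, which is positive close to the image. It is a calibration: the divergence theorem
shows that a larger region has strictly larger perimeter (`isStrictlyOuterMinimising_sublevel`).

`exists_conformal` combines the three points, and `exists_opens_sublevel` provides `N`. Since
curvature, mean curvature, divergence and volume are defined by coordinate formulas, a large part of
the proof shows that these formulas are invariant under isometric maps; `Trans` is the coordinate
form of such a map. -/

noncomputable section

namespace Bartnik

open scoped Topology Matrix
open Set

/-! ### Calculus with partial derivatives in the half-space -/

/-- The model half-space. -/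
abbrev HS : Set E3 := Set.range (𝓡∂ 3)

/-- Relatively open subsets of the half-space. -/
def Dom (D : Set E3) : Prop := ∃ O, IsOpen O ∧ D = HS ∩ O

/-- Functions that are smooth on `D`. -/
abbrev Sm (D : Set E3) (f : E3 → ℝ) : Prop := ContDiffOn ℝ ∞ f D

theorem mem_HS {y : E3} : y ∈ HS ↔ 0 ≤ y 0 := by
  rw [HS, range_modelWithCornersEuclideanHalfSpace]; rfl

theorem uniqueDiffOn_HS : UniqueDiffOn ℝ HS := (𝓡∂ 3).uniqueDiffOn

namespace Dom

variable {D : Set E3} (hD : Dom D)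
include hD

theorem sub : D ⊆ HS := by
  obtain ⟨O, hO, rfl⟩ := hD
  exact inter_subset_left

theorem mem_nhdsWithin {y : E3} (hy : y ∈ D) : D ∈ 𝓝[HS] y := by
  obtain ⟨O, hO, rfl⟩ := hD
  exact Filter.inter_mem self_mem_nhdsWithin (mem_nhdsWithin_of_mem_nhds (hO.mem_nhds hy.2))

theorem uniqueDiffOn : UniqueDiffOn ℝ D := by
  obtain ⟨O, hO, rfl⟩ := hD
  exact uniqueDiffOn_HS.inter hO

theorem fderivWithin_eq {F : Type*} [NormedAddCommGroup F] [NormedSpace ℝ F] {f : E3 → F} {y : E3}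
    (hy : y ∈ D) : fderivWithin ℝ f HS y = fderivWithin ℝ f D y := by
  obtain ⟨O, hO, rfl⟩ := hD
  rw [fderivWithin_inter (hO.mem_nhds hy.2)]

/-- Symmetry of second derivatives within a set is applied at limits of interior points. Points with
`y 0 = 0` are such limits, so `pd_comm` holds up to the boundary. -/
theorem mem_closure_interior {y : E3} (hy : y ∈ D) : y ∈ closure (interior D) := by
  obtain ⟨O, hO, rfl⟩ := hD
  rw [interior_inter, hO.interior_eq, inter_comm]
  exact hO.inter_closure ⟨hy.2, (𝓡∂ 3).range_subset_closure_interior hy.1⟩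

theorem pd_eq {f : E3 → ℝ} {y : E3} (i : Fin 3) (hy : y ∈ D) :
    pd i f y = fderivWithin ℝ f D y (EuclideanSpace.single i 1) := by
  rw [pd, hD.fderivWithin_eq hy]

theorem pd_congr {f g : E3 → ℝ} (h : EqOn f g D) (i : Fin 3) {y : E3} (hy : y ∈ D) :
    pd i f y = pd i g y := by
  rw [hD.pd_eq i hy, hD.pd_eq i hy, fderivWithin_congr h (h hy)]

theorem sm_pd {f : E3 → ℝ} (hf : Sm D f) (i : Fin 3) : Sm D (pd i f) := by
  have h : ContDiffOn ℝ ∞ (fderivWithin ℝ f D) D := hf.fderivWithin hD.uniqueDiffOn (by simp)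
  refine (h.clm_apply contDiffOn_const).congr fun y hy => hD.pd_eq i hy

theorem pd_add {f g : E3 → ℝ} (hf : Sm D f) (hg : Sm D g) (i : Fin 3) {y : E3} (hy : y ∈ D) :
    pd i (fun z => f z + g z) y = pd i f y + pd i g y := by
  rw [hD.pd_eq i hy, hD.pd_eq i hy, hD.pd_eq i hy, fderivWithin_fun_add (hD.uniqueDiffOn y hy)
    (hf.differentiableOn (by simp) y hy) (hg.differentiableOn (by simp) y hy)]
  rfl

theorem pd_sub {f g : E3 → ℝ} (hf : Sm D f) (hg : Sm D g) (i : Fin 3) {y : E3} (hy : y ∈ D) :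
    pd i (fun z => f z - g z) y = pd i f y - pd i g y := by
  rw [hD.pd_eq i hy, hD.pd_eq i hy, hD.pd_eq i hy, fderivWithin_fun_sub (hD.uniqueDiffOn y hy)
    (hf.differentiableOn (by simp) y hy) (hg.differentiableOn (by simp) y hy)]
  rfl

theorem pd_mul {f g : E3 → ℝ} (hf : Sm D f) (hg : Sm D g) (i : Fin 3) {y : E3} (hy : y ∈ D) :
    pd i (fun z => f z * g z) y = pd i f y * g y + f y * pd i g y := by
  rw [hD.pd_eq i hy, hD.pd_eq i hy, hD.pd_eq i hy, fderivWithin_fun_mul (hD.uniqueDiffOn y hy)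
    (hf.differentiableOn (by simp) y hy) (hg.differentiableOn (by simp) y hy)]
  simp; ring

theorem pd_sum {ι : Type*} (s : Finset ι) {f : ι → E3 → ℝ} (hf : ∀ a ∈ s, Sm D (f a)) (i : Fin 3)
    {y : E3} (hy : y ∈ D) : pd i (fun z => ∑ a ∈ s, f a z) y = ∑ a ∈ s, pd i (f a) y := by
  simp only [hD.pd_eq i hy]
  rw [fderivWithin_fun_sum (hD.uniqueDiffOn y hy)
    fun a ha => (hf a ha).differentiableOn (by simp) y hy]
  simp

omit hD in
theorem pd_const (c : ℝ) (i : Fin 3) (y : E3) : pd i (fun _ => c) y = 0 := by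
  simp [pd]

theorem pd_const_mul {f : E3 → ℝ} (c : ℝ) (hf : Sm D f) (i : Fin 3) {y : E3} (hy : y ∈ D) :
    pd i (fun z => c * f z) y = c * pd i f y := by
  rw [hD.pd_mul contDiffOn_const hf i hy, pd_const]; ring

/-- The chain rule for functions of a real variable. -/
theorem pd_comp_real {f : E3 → ℝ} {h : ℝ → ℝ} {h' : ℝ} (hf : Sm D f) {y : E3}
    (hh : HasDerivAt h h' (f y)) (i : Fin 3) (hy : y ∈ D) :
    pd i (fun z => h (f z)) y = h' * pd i f y := by
  rw [hD.pd_eq i hy, hD.pd_eq i hy]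
  have h1 := (hf.differentiableOn (by simp) y hy).hasFDerivWithinAt
  have h2 := hh.hasFDerivAt.comp_hasFDerivWithinAt y h1
  have h3 := h2.fderivWithin (hD.uniqueDiffOn y hy)
  have : (fun z => h (f z)) = h ∘ f := rfl
  rw [this, h3]
  simp [mul_comm]

theorem pd_comm {f : E3 → ℝ} (hf : Sm D f) (i j : Fin 3) {y : E3} (hy : y ∈ D) :
    pd i (pd j f) y = pd j (pd i f) y := by
  have key : ∀ i j, pd i (pd j f) y =
      fderivWithin ℝ (fderivWithin ℝ f D) D y (EuclideanSpace.single i 1)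
        (EuclideanSpace.single j 1) := by
    intro i j
    rw [hD.pd_congr (fun z hz => hD.pd_eq j hz) i hy, hD.pd_eq i hy]
    have h : ContDiffOn ℝ ∞ (fderivWithin ℝ f D) D := hf.fderivWithin hD.uniqueDiffOn (by simp)
    have h2 := (h.differentiableOn (by simp) y hy).hasFDerivWithinAt.clm_apply
      (hasFDerivWithinAt_const (EuclideanSpace.single j (1 : ℝ) : E3) y D)
    rw [h2.fderivWithin (hD.uniqueDiffOn y hy)]
    simp
  rw [key, key]
  exact ((hf y hy).isSymmSndFDerivWithinAt
    (by rw [minSmoothness_of_isRCLikeNormedField]; exact WithTop.coe_le_coe.2 le_top) hD.uniqueDiffOn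
    (hD.mem_closure_interior hy) hy).eq _ _

omit hD in
theorem fderivWithin_apply {f : E3 → ℝ} {y : E3} (v : E3) :
    fderivWithin ℝ f HS y v = ∑ a, v a * pd a f y := by
  have hv : v = ∑ a, v a • (EuclideanSpace.single a (1 : ℝ) : E3) := by
    ext i; simp [Fin.sum_univ_three]; fin_cases i <;> simp
  conv_lhs => rw [hv]
  simp only [map_sum, map_smul, pd, smul_eq_mul]

end Dom

/-- The Jacobian matrix of `τ`. -/
def jac (τ : E3 → E3) (y : E3) : Matrix (Fin 3) (Fin 3) ℝ :=
  Matrix.of fun a i => pd i (fun z => τ z a) y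

theorem jac_apply (τ : E3 → E3) (y : E3) (a i : Fin 3) : jac τ y a i = pd i (fun z => τ z a) y := rfl

theorem sm_coord {D : Set E3} {τ : E3 → E3} (h : ContDiffOn ℝ ∞ τ D) (a : Fin 3) :
    Sm D (fun z => τ z a) := by
  exact (EuclideanSpace.proj (𝕜 := ℝ) a).contDiff.comp_contDiffOn h

theorem Dom.sm_jac {D : Set E3} (hD : Dom D) {τ : E3 → E3} (h : ContDiffOn ℝ ∞ τ D) (a i : Fin 3) :
    Sm D (fun z => jac τ z a i) := hD.sm_pd (sm_coord h a) i

/-- Derivatives within the half-space agree with derivatives within `D` and `D'`, which are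
relatively open in it. The chain rule is used within these sets, since `τ` need not preserve the
half-space. -/
theorem Dom.pd_comp {D D' : Set E3} (hD : Dom D) (hD' : Dom D') {τ : E3 → E3}
    (hτ : ContDiffOn ℝ ∞ τ D) (hm : MapsTo τ D D') {f : E3 → ℝ} (hf : Sm D' f) (i : Fin 3)
    {y : E3} (hy : y ∈ D) :
    pd i (fun z => f (τ z)) y = ∑ a, jac τ y a i * pd a f (τ y) := by
  have h := fderivWithin_comp (𝕜 := ℝ) y (hf.differentiableOn (by simp) _ (hm hy))
    (hτ.differentiableOn (by simp) y hy) hm (hD.uniqueDiffOn y hy)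
  rw [hD.pd_eq i hy]
  change fderivWithin ℝ (f ∘ τ) D y _ = _
  rw [h, ContinuousLinearMap.comp_apply, ← hD'.fderivWithin_eq (hm hy), Dom.fderivWithin_apply]
  refine Finset.sum_congr rfl fun a _ => ?_
  congr 1
  rw [jac_apply, hD.pd_eq i hy]
  have h1 := (hτ.differentiableOn (by simp) y hy).hasFDerivWithinAt
  have h2 := (EuclideanSpace.proj (𝕜 := ℝ) a).hasFDerivAt.comp_hasFDerivWithinAt y h1
  have h3 := h2.fderivWithin (hD.uniqueDiffOn y hy)
  have : (fun z => τ z a) = (EuclideanSpace.proj (𝕜 := ℝ) a) ∘ τ := rfl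
  rw [this, h3]; simp

theorem Sm.comp_map {D D' : Set E3} {τ : E3 → E3}
    (hτ : ContDiffOn ℝ ∞ τ D) (hm : MapsTo τ D D') {f : E3 → ℝ} (hf : Sm D' f) :
    Sm D (fun z => f (τ z)) := hf.comp hτ hm

/-- The symmetry of second derivatives of the components of a map. -/
theorem Dom.pd_jac_comm {D : Set E3} (hD : Dom D) {τ : E3 → E3} (h : ContDiffOn ℝ ∞ τ D)
    (a i j : Fin 3) {y : E3} (hy : y ∈ D) :
    pd i (fun z => jac τ z a j) y = pd j (fun z => jac τ z a i) y :=
  hD.pd_comm (sm_coord h a) i j hy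

/-! ### Metrics and Christoffel symbols in coordinates -/

/-- Smooth Riemannian metrics in coordinates. -/
structure Met (D : Set E3) (G : E3 → Matrix (Fin 3) (Fin 3) ℝ) : Prop where
  sm : ∀ i j, Sm D (fun z => G z i j)
  pos : ∀ z ∈ D, (G z).PosDef

namespace Met

variable {D : Set E3} {G : E3 → Matrix (Fin 3) (Fin 3) ℝ}

theorem mono (h : Met D G) {D' : Set E3} (h' : D' ⊆ D) : Met D' G :=
  ⟨fun i j => (h.sm i j).mono h', fun z hz => h.pos z (h' hz)⟩

theorem det_pos (h : Met D G) {z : E3} (hz : z ∈ D) : 0 < (G z).det := (h.pos z hz).det_pos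

theorem symm (h : Met D G) {z : E3} (hz : z ∈ D) (i j : Fin 3) : G z i j = G z j i := by
  have := (h.pos z hz).isHermitian.apply j i
  simpa using this

theorem inv_symm (h : Met D G) {z : E3} (hz : z ∈ D) (i j : Fin 3) :
    (G z)⁻¹ i j = (G z)⁻¹ j i := by
  have := ((h.pos z hz).inv).isHermitian.apply j i
  simpa using this

theorem mul_inv (h : Met D G) {z : E3} (hz : z ∈ D) : G z * (G z)⁻¹ = 1 :=
  Matrix.mul_nonsing_inv _ (h.det_pos hz).ne'.isUnit

theorem inv_mul (h : Met D G) {z : E3} (hz : z ∈ D) : (G z)⁻¹ * G z = 1 :=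
  Matrix.nonsing_inv_mul _ (h.det_pos hz).ne'.isUnit

theorem sm_det (h : Met D G) : Sm D (fun z => (G z).det) := by
  have := h.sm
  simp only [Matrix.det_fin_three]
  exact (((((((this 0 0).mul (this 1 1)).mul (this 2 2)).sub (((this 0 0).mul (this 1 2)).mul
    (this 2 1))).sub (((this 0 1).mul (this 1 0)).mul (this 2 2))).add (((this 0 1).mul
    (this 1 2)).mul (this 2 0))).add (((this 0 2).mul (this 1 0)).mul (this 2 1))).sub
    (((this 0 2).mul (this 1 1)).mul (this 2 0))

theorem sm_adjugate (h : Met D G) (i j : Fin 3) : Sm D (fun z => (G z).adjugate i j) := by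
  have h := h.sm
  have key : ∀ a b c d a' b' c' d' : Fin 3,
      Sm D (fun z => G z a b * G z c d - G z a' b' * G z c' d') := fun a b c d a' b' c' d' =>
    ((h a b).mul (h c d)).sub ((h a' b').mul (h c' d'))
  have key' : ∀ a b c d a' b' c' d' : Fin 3,
      Sm D (fun z => -(G z a b * G z c d) + G z a' b' * G z c' d') := fun a b c d a' b' c' d' =>
    ((h a b).mul (h c d)).neg.add ((h a' b').mul (h c' d'))
  simp only [Matrix.adjugate_fin_three]
  fin_cases i <;> fin_cases j <;> simp <;> first | exact key _ _ _ _ _ _ _ _ | exact key' _ _ _ _ _ _ _ _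

theorem sm_inv (h : Met D G) (i j : Fin 3) : Sm D (fun z => (G z)⁻¹ i j) := by
  refine ((h.sm_det.inv fun _ hz => (h.det_pos hz).ne').mul (h.sm_adjugate i j)).congr
    fun z hz => ?_
  simp [Matrix.inv_def]

theorem sm_sqrt_det (h : Met D G) : Sm D (fun z => √(G z).det) :=
  h.sm_det.sqrt fun _ hz => (h.det_pos hz).ne'

theorem sum_inv_mul (h : Met D G) {z : E3} (hz : z ∈ D) (i j : Fin 3) :
    ∑ k, (G z)⁻¹ i k * G z k j = if i = j then 1 else 0 := by
  rw [← Matrix.mul_apply, h.inv_mul hz, Matrix.one_apply]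

theorem sum_mul_inv (h : Met D G) {z : E3} (hz : z ∈ D) (i j : Fin 3) :
    ∑ k, G z i k * (G z)⁻¹ k j = if i = j then 1 else 0 := by
  rw [← Matrix.mul_apply, h.mul_inv hz, Matrix.one_apply]

end Met

/-- The Christoffel symbols of the first kind. -/
def christoffelLow (G : E3 → Matrix (Fin 3) (Fin 3) ℝ) (l i j : Fin 3) (y : E3) : ℝ :=
  (1 / 2) * (pd i (fun z => G z j l) y + pd j (fun z => G z i l) y - pd l (fun z => G z i j) y)

theorem christoffel_eq_low (G : E3 → Matrix (Fin 3) (Fin 3) ℝ) (k i j : Fin 3) (y : E3) :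
    christoffel G k i j y = ∑ l, (G y)⁻¹ k l * christoffelLow G l i j y := by
  simp only [christoffel, christoffelLow, Finset.mul_sum]
  exact Finset.sum_congr rfl fun l _ => by ring

section
variable {D : Set E3} {G : E3 → Matrix (Fin 3) (Fin 3) ℝ}

theorem sm_christoffelLow (hD : Dom D) (h : Met D G) (l i j : Fin 3) :
    Sm D (christoffelLow G l i j) :=
  contDiffOn_const.mul (((hD.sm_pd (h.sm _ _) _).add (hD.sm_pd (h.sm _ _) _)).sub
    (hD.sm_pd (h.sm _ _) _))

theorem sm_christoffel (hD : Dom D) (h : Met D G) (k i j : Fin 3) :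
    Sm D (christoffel G k i j) := by
  refine (ContDiffOn.sum (s := Finset.univ) fun l _ => (h.sm_inv k l).mul
    (sm_christoffelLow hD h l i j)).congr fun y _ => ?_
  rw [christoffel_eq_low]

theorem sm_ricci (hD : Dom D) (h : Met D G) (i j : Fin 3) : Sm D (ricci G i j) := by
  have := sm_christoffel hD h
  exact ContDiffOn.sum fun _ _ => ((hD.sm_pd (this _ _ _) _).sub (hD.sm_pd (this _ _ _) _)).add
    (ContDiffOn.sum fun l _ => ((this _ _ _).mul (this _ _ _)).sub ((this _ _ _).mul (this _ _ _)))

theorem sm_scalar (hD : Dom D) (h : Met D G) : Sm D (scalar G) :=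
  ContDiffOn.sum fun i _ => ContDiffOn.sum fun j _ => (h.sm_inv i j).mul (sm_ricci hD h i j)

theorem sm_hessian (hD : Dom D) (h : Met D G) {f : E3 → ℝ} (hf : Sm D f) (i j : Fin 3) :
    Sm D (hessian G f i j) :=
  (hD.sm_pd (hD.sm_pd hf _) _).sub (ContDiffOn.sum fun _ _ => (sm_christoffel hD h _ _ _).mul
    (hD.sm_pd hf _))

theorem sm_laplacian (hD : Dom D) (h : Met D G) {f : E3 → ℝ} (hf : Sm D f) :
    Sm D (laplacian G f) :=
  ContDiffOn.sum fun i _ => ContDiffOn.sum fun j _ => (h.sm_inv i j).mul (sm_hessian hD h hf i j)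

theorem christoffel_symm (hD : Dom D) (h : Met D G) (k i j : Fin 3) {y : E3} (hy : y ∈ D) :
    christoffel G k i j y = christoffel G k j i y := by
  simp only [christoffel]
  congr 1
  refine Finset.sum_congr rfl fun l _ => ?_
  rw [hD.pd_congr (fun z hz => h.symm hz i j) l hy]
  ring

theorem lower_christoffel (h : Met D G) (k i j : Fin 3) {y : E3} (hy : y ∈ D) :
    ∑ l, G y k l * christoffel G l i j y = christoffelLow G k i j y := by
  simp only [christoffel_eq_low, Finset.mul_sum]
  rw [Finset.sum_comm]
  simp only [← mul_assoc, ← Finset.sum_mul, h.sum_mul_inv hy]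
  simp

theorem pd_metric (hD : Dom D) (h : Met D G) (i j l : Fin 3) {y : E3} (hy : y ∈ D) :
    pd i (fun z => G z j l) y = christoffelLow G l i j y + christoffelLow G j i l y := by
  simp only [christoffelLow]
  rw [hD.pd_congr (fun z hz => h.symm hz l j) i hy]
  ring

end

/-! ### Coordinate changes -/

/-- `τ` is a smooth map from `D` to `D'` that pulls the metric `G` on `D'` back to `G'` on `D`. -/
structure Trans (D D' : Set E3) (G' G : E3 → Matrix (Fin 3) (Fin 3) ℝ) (τ : E3 → E3) : Prop where
  dom : Dom D
  dom' : Dom D'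
  met : Met D G'
  met' : Met D' G
  sm : ContDiffOn ℝ ∞ τ D
  maps : MapsTo τ D D'
  pull : ∀ y ∈ D, G' y = (jac τ y)ᵀ * G (τ y) * jac τ y

namespace Trans

variable {D D' : Set E3} {G' G : E3 → Matrix (Fin 3) (Fin 3) ℝ} {τ : E3 → E3}
  (T : Trans D D' G' G τ)
include T

/-- Invertibility need not be part of `Trans`: a singular Jacobian would make the positive definite
pull-back `G'` singular. -/
theorem det_ne_zero {y : E3} (hy : y ∈ D) : (jac τ y).det ≠ 0 := by
  have h := T.met.det_pos hy
  rw [T.pull y hy, Matrix.det_mul] at h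
  exact (right_ne_zero_of_mul h.ne')

theorem inv_mul {y : E3} (hy : y ∈ D) : (jac τ y)⁻¹ * jac τ y = 1 :=
  Matrix.nonsing_inv_mul _ (T.det_ne_zero hy).isUnit

theorem mul_inv {y : E3} (hy : y ∈ D) : jac τ y * (jac τ y)⁻¹ = 1 :=
  Matrix.mul_nonsing_inv _ (T.det_ne_zero hy).isUnit

/-- This arrangement allows contraction with the inverse metric without inverting the Jacobian; it
is the whole content of `contract`. -/
theorem inv_eq {y : E3} (hy : y ∈ D) :
    jac τ y * (G' y)⁻¹ * (jac τ y)ᵀ = (G (τ y))⁻¹ := by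
  have h := T.pull y hy
  have hu : IsUnit (jac τ y).det := (T.det_ne_zero hy).isUnit
  have hu' : IsUnit (jac τ y)ᵀ.det := by rwa [Matrix.det_transpose]
  rw [h, Matrix.mul_inv_rev, Matrix.mul_inv_rev, ← mul_assoc, Matrix.mul_nonsing_inv _ hu, one_mul,
    mul_assoc, Matrix.nonsing_inv_mul _ hu', mul_one]

theorem pull_apply {y : E3} (hy : y ∈ D) (i j : Fin 3) :
    G' y i j = ∑ a, ∑ b, jac τ y a i * jac τ y b j * G (τ y) a b := by
  rw [T.pull y hy]
  simp only [Matrix.mul_apply, Matrix.transpose_apply, Finset.sum_mul]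
  rw [Finset.sum_comm]
  exact Finset.sum_congr rfl fun a _ => Finset.sum_congr rfl fun b _ => by ring

theorem pd_pull {y : E3} (hy : y ∈ D) (k i j : Fin 3) :
    pd k (fun z => G' z i j) y = ∑ a, ∑ b, (
      pd k (fun z => jac τ z a i) y * jac τ y b j * G (τ y) a b +
      jac τ y a i * pd k (fun z => jac τ z b j) y * G (τ y) a b +
      ∑ c, jac τ y a i * jac τ y b j * jac τ y c k * pd c (fun z => G z a b) (τ y)) := by
  have hJ := T.dom.sm_jac T.sm
  have hG : ∀ a b, Sm D (fun z => G (τ z) a b) := fun a b =>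
    Sm.comp_map T.sm T.maps (T.met'.sm a b)
  rw [T.dom.pd_congr (fun z hz => T.pull_apply hz i j) k hy,
    T.dom.pd_sum _ (fun a _ => ContDiffOn.sum fun b _ => ((hJ a i).mul (hJ b j)).mul (hG a b)) k hy]
  refine Finset.sum_congr rfl fun a _ => ?_
  rw [T.dom.pd_sum _ (fun b _ => ((hJ a i).mul (hJ b j)).mul (hG a b)) k hy]
  refine Finset.sum_congr rfl fun b _ => ?_
  rw [T.dom.pd_mul ((hJ a i).mul (hJ b j)) (hG a b) k hy, T.dom.pd_mul (hJ a i) (hJ b j) k hy,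
    T.dom.pd_comp T.dom' T.sm T.maps (T.met'.sm a b) k hy, Finset.mul_sum]
  rw [add_mul]
  congr 1
  exact Finset.sum_congr rfl fun c _ => by ring

/-- In the combination of the derivatives of `Jᵀ G J` the derivatives of `G` assemble into the
symbols of `G`. Among the second derivatives of `τ` only those in the directions `i`, `j` survive;
the others cancel in pairs. -/
theorem christoffelLow_eq {y : E3} (hy : y ∈ D) (l i j : Fin 3) :
    christoffelLow G' l i j y = ∑ a, jac τ y a l *
      (∑ b, ∑ c, jac τ y b i * jac τ y c j * christoffelLow G a b c (τ y) +
        ∑ b, G (τ y) a b * pd i (fun z => jac τ z b j) y) := by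
  have s := fun a b => T.met'.symm (T.maps hy) a b
  have s1 := fun a b c => T.dom'.pd_congr (fun z hz => T.met'.symm hz a b) c (T.maps hy)
  have hc := fun a b c => T.dom.pd_jac_comm T.sm a b c hy
  simp only [christoffelLow, T.pd_pull hy]
  simp only [Fin.sum_univ_three]
  -- One ordering is fixed for each symmetric pair of indices; after that the identity is
  -- polynomial.
  simp only [hc _ j i, hc _ l i, hc _ l j, s 1 0, s 2 0, s 2 1, s1 1 0, s1 2 0, s1 2 1]
  ring

/-- Multiplication by the Jacobian keeps its inverse out of the formula. The second derivatives of
`τ` form the inhomogeneous term whose cancellation makes Hessian, divergence and curvature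
tensorial. -/
theorem christoffel_eq {y : E3} (hy : y ∈ D) (c i j : Fin 3) :
    ∑ k, jac τ y c k * christoffel G' k i j y =
      ∑ a, ∑ b, christoffel G c a b (τ y) * jac τ y a i * jac τ y b j +
        pd i (fun z => jac τ z c j) y := by
  have h1 : ∀ a, ∑ k, ∑ l, jac τ y c k * (G' y)⁻¹ k l * jac τ y a l = (G (τ y))⁻¹ c a := by
    intro a
    rw [← T.inv_eq hy, Matrix.mul_apply, Finset.sum_comm]
    refine Finset.sum_congr rfl fun k _ => ?_
    rw [Matrix.mul_apply, Finset.sum_mul]; rfl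
  obtain ⟨B, hB⟩ : ∃ B : Fin 3 → ℝ, ∀ a, B a =
      ∑ b, ∑ c, jac τ y b i * jac τ y c j * christoffelLow G a b c (τ y) +
        ∑ b, G (τ y) a b * pd i (fun z => jac τ z b j) y := ⟨_, fun _ => rfl⟩
  have hl : ∀ l, christoffelLow G' l i j y = ∑ a, jac τ y a l * B a := fun l => by
    simp only [T.christoffelLow_eq hy, hB]
  have h2 : ∑ k, jac τ y c k * christoffel G' k i j y = ∑ a, (G (τ y))⁻¹ c a * B a := by
    have hr : ∑ a, (G (τ y))⁻¹ c a * B a =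
        ∑ a, (∑ k, ∑ l, jac τ y c k * (G' y)⁻¹ k l * jac τ y a l) * B a :=
      Finset.sum_congr rfl fun a _ => by rw [h1 a]
    simp only [hr, christoffel_eq_low, hl]
    simp only [Fin.sum_univ_three]; ring
  have h3 : ∑ a, (G (τ y))⁻¹ c a * ∑ b, G (τ y) a b * pd i (fun z => jac τ z b j) y =
      pd i (fun z => jac τ z c j) y := by
    simp only [Finset.mul_sum]
    rw [Finset.sum_comm]
    simp only [← mul_assoc, ← Finset.sum_mul, T.met'.sum_inv_mul (T.maps hy)]
    simp
  rw [h2, ← h3]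
  simp only [hB, christoffel_eq_low, mul_add, Finset.sum_add_distrib]
  congr 1
  simp only [Fin.sum_univ_three]; ring

end Trans

/-! ### Curvature of connection matrices; tensoriality of Ricci curvature and Hessian -/

/-- The partial derivative of a matrix-valued function. -/
def mpd (i : Fin 3) (A : E3 → Matrix (Fin 3) (Fin 3) ℝ) (y : E3) : Matrix (Fin 3) (Fin 3) ℝ :=
  Matrix.of fun a b => pd i (fun z => A z a b) y

/-- Matrix-valued functions with smooth entries. -/
def MSm (D : Set E3) (A : E3 → Matrix (Fin 3) (Fin 3) ℝ) : Prop := ∀ a b, Sm D (fun z => A z a b)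

section
variable {D : Set E3} {A B : E3 → Matrix (Fin 3) (Fin 3) ℝ}

theorem MSm.mul (hA : MSm D A) (hB : MSm D B) : MSm D (fun z => A z * B z) := fun a b => by
  simp only [Matrix.mul_apply]
  exact ContDiffOn.sum fun k _ => (hA a k).mul (hB k b)

theorem MSm.mpd (hD : Dom D) (hA : MSm D A) (i : Fin 3) : MSm D (mpd i A) :=
  fun a b => hD.sm_pd (hA a b) i

theorem mpd_congr (hD : Dom D) (h : EqOn A B D) (i : Fin 3) {y : E3} (hy : y ∈ D) :
    mpd i A y = mpd i B y := by
  ext a b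
  exact hD.pd_congr (fun z hz => by rw [h hz]) i hy

theorem mpd_mul (hD : Dom D) (hA : MSm D A) (hB : MSm D B) (i : Fin 3) {y : E3} (hy : y ∈ D) :
    mpd i (fun z => A z * B z) y = mpd i A y * B y + A y * mpd i B y := by
  ext a b
  simp only [mpd, Matrix.of_apply, Matrix.add_apply, Matrix.mul_apply]
  rw [hD.pd_sum _ (fun k _ => (hA a k).mul (hB k b)) i hy, ← Finset.sum_add_distrib]
  exact Finset.sum_congr rfl fun k _ => hD.pd_mul (hA a k) (hB k b) i hy

theorem mpd_add (hD : Dom D) (hA : MSm D A) (hB : MSm D B) (i : Fin 3) {y : E3} (hy : y ∈ D) :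
    mpd i (fun z => A z + B z) y = mpd i A y + mpd i B y := by
  ext a b
  exact hD.pd_add (hA a b) (hB a b) i hy

end

/-- The connection matrices of the Levi-Civita connection. -/
def conn (G : E3 → Matrix (Fin 3) (Fin 3) ℝ) (i : Fin 3) (y : E3) : Matrix (Fin 3) (Fin 3) ℝ :=
  Matrix.of fun k j => christoffel G k i j y

/-- The curvature matrices of a family of connection matrices. -/
def curv (Γ : Fin 3 → E3 → Matrix (Fin 3) (Fin 3) ℝ) (i j : Fin 3) (y : E3) :
    Matrix (Fin 3) (Fin 3) ℝ :=
  mpd i (Γ j) y - mpd j (Γ i) y + (Γ i y * Γ j y - Γ j y * Γ i y)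

/-- Curvature matrices transform by conjugation, so the transformation of the Ricci curvature is
obtained from its description as a trace of them. -/
theorem ricci_eq_curv {D : Set E3} (hD : Dom D) {G : E3 → Matrix (Fin 3) (Fin 3) ℝ} (h : Met D G)
    (i j : Fin 3) {y : E3} (hy : y ∈ D) : ricci G i j y = ∑ k, curv (conn G) k j y k i := by
  refine Finset.sum_congr rfl fun k _ => ?_
  simp only [curv, mpd, conn, Matrix.sub_apply, Matrix.add_apply, Matrix.mul_apply, Matrix.of_apply]
  rw [hD.pd_congr (fun z hz => christoffel_symm hD h k i j hz) k hy,
    hD.pd_congr (fun z hz => christoffel_symm hD h k i k hz) j hy, Finset.sum_sub_distrib]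
  simp only [fun l => christoffel_symm hD h l i j hy, fun l => christoffel_symm hD h l i k hy]

namespace Trans

variable {D D' : Set E3} {G' G : E3 → Matrix (Fin 3) (Fin 3) ℝ} {τ : E3 → E3}
  (T : Trans D D' G' G τ)
include T

/-- The pulled back connection matrices, in the frame of the target. -/
def pconn (_ : Trans D D' G' G τ) (i : Fin 3) (y : E3) : Matrix (Fin 3) (Fin 3) ℝ :=
  Matrix.of fun c b => ∑ a, jac τ y a i * conn G a (τ y) c b

theorem msm_jac : MSm D (jac τ) := T.dom.sm_jac T.sm

theorem msm_conn (i : Fin 3) : MSm D (conn G' i) := fun a b => sm_christoffel T.dom T.met a i b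

theorem sm_conn_comp (a c b : Fin 3) : Sm D (fun z => conn G a (τ z) c b) :=
  Sm.comp_map T.sm T.maps (sm_christoffel T.dom' T.met' c a b)

theorem msm_pconn (i : Fin 3) : MSm D (T.pconn i) := fun c b => by
  simp only [pconn, Matrix.of_apply]
  exact ContDiffOn.sum fun a _ => (T.msm_jac a i).mul (T.sm_conn_comp a c b)

/-- The transformation law of the Christoffel symbols, read as a gauge transformation by the matrix
`jac τ`. -/
theorem gauge {y : E3} (hy : y ∈ D) (i : Fin 3) :
    jac τ y * conn G' i y = T.pconn i y * jac τ y + mpd i (jac τ) y := by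
  ext c j
  simp only [Matrix.mul_apply, Matrix.add_apply, conn, mpd, Matrix.of_apply, pconn]
  rw [T.christoffel_eq hy, Finset.sum_comm]
  congr 1
  refine Finset.sum_congr rfl fun b _ => ?_
  rw [Finset.sum_mul]
  exact Finset.sum_congr rfl fun a _ => by ring

theorem mpd_jac_comm {y : E3} (hy : y ∈ D) (i j : Fin 3) :
    mpd i (mpd j (jac τ)) y = mpd j (mpd i (jac τ)) y := by
  ext a b
  exact T.dom.pd_comm (T.msm_jac a b) i j hy

/-- When the gauge law is differentiated and antisymmetrised in `i`, `j`, the second derivatives of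
the Jacobian cancel. Its first derivatives are then eliminated by the gauge law itself. -/
theorem gauge_curv {y : E3} (hy : y ∈ D) (i j : Fin 3) :
    jac τ y * curv (conn G') i j y = curv T.pconn i j y * jac τ y := by
  have hd : ∀ i j, mpd i (jac τ) y * conn G' j y + jac τ y * mpd i (conn G' j) y =
      mpd i (T.pconn j) y * jac τ y + T.pconn j y * mpd i (jac τ) y + mpd i (mpd j (jac τ)) y := by
    intro i j
    rw [← mpd_mul T.dom T.msm_jac (T.msm_conn j) i hy, ← mpd_mul T.dom (T.msm_pconn j) T.msm_jac i hy,
      ← mpd_add T.dom ((T.msm_pconn j).mul T.msm_jac) (T.msm_jac.mpd T.dom j) i hy]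
    exact mpd_congr T.dom (fun z hz => T.gauge hz j) i hy
  have g := T.gauge hy
  have h1 : jac τ y * mpd i (conn G' j) y - jac τ y * mpd j (conn G' i) y =
      (mpd i (T.pconn j) y - mpd j (T.pconn i) y) * jac τ y +
      T.pconn j y * mpd i (jac τ) y - T.pconn i y * mpd j (jac τ) y
      - mpd i (jac τ) y * conn G' j y + mpd j (jac τ) y * conn G' i y := by
    have e1 := hd i j
    have e2 := hd j i
    rw [T.mpd_jac_comm hy j i] at e2
    rw [eq_sub_of_add_eq' e1, eq_sub_of_add_eq' e2]
    noncomm_ring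
  have e : ∀ i, mpd i (jac τ) y = jac τ y * conn G' i y - T.pconn i y * jac τ y := fun i => by
    rw [g]; abel
  simp only [curv]
  rw [mul_add, mul_sub, h1, e i, e j]
  noncomm_ring

/-- Curvature is a matrix-valued two-form and commutes with pull-back: the derivatives of the
Jacobian enter symmetrically in `i`, `j` and cancel. -/
theorem curv_pconn {y : E3} (hy : y ∈ D) (i j : Fin 3) (c d : Fin 3) :
    curv T.pconn i j y c d = ∑ a, ∑ b, jac τ y a i * jac τ y b j * curv (conn G) a b (τ y) c d := by
  have hm : ∀ i j c d, mpd i (T.pconn j) y c d = ∑ b, (pd i (fun z => jac τ z b j) y *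
      conn G b (τ y) c d + jac τ y b j * ∑ a, jac τ y a i * mpd a (conn G b) (τ y) c d) := by
    intro i j c d
    simp only [mpd, Matrix.of_apply, pconn]
    rw [T.dom.pd_sum _ (fun b _ => (T.msm_jac b j).mul (T.sm_conn_comp b c d)) i hy]
    refine Finset.sum_congr rfl fun b _ => ?_
    rw [T.dom.pd_mul (T.msm_jac b j) (T.sm_conn_comp b c d) i hy]
    congr 2
    exact T.dom.pd_comp T.dom' T.sm T.maps (sm_christoffel T.dom' T.met' c b d) i hy
  simp only [curv, Matrix.add_apply, Matrix.sub_apply, hm, Matrix.mul_apply]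
  simp only [T.dom.pd_jac_comm T.sm _ j i hy, pconn, Matrix.of_apply, Fin.sum_univ_three]
  ring

/-- The curvature of `G'` is conjugate to the pulled-back curvature. In the trace over `k` one
factor `jac τ` meets `(jac τ)⁻¹`, which leaves the two factors of a covariant 2-tensor. -/
theorem ricci_eq {y : E3} (hy : y ∈ D) (i j : Fin 3) :
    ricci G' i j y = ∑ a, ∑ b, jac τ y a i * jac τ y b j * ricci G a b (τ y) := by
  have h1 : ∀ k, curv (conn G') k j y = (jac τ y)⁻¹ * curv T.pconn k j y * jac τ y := by
    intro k
    rw [mul_assoc, ← T.gauge_curv hy, ← mul_assoc, T.inv_mul hy, one_mul]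
  have h2 : ∀ a c, ∑ k, jac τ y a k * (jac τ y)⁻¹ k c = if a = c then 1 else 0 := by
    intro a c
    rw [← Matrix.mul_apply, T.mul_inv hy, Matrix.one_apply]
  rw [ricci_eq_curv T.dom T.met _ _ hy]
  simp only [h1, Matrix.mul_apply, T.curv_pconn hy]
  simp only [fun a b => ricci_eq_curv T.dom' T.met' a b (T.maps hy)]
  have : ∀ k, ∑ x, (∑ x_1, (jac τ y)⁻¹ k x_1 * ∑ a, ∑ b, jac τ y a k * jac τ y b j *
      curv (conn G) a b (τ y) x_1 x) * jac τ y x i = ∑ x, ∑ b, ∑ a, ∑ c,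
      (jac τ y a k * (jac τ y)⁻¹ k c) * (jac τ y x i * jac τ y b j *
      curv (conn G) a b (τ y) c x) := by
    intro k
    refine Finset.sum_congr rfl fun x _ => ?_
    simp only [Finset.mul_sum, Finset.sum_mul]
    rw [Finset.sum_comm]
    rw [Finset.sum_comm' (t' := Finset.univ) (s' := fun _ => Finset.univ) (by simp)]
    simp only [Fin.sum_univ_three]; ring
  simp only [this]
  rw [Finset.sum_comm]
  refine Finset.sum_congr rfl fun x _ => ?_
  rw [Finset.sum_comm]
  refine Finset.sum_congr rfl fun b _ => ?_
  rw [Finset.sum_comm, Finset.mul_sum]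
  refine Finset.sum_congr rfl fun a _ => ?_
  rw [Finset.sum_comm]
  simp only [← Finset.sum_mul, h2]
  simp

theorem contract {y : E3} (hy : y ∈ D) {S' S : Fin 3 → Fin 3 → ℝ}
    (hS : ∀ i j, S' i j = ∑ a, ∑ b, jac τ y a i * jac τ y b j * S a b) :
    ∑ i, ∑ j, (G' y)⁻¹ i j * S' i j = ∑ a, ∑ b, (G (τ y))⁻¹ a b * S a b := by
  simp only [← T.inv_eq hy, hS, Matrix.mul_apply, Matrix.transpose_apply, Fin.sum_univ_three]
  ring

theorem scalar_eq {y : E3} (hy : y ∈ D) : scalar G' y = scalar G (τ y) :=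
  T.contract hy (T.ricci_eq hy)

/-- The second derivatives of `τ` produced by the chain rule are exactly the inhomogeneous term of
`christoffel_eq`, and the two cancel. -/
theorem hessian_eq {f : E3 → ℝ} (hf : Sm D' f) {y : E3} (hy : y ∈ D) (i j : Fin 3) :
    hessian G' (fun z => f (τ z)) i j y =
      ∑ a, ∑ b, jac τ y a i * jac τ y b j * hessian G f a b (τ y) := by
  have hf1 := T.dom'.sm_pd hf
  have hfc : ∀ a, Sm D (fun z => pd a f (τ z)) := fun a => Sm.comp_map T.sm T.maps (hf1 a)
  have h1 : pd i (pd j (fun z => f (τ z))) y = ∑ a, (pd i (fun z => jac τ z a j) y * pd a f (τ y)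
      + jac τ y a j * ∑ b, jac τ y b i * pd b (pd a f) (τ y)) := by
    rw [T.dom.pd_congr (fun z hz => T.dom.pd_comp T.dom' T.sm T.maps hf j hz) i hy,
      T.dom.pd_sum _ (fun a _ => (T.msm_jac a j).mul (hfc a)) i hy]
    refine Finset.sum_congr rfl fun a _ => ?_
    rw [T.dom.pd_mul (T.msm_jac a j) (hfc a) i hy,
      T.dom.pd_comp T.dom' T.sm T.maps (hf1 a) i hy]
  have h2 : ∑ k, christoffel G' k i j y * pd k (fun z => f (τ z)) y =
      ∑ c, (∑ a, ∑ b, christoffel G c a b (τ y) * jac τ y a i * jac τ y b j +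
        pd i (fun z => jac τ z c j) y) * pd c f (τ y) := by
    simp only [← T.christoffel_eq hy, T.dom.pd_comp T.dom' T.sm T.maps hf _ hy, Finset.mul_sum,
      Finset.sum_mul]
    rw [Finset.sum_comm]
    exact Finset.sum_congr rfl fun a _ => Finset.sum_congr rfl fun b _ => by ring
  simp only [hessian, h1, h2, fun a b => T.dom'.pd_comm hf a b (T.maps hy)]
  simp only [Fin.sum_univ_three, T.dom'.pd_comm hf 1 0 (T.maps hy),
    T.dom'.pd_comm hf 2 0 (T.maps hy), T.dom'.pd_comm hf 2 1 (T.maps hy)]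
  ring

theorem laplacian_eq {f : E3 → ℝ} (hf : Sm D' f) {y : E3} (hy : y ∈ D) :
    laplacian G' (fun z => f (τ z)) y = laplacian G f (τ y) :=
  T.contract hy (T.hessian_eq hf hy)

end Trans

/-! ### The divergence in coordinates -/

section
variable {D : Set E3} {G : E3 → Matrix (Fin 3) (Fin 3) ℝ}

/-- Jacobi's formula, verified on the expanded 3×3 determinant and its adjugate. -/
theorem pd_det (hD : Dom D) (h : Met D G) (k : Fin 3) {y : E3} (hy : y ∈ D) :
    pd k (fun z => (G z).det) y =
      (G y).det * ∑ l, ∑ m, (G y)⁻¹ l m * pd k (fun z => G z m l) y := by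
  have hs := h.sm
  have hd : ∀ l m, (G y).det * (G y)⁻¹ l m = (G y).adjugate l m := by
    intro l m
    rw [Matrix.inv_def, Matrix.smul_apply, smul_eq_mul, ← mul_assoc, Ring.inverse_eq_inv',
      mul_inv_cancel₀ (h.det_pos hy).ne', one_mul]
  simp only [Finset.mul_sum, ← mul_assoc, hd]
  have key : ∀ a b c d e f : Fin 3, Sm D (fun z => G z a b * G z c d * G z e f) :=
    fun a b c d e f => ((hs a b).mul (hs c d)).mul (hs e f)
  have pkey : ∀ a b c d e f : Fin 3, pd k (fun z => G z a b * G z c d * G z e f) y =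
      (pd k (fun z => G z a b) y * G y c d + G y a b * pd k (fun z => G z c d) y) * G y e f +
        G y a b * G y c d * pd k (fun z => G z e f) y := fun a b c d e f => by
    rw [hD.pd_mul ((hs a b).mul (hs c d)) (hs e f) k hy, hD.pd_mul (hs a b) (hs c d) k hy]
  simp only [Matrix.det_fin_three]
  have s1 := (key 0 0 1 1 2 2).sub (key 0 0 1 2 2 1)
  have s2 := s1.sub (key 0 1 1 0 2 2)
  have s3 := s2.add (key 0 1 1 2 2 0)
  have s4 := s3.add (key 0 2 1 0 2 1)
  rw [hD.pd_sub s4 (key 0 2 1 1 2 0) k hy, hD.pd_add s3 (key 0 2 1 0 2 1) k hy,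
    hD.pd_add s2 (key 0 1 1 2 2 0) k hy, hD.pd_sub s1 (key 0 1 1 0 2 2) k hy,
    hD.pd_sub (key 0 0 1 1 2 2) (key 0 0 1 2 2 1) k hy]
  simp only [pkey, Fin.sum_univ_three, Matrix.adjugate_fin_three]
  simp
  ring

theorem christoffel_trace (hD : Dom D) (h : Met D G) (k : Fin 3) {y : E3} (hy : y ∈ D) :
    ∑ l, christoffel G l k l y =
      (1 / 2) * ∑ l, ∑ m, (G y)⁻¹ l m * pd k (fun z => G z m l) y := by
  have s1 := fun a b c => hD.pd_congr (fun z hz => h.symm hz a b) c hy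
  simp only [christoffel_eq_low, christoffelLow, Fin.sum_univ_three, h.inv_symm hy 1 0,
    h.inv_symm hy 2 0, h.inv_symm hy 2 1, s1 1 0, s1 2 0, s1 2 1]
  ring

/-- By Jacobi's formula the logarithmic derivative of `√det G` is the trace of the Christoffel
symbols. Hence the divergence is the trace of the covariant derivative `∇X`, a form that can be
transformed. -/
theorem divergence_eq (hD : Dom D) (h : Met D G) {X : E3 → Fin 3 → ℝ}
    (hX : ∀ k, Sm D (fun z => X z k)) {y : E3} (hy : y ∈ D) :
    divergence G X y = ∑ k, (pd k (fun z => X z k) y + ∑ l, christoffel G l k l y * X y k) := by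
  have hp := h.det_pos hy
  have hs : 0 < √(G y).det := Real.sqrt_pos.2 hp
  have h1 : ∀ k, pd k (fun z => √(G z).det) y = √(G y).det * ∑ l, christoffel G l k l y := by
    intro k
    rw [hD.pd_comp_real h.sm_det (Real.hasDerivAt_sqrt hp.ne') k hy, pd_det hD h k hy,
      christoffel_trace hD h k hy]
    have : (G y).det = √(G y).det * √(G y).det := (Real.mul_self_sqrt hp.le).symm
    nth_rw 2 [this]
    field_simp
  rw [divergence, Finset.mul_sum]
  refine Finset.sum_congr rfl fun k _ => ?_
  rw [hD.pd_mul h.sm_sqrt_det (hX k) k hy, h1, ← Finset.sum_mul]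
  field_simp
  ring

theorem sm_divergence (hD : Dom D) (h : Met D G) {X : E3 → Fin 3 → ℝ}
    (hX : ∀ k, Sm D (fun z => X z k)) : Sm D (divergence G X) :=
  (ContDiffOn.sum fun k _ => (hD.sm_pd (hX k) k).add
    (ContDiffOn.sum fun l _ => (sm_christoffel hD h l k l).mul (hX k))).congr
    fun _ hy => divergence_eq hD h hX hy

theorem divergence_congr (hD : Dom D) {X Y : E3 → Fin 3 → ℝ} (h : EqOn X Y D)
    {y : E3} (hy : y ∈ D) : divergence G X y = divergence G Y y := by
  simp only [divergence]
  congr 1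
  refine Finset.sum_congr rfl fun k _ => ?_
  exact hD.pd_congr (fun z hz => by simp only [h hz]) k hy

end

theorem Trans.divergence_eq {D D' : Set E3} {G' G : E3 → Matrix (Fin 3) (Fin 3) ℝ} {τ : E3 → E3}
    (T : Trans D D' G' G τ) {X' X : E3 → Fin 3 → ℝ} (hX' : ∀ k, Sm D (fun z => X' z k))
    (hX : ∀ k, Sm D' (fun z => X z k)) (h : ∀ z ∈ D, ∀ a, ∑ k, jac τ z a k * X' z k = X (τ z) a)
    {y : E3} (hy : y ∈ D) : divergence G' X' y = divergence G X (τ y) := by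
  obtain ⟨N', hN'⟩ : ∃ A : Matrix (Fin 3) (Fin 3) ℝ, A = Matrix.of fun k i =>
    pd i (fun z => X' z k) y + ∑ l, christoffel G' k i l y * X' y l := ⟨_, rfl⟩
  obtain ⟨N, hN⟩ : ∃ A : Matrix (Fin 3) (Fin 3) ℝ, A = Matrix.of fun k i =>
    pd i (fun z => X z k) (τ y) + ∑ l, christoffel G k i l (τ y) * X (τ y) l := ⟨_, rfl⟩
  have e' : divergence G' X' y = N'.trace := by
    rw [Bartnik.divergence_eq T.dom T.met hX' hy, Matrix.trace_fin_three]
    have c := fun a b c => christoffel_symm T.dom T.met a b c hy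
    simp only [hN', Matrix.of_apply, Fin.sum_univ_three, c _ 1 0, c _ 2 0, c _ 2 1]
    ring
  have e : divergence G X (τ y) = N.trace := by
    rw [Bartnik.divergence_eq T.dom' T.met' hX (T.maps hy), Matrix.trace_fin_three]
    have c := fun a b c => christoffel_symm T.dom' T.met' a b c (T.maps hy)
    simp only [hN, Matrix.of_apply, Fin.sum_univ_three, c _ 1 0, c _ 2 0, c _ 2 1]
    ring
  -- The relation `J X' = X ∘ τ` is differentiated; the second derivatives of `τ` cancel against
  -- `christoffel_eq`. So the matrices of `∇X'` and `∇X` are conjugate and have the same trace.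
  have key : jac τ y * N' = N * jac τ y := by
    ext a i
    have h1 : ∑ k, (pd i (fun z => jac τ z a k) y * X' y k +
        jac τ y a k * pd i (fun z => X' z k) y) = ∑ b, jac τ y b i * pd b (fun z => X z a) (τ y) := by
      rw [← T.dom.pd_comp T.dom' T.sm T.maps (hX a) i hy, ← T.dom.pd_congr (fun z hz => h z hz a) i hy,
        T.dom.pd_sum _ (fun k _ => (T.msm_jac a k).mul (hX' k)) i hy]
      exact Finset.sum_congr rfl fun k _ => (T.dom.pd_mul (T.msm_jac a k) (hX' k) i hy).symm
    have h2 : ∀ l, ∑ k, jac τ y a k * christoffel G' k i l y = _ := fun l =>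
      T.christoffel_eq hy a i l
    simp only [Matrix.mul_apply, hN', hN, Matrix.of_apply, ← h y hy]
    have h3 : ∑ k, jac τ y a k * ∑ l, christoffel G' k i l y * X' y l =
        ∑ l, (∑ k, jac τ y a k * christoffel G' k i l y) * X' y l := by
      simp only [Finset.mul_sum, Finset.sum_mul, mul_assoc]
      rw [Finset.sum_comm]
    simp only [mul_add, Finset.sum_add_distrib, h3, h2]
    simp only [Fin.sum_univ_three] at h1 ⊢
    linear_combination h1
  have : N' = (jac τ y)⁻¹ * N * jac τ y := by
    rw [mul_assoc, ← key, ← mul_assoc, T.inv_mul hy, one_mul]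
  rw [e', e, this, Matrix.trace_mul_comm, ← mul_assoc, T.mul_inv hy, one_mul]

/-! ### Normal coordinates -/

-- A positive definite matrix is `B* B` with `B` invertible, and `B⁻¹` orthonormalises it.
open scoped MatrixOrder Matrix.Norms.L2Operator in
theorem exists_orthonormalising {A : Matrix (Fin 3) (Fin 3) ℝ} (hA : A.PosDef) :
    ∃ L : Matrix (Fin 3) (Fin 3) ℝ, IsUnit L.det ∧ Lᵀ * A * L = 1 := by
  obtain ⟨B, hB, h⟩ := CStarAlgebra.isStrictlyPositive_iff_eq_star_mul_self.mp hA.isStrictlyPositive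
  have hu : IsUnit B.det := (Matrix.isUnit_iff_isUnit_det _).1 hB
  have hu' : IsUnit Bᵀ.det := by rwa [Matrix.det_transpose]
  have hs : star B = Bᵀ := by
    rw [Matrix.star_eq_conjTranspose, Matrix.conjTranspose_eq_transpose_of_trivial]
  refine ⟨B⁻¹, by rw [Matrix.det_nonsing_inv]; exact hu.ringInverse, ?_⟩
  rw [h, hs, Matrix.transpose_nonsing_inv, ← mul_assoc, Matrix.nonsing_inv_mul _ hu', one_mul,
    Matrix.mul_nonsing_inv _ hu]

theorem dom_HS : Dom HS := ⟨univ, isOpen_univ, by simp⟩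

theorem sm_proj (D : Set E3) (k : Fin 3) : Sm D (fun z => z k) :=
  (EuclideanSpace.proj (𝕜 := ℝ) k).contDiff.contDiffOn

theorem pd_proj {y : E3} (hy : y ∈ HS) (i k : Fin 3) :
    pd i (fun z => z k) y = if k = i then 1 else 0 := by
  have h := ((EuclideanSpace.proj (𝕜 := ℝ) k).hasFDerivAt (x := y)).hasFDerivWithinAt.fderivWithin
    (uniqueDiffOn_HS y hy)
  have : (fun z : E3 => z k) = (EuclideanSpace.proj (𝕜 := ℝ) k) := rfl
  rw [pd, this, h]
  simp

/-- The quadratic map with value `y`, Jacobian matrix `L` and second derivatives `-Q` at `y`. -/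
def quadMap (y : E3) (L : Matrix (Fin 3) (Fin 3) ℝ) (Q : Fin 3 → Fin 3 → Fin 3 → ℝ) (z : E3) : E3 :=
  WithLp.toLp 2 fun c => y c + (∑ k, L c k * (z k - y k) -
    (1 / 2) * ∑ i, ∑ j, Q c i j * ((z i - y i) * (z j - y j)))

theorem quadMap_apply (y : E3) (L : Matrix (Fin 3) (Fin 3) ℝ) (Q : Fin 3 → Fin 3 → Fin 3 → ℝ)
    (z : E3) (c : Fin 3) : quadMap y L Q z c = y c + (∑ k, L c k * (z k - y k) -
    (1 / 2) * ∑ i, ∑ j, Q c i j * ((z i - y i) * (z j - y j))) := rfl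

theorem contDiff_quadMap (y : E3) (L : Matrix (Fin 3) (Fin 3) ℝ) (Q : Fin 3 → Fin 3 → Fin 3 → ℝ) :
    ContDiff ℝ ∞ (quadMap y L Q) := by
  rw [contDiff_euclidean]
  intro c
  simp only [quadMap_apply]
  have h : ∀ k, ContDiff ℝ ∞ (fun z : E3 => z k - y k) := fun k =>
    (EuclideanSpace.proj (𝕜 := ℝ) k).contDiff.sub contDiff_const
  exact contDiff_const.add ((ContDiff.sum fun k _ => contDiff_const.mul (h k)).sub
    (contDiff_const.mul (ContDiff.sum fun i _ => ContDiff.sum fun j _ =>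
      contDiff_const.mul ((h i).mul (h j)))))

theorem jac_quadMap (y : E3) (L : Matrix (Fin 3) (Fin 3) ℝ) {Q : Fin 3 → Fin 3 → Fin 3 → ℝ}
    (hQ : ∀ c i j, Q c i j = Q c j i) {z : E3} (hz : z ∈ HS) (c i : Fin 3) :
    jac (quadMap y L Q) z c i = L c i - ∑ j, Q c i j * (z j - y j) := by
  have hk : ∀ k, Sm HS (fun z => z k - y k) := fun k => (sm_proj HS k).sub contDiffOn_const
  have pk : ∀ k, pd i (fun z => z k - y k) z = if k = i then 1 else 0 := fun k => by
    rw [dom_HS.pd_sub (sm_proj HS k) contDiffOn_const i hz, Dom.pd_const, sub_zero, pd_proj hz]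
  have h1 : Sm HS (fun z => ∑ k, L c k * (z k - y k)) :=
    ContDiffOn.sum fun k _ => contDiffOn_const.mul (hk k)
  have hq : ∀ a b, Sm HS (fun z => Q c a b * ((z a - y a) * (z b - y b))) := fun a b =>
    contDiffOn_const.mul ((hk a).mul (hk b))
  have h2 : Sm HS (fun z => ∑ a, ∑ b, Q c a b * ((z a - y a) * (z b - y b))) :=
    ContDiffOn.sum fun a _ => ContDiffOn.sum fun b _ => hq a b
  rw [jac_apply]
  simp only [quadMap_apply]
  rw [dom_HS.pd_add contDiffOn_const (h1.sub (contDiffOn_const.mul h2)) i hz, Dom.pd_const,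
    dom_HS.pd_sub h1 (contDiffOn_const.mul h2) i hz, dom_HS.pd_const_mul _ h2 i hz,
    dom_HS.pd_sum _ (fun k _ => contDiffOn_const.mul (hk k)) i hz,
    dom_HS.pd_sum _ (fun a _ => ContDiffOn.sum fun b _ => hq a b) i hz]
  have e1 : ∀ a, pd i (fun z => ∑ b, Q c a b * ((z a - y a) * (z b - y b))) z =
      ∑ b, Q c a b * ((if a = i then 1 else 0) * (z b - y b) + (z a - y a) *
        (if b = i then 1 else 0)) := fun a => by
    rw [dom_HS.pd_sum _ (fun b _ => hq a b) i hz]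
    refine Finset.sum_congr rfl fun b _ => ?_
    rw [dom_HS.pd_const_mul _ ((hk a).mul (hk b)) i hz, dom_HS.pd_mul (hk a) (hk b) i hz, pk, pk]
  have e2 : ∀ k, pd i (fun z => L c k * (z k - y k)) z = L c k * if k = i then 1 else 0 :=
    fun k => by rw [dom_HS.pd_const_mul _ (hk k) i hz, pk]
  simp only [e1, e2]
  fin_cases i <;> simp [Fin.sum_univ_three, hQ c 1 0, hQ c 2 0, hQ c 2 1] <;> ring

/-- A metric that is Euclidean up to second order at `y`. -/
structure NormalAt (G : E3 → Matrix (Fin 3) (Fin 3) ℝ) (y : E3) : Prop where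
  eq_one : G y = 1
  pd_eq_zero : ∀ i j k, pd k (fun z => G z i j) y = 0

/-- A quadratic change of coordinates suffices: its linear part orthonormalises `G y` and its second
derivatives cancel the Christoffel symbols at `y`. The condition `0 < y 0` keeps a neighbourhood of
`y` inside the half-space, which a quadratic map need not preserve. -/
theorem exists_normal {D : Set E3} {G : E3 → Matrix (Fin 3) (Fin 3) ℝ} (hD : Dom D) (h : Met D G)
    {y : E3} (hy : y ∈ D) (hy0 : 0 < y 0) :
    ∃ (D' : Set E3) (G' : E3 → Matrix (Fin 3) (Fin 3) ℝ) (τ : E3 → E3),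
      Trans D' D G' G τ ∧ y ∈ D' ∧ τ y = y ∧ NormalAt G' y := by
  obtain ⟨L, hL, hLG⟩ := exists_orthonormalising (h.pos y hy)
  obtain ⟨Q, hQdef⟩ : ∃ Q : Fin 3 → Fin 3 → Fin 3 → ℝ, ∀ c i j, Q c i j =
    ∑ a, ∑ b, christoffel G c a b y * L a i * L b j := ⟨_, fun _ _ _ => rfl⟩
  have hQ : ∀ c i j, Q c i j = Q c j i := fun c i j => by
    rw [hQdef, hQdef, Finset.sum_comm]
    refine Finset.sum_congr rfl fun a _ => Finset.sum_congr rfl fun b _ => ?_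
    rw [christoffel_symm hD h c a b hy]; ring
  obtain ⟨τ, rfl⟩ : ∃ τ, τ = quadMap y L Q := ⟨_, rfl⟩
  have hτy : quadMap y L Q y = y := by
    ext c; simp [quadMap_apply]
  have hc := contDiff_quadMap y L Q
  obtain ⟨J, hJ⟩ : ∃ J : E3 → Matrix (Fin 3) (Fin 3) ℝ, ∀ z, J z =
      Matrix.of fun c i => L c i - ∑ j, Q c i j * (z j - y j) := ⟨_, fun _ => rfl⟩
  have hJac : ∀ z ∈ HS, jac (quadMap y L Q) z = J z := fun z hz => by
    ext c i; rw [jac_quadMap y L hQ hz, hJ]; rfl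
  have hJy : J y = L := by rw [hJ]; ext; simp
  have hJc : Continuous fun z => (J z).det := by
    refine Continuous.matrix_det ?_
    rw [funext hJ]
    refine continuous_matrix fun c i => ?_
    simp only [Matrix.of_apply]
    refine continuous_const.sub (continuous_finsetSum _ fun j _ => continuous_const.mul
      ((EuclideanSpace.proj (𝕜 := ℝ) j).continuous.sub continuous_const))
  obtain ⟨O, hO, hDO⟩ := id hD
  have hpos : IsOpen {z : E3 | 0 < z 0} :=
    isOpen_lt continuous_const (EuclideanSpace.proj (𝕜 := ℝ) 0).continuous
  have hO' : IsOpen (quadMap y L Q ⁻¹' (O ∩ {z : E3 | 0 < z 0}) ∩ {z | (J z).det ≠ 0}) :=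
    ((hO.inter hpos).preimage hc.continuous).inter (isOpen_ne_fun hJc continuous_const)
  have hyH : y ∈ HS := hD.sub hy
  have hD' : Dom (HS ∩ (quadMap y L Q ⁻¹' (O ∩ {z : E3 | 0 < z 0}) ∩ {z | (J z).det ≠ 0})) :=
    ⟨_, hO', rfl⟩
  have hm : MapsTo (quadMap y L Q)
      (HS ∩ (quadMap y L Q ⁻¹' (O ∩ {z : E3 | 0 < z 0}) ∩ {z | (J z).det ≠ 0})) D := by
    rintro z ⟨-, ⟨hz1, hz2⟩, -⟩
    rw [hDO]
    exact ⟨mem_HS.2 hz2.le, hz1⟩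
  have hyD' : y ∈ HS ∩ (quadMap y L Q ⁻¹' (O ∩ {z : E3 | 0 < z 0}) ∩ {z | (J z).det ≠ 0}) := by
    refine ⟨hyH, ⟨?_, ?_⟩, ?_⟩
    · rw [hτy]; rw [hDO] at hy; exact hy.2
    · rw [hτy]; exact hy0
    · change (J y).det ≠ 0
      rw [hJy]; exact hL.ne_zero
  have hs : ContDiffOn ℝ ∞ (quadMap y L Q)
    (HS ∩ (quadMap y L Q ⁻¹' (O ∩ {z : E3 | 0 < z 0}) ∩ {z | (J z).det ≠ 0})) := hc.contDiffOn
  have T : Trans (HS ∩ (quadMap y L Q ⁻¹' (O ∩ {z : E3 | 0 < z 0}) ∩ {z | (J z).det ≠ 0})) D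
      (fun z => (jac (quadMap y L Q) z)ᵀ * G (quadMap y L Q z) * jac (quadMap y L Q) z) G
      (quadMap y L Q) := by
    refine ⟨hD', hD, ⟨?_, ?_⟩, h, hs, hm, fun z _ => rfl⟩
    · have hJs : MSm _ (jac (quadMap y L Q)) := hD'.sm_jac hs
      have hJt : MSm (HS ∩ (quadMap y L Q ⁻¹' (O ∩ {z : E3 | 0 < z 0}) ∩ {z | (J z).det ≠ 0}))
        (fun z => (jac (quadMap y L Q) z)ᵀ) := fun a b => hJs b a
      exact (hJt.mul fun a b => Sm.comp_map hs hm (h.sm a b)).mul hJs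
    · intro z hz
      have := (h.pos _ (hm hz)).conjTranspose_mul_mul_same (B := jac (quadMap y L Q) z) (by
        rw [Matrix.mulVec_injective_iff_isUnit, Matrix.isUnit_iff_isUnit_det, hJac z hz.1]
        exact (Ne.isUnit hz.2.2))
      rwa [Matrix.conjTranspose_eq_transpose_of_trivial] at this
  refine ⟨_, _, _, T, hyD', hτy, ?_, ?_⟩
  · simp only [hJac y hyH, hJy, hτy, hLG]
  -- By `pd_metric` and `lower_christoffel` the first derivatives of a metric are combinations of
  -- its Christoffel symbols, so it is enough that these vanish at `y`.
  · have hchr : ∀ k i j, christoffel (fun z => (jac (quadMap y L Q) z)ᵀ * G (quadMap y L Q z) *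
        jac (quadMap y L Q) z) k i j y = 0 := by
      intro k i j
      have h1 : ∀ c, ∑ k, jac (quadMap y L Q) y c k * christoffel (fun z =>
          (jac (quadMap y L Q) z)ᵀ * G (quadMap y L Q z) * jac (quadMap y L Q) z) k i j y = 0 := by
        intro c
        have hk : ∀ k, Sm HS (fun z => z k - y k) := fun k => (sm_proj HS k).sub contDiffOn_const
        rw [T.christoffel_eq hyD', hτy, dom_HS.pd_congr (fun z hz => jac_quadMap y L hQ hz c j) i hyH,
          dom_HS.pd_sub contDiffOn_const (ContDiffOn.sum fun a _ => contDiffOn_const.mul (hk a)) i hyH,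
          Dom.pd_const, dom_HS.pd_sum _ (fun a _ => contDiffOn_const.mul (hk a)) i hyH]
        have e : ∀ a, pd i (fun z => Q c j a * (z a - y a)) y = Q c j a * if a = i then 1 else 0 := by
          intro a
          rw [dom_HS.pd_const_mul _ (hk a) i hyH,
            dom_HS.pd_sub (sm_proj HS a) contDiffOn_const i hyH, Dom.pd_const, sub_zero, pd_proj hyH]
        simp only [e, hJac y hyH, hJy, ← hQdef]
        simp [hQ c j i]
      have h2 : jac (quadMap y L Q) y *ᵥ (fun k => christoffel (fun z =>
          (jac (quadMap y L Q) z)ᵀ * G (quadMap y L Q z) * jac (quadMap y L Q) z) k i j y) = 0 := by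
        ext c; exact h1 c
      have h3 := Matrix.eq_zero_of_mulVec_eq_zero (T.det_ne_zero hyD') h2
      exact congrFun h3 k
    intro i j k
    rw [pd_metric T.dom T.met k i j hyD', ← lower_christoffel T.met _ _ _ hyD',
      ← lower_christoffel T.met _ _ _ hyD']
    simp only [hchr, mul_zero, Finset.sum_const_zero, add_zero]

/-! ### Conformal changes of the metric -/

/-- The squared length of the gradient. -/
def gradSq (G : E3 → Matrix (Fin 3) (Fin 3) ℝ) (f : E3 → ℝ) (y : E3) : ℝ :=
  ∑ i, ∑ j, (G y)⁻¹ i j * (pd i f y * pd j f y)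

theorem Trans.gradSq_eq {D D' : Set E3} {G' G : E3 → Matrix (Fin 3) (Fin 3) ℝ} {τ : E3 → E3}
    (T : Trans D D' G' G τ) {f : E3 → ℝ} (hf : Sm D' f) {y : E3} (hy : y ∈ D) :
    gradSq G' (fun z => f (τ z)) y = gradSq G f (τ y) :=
  T.contract hy fun i j => by
    rw [T.dom.pd_comp T.dom' T.sm T.maps hf i hy, T.dom.pd_comp T.dom' T.sm T.maps hf j hy,
      Finset.sum_mul_sum]
    exact Finset.sum_congr rfl fun a _ => Finset.sum_congr rfl fun b _ => by ring

theorem sm_gradSq {D : Set E3} {G : E3 → Matrix (Fin 3) (Fin 3) ℝ} (hD : Dom D) (h : Met D G)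
    {f : E3 → ℝ} (hf : Sm D f) : Sm D (gradSq G f) :=
  ContDiffOn.sum fun i _ => ContDiffOn.sum fun j _ =>
    (h.sm_inv i j).mul ((hD.sm_pd hf i).mul (hD.sm_pd hf j))

/-- The metric `e^(2w) G`. -/
def conf (w : E3 → ℝ) (G : E3 → Matrix (Fin 3) (Fin 3) ℝ) (z : E3) : Matrix (Fin 3) (Fin 3) ℝ :=
  Real.exp (2 * w z) • G z

theorem conf_apply (w : E3 → ℝ) (G : E3 → Matrix (Fin 3) (Fin 3) ℝ) (z : E3) (i j : Fin 3) :
    conf w G z i j = Real.exp (2 * w z) * G z i j := rfl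

section
variable {D : Set E3} {G : E3 → Matrix (Fin 3) (Fin 3) ℝ} {w : E3 → ℝ}

theorem sm_exp (hw : Sm D w) : Sm D (fun z => Real.exp (2 * w z)) :=
  (contDiffOn_const.mul hw).exp

theorem met_conf (h : Met D G) (hw : Sm D w) : Met D (conf w G) :=
  ⟨fun i j => (sm_exp hw).mul (h.sm i j), fun z hz => (h.pos z hz).smul (Real.exp_pos _)⟩

theorem conf_inv (h : Met D G) {y : E3} (hy : y ∈ D) (i j : Fin 3) :
    (conf w G y)⁻¹ i j = Real.exp (-(2 * w y)) * (G y)⁻¹ i j := by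
  have hu : IsUnit (G y).det := (h.det_pos hy).ne'.isUnit
  have : (conf w G y)⁻¹ = Real.exp (-(2 * w y)) • (G y)⁻¹ := by
    refine Matrix.inv_eq_left_inv ?_
    rw [conf, smul_mul_smul_comm, ← Real.exp_add, Matrix.nonsing_inv_mul _ hu]
    simp
  rw [this]; rfl

theorem pd_exp (hD : Dom D) (hw : Sm D w) {y : E3} (hy : y ∈ D) (k : Fin 3) :
    pd k (fun z => Real.exp (2 * w z)) y = 2 * Real.exp (2 * w y) * pd k w y := by
  have h := hD.pd_comp_real (h := fun t => Real.exp (2 * t)) hw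
    (((hasDerivAt_id (w y)).const_mul 2).exp) k hy
  rw [h, id]; ring

theorem pd_conf (hD : Dom D) (h : Met D G) (hw : Sm D w) {y : E3} (hy : y ∈ D) (k i j : Fin 3) :
    pd k (fun z => conf w G z i j) y =
      Real.exp (2 * w y) * (2 * pd k w y * G y i j + pd k (fun z => G z i j) y) := by
  simp only [conf_apply]
  rw [hD.pd_mul (sm_exp hw) (h.sm i j) k hy, pd_exp hD hw hy]
  ring

theorem christoffel_conf (hD : Dom D) (h : Met D G) (hw : Sm D w) {y : E3} (hy : y ∈ D)
    (k i j : Fin 3) : christoffel (conf w G) k i j y = christoffel G k i j y +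
      ((if k = j then pd i w y else 0) + (if k = i then pd j w y else 0) -
        G y i j * ∑ l, (G y)⁻¹ k l * pd l w y) := by
  have he : Real.exp (-(2 * w y)) * Real.exp (2 * w y) = 1 := by
    rw [← Real.exp_add]; simp
  have hl : ∀ l, christoffelLow (conf w G) l i j y = Real.exp (2 * w y) * (christoffelLow G l i j y
      + (pd i w y * G y l j + pd j w y * G y l i - G y i j * pd l w y)) := fun l => by
    simp only [christoffelLow, pd_conf hD h hw hy, h.symm hy l j, h.symm hy l i]
    ring
  have e1 : ∀ j, (if k = j then (1 : ℝ) else 0) = ∑ l, (G y)⁻¹ k l * G y l j := fun j =>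
    (h.sum_inv_mul hy k j).symm
  have e2 : ∀ i j, (if k = j then pd i w y else 0) = (if k = j then (1 : ℝ) else 0) * pd i w y := by
    intro i j; split_ifs <;> simp
  rw [e2 i j, e2 j i, e1, e1, christoffel_eq_low, christoffel_eq_low]
  simp only [conf_inv h hy, hl]
  have e3 : ∀ l (x : ℝ), Real.exp (-(2 * w y)) * (G y)⁻¹ k l * (Real.exp (2 * w y) * x) =
      (G y)⁻¹ k l * x := fun l x => by
    calc _ = Real.exp (-(2 * w y)) * Real.exp (2 * w y) * ((G y)⁻¹ k l * x) := by ring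
      _ = _ := by rw [he, one_mul]
  simp only [e3, Fin.sum_univ_three]
  ring

/-- Differentiation of `G⁻¹ G = 1` at a point where `∂G = 0`. -/
theorem pd_inv_of_normal (hD : Dom D) (h : Met D G) {y : E3} (hy : y ∈ D) (hn : NormalAt G y)
    (k i j : Fin 3) : pd k (fun z => (G z)⁻¹ i j) y = 0 := by
  have h1 : pd k (fun z => ∑ l, (G z)⁻¹ i l * G z l j) y = 0 := by
    rw [hD.pd_congr (fun z hz => h.sum_inv_mul hz i j) k hy, Dom.pd_const]
  rw [hD.pd_sum _ (fun l _ => (h.sm_inv i l).mul (h.sm l j)) k hy] at h1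
  simpa [fun l => hD.pd_mul (h.sm_inv i l) (h.sm l j) k hy, hn.pd_eq_zero, hn.eq_one,
    Matrix.one_apply] using h1

theorem christoffel_of_normal {y : E3} (hn : NormalAt G y) (k i j : Fin 3) :
    christoffel G k i j y = 0 := by
  simp [christoffel, hn.pd_eq_zero]

/-- At a normal point the Christoffel symbols of `G` vanish and only their derivatives remain, so
that the formula becomes polynomial. The constants 4 and 2 are `2(n-1)` and `(n-1)(n-2)` for `n =
3`. -/
theorem scalar_conf_of_normal (hD : Dom D) (h : Met D G) (hw : Sm D w) {y : E3} (hy : y ∈ D)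
    (hn : NormalAt G y) : scalar (conf w G) y =
      Real.exp (-(2 * w y)) * (scalar G y - 4 * laplacian G w y - 2 * gradSq G w y) := by
  have hw1 := fun l => hD.sm_pd hw l
  have sS : ∀ k, Sm D (fun z => ∑ l, (G z)⁻¹ k l * pd l w z) := fun k =>
    ContDiffOn.sum fun l _ => (h.sm_inv k l).mul (hw1 l)
  have sP : ∀ k i j, Sm D (fun z => G z i j * ∑ l, (G z)⁻¹ k l * pd l w z) := fun k i j =>
    (h.sm i j).mul (sS k)
  have sI : ∀ (k i j : Fin 3), Sm D (fun z => if k = j then pd i w z else 0) := fun k i j => by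
    split_ifs
    · exact hw1 i
    · exact contDiffOn_const
  have pI : ∀ m (k i j : Fin 3), pd m (fun z => if k = j then pd i w z else 0) y =
      if k = j then pd m (pd i w) y else 0 := fun m k i j => by
    split_ifs
    · rfl
    · exact Dom.pd_const _ _ _
  have hdC : ∀ m k i j, pd m (christoffel (conf w G) k i j) y = pd m (christoffel G k i j) y +
      ((if k = j then pd m (pd i w) y else 0) + (if k = i then pd m (pd j w) y else 0) -
        if i = j then pd m (pd k w) y else 0) := by
    intro m k i j
    rw [hD.pd_congr (fun z hz => christoffel_conf hD h hw hz k i j) m hy,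
      hD.pd_add (sm_christoffel hD h k i j) (((sI k i j).add (sI k j i)).sub (sP k i j)) m hy,
      hD.pd_sub ((sI k i j).add (sI k j i)) (sP k i j) m hy, hD.pd_add (sI k i j) (sI k j i) m hy,
      pI, pI, hD.pd_mul (h.sm i j) (sS k) m hy,
      hD.pd_sum _ (fun l _ => (h.sm_inv k l).mul (hw1 l)) m hy]
    simp [fun l => hD.pd_mul (h.sm_inv k l) (hw1 l) m hy, hn.pd_eq_zero, hn.eq_one,
      pd_inv_of_normal hD h hy hn, Matrix.one_apply]
  have hC : ∀ k i j, christoffel (conf w G) k i j y = (if k = j then pd i w y else 0) +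
      (if k = i then pd j w y else 0) - if i = j then pd k w y else 0 := by
    intro k i j
    rw [christoffel_conf hD h hw hy, christoffel_of_normal hn]
    simp [hn.eq_one, Matrix.one_apply]
  simp only [scalar, ricci, laplacian, hessian, gradSq, hdC, hC, christoffel_of_normal hn,
    conf_inv h hy, hn.eq_one]
  simp [Fin.sum_univ_three, Matrix.one_apply]
  ring

/-- The scalar curvature of a conformal metric. -/
theorem scalar_conf (hD : Dom D) (h : Met D G) (hw : Sm D w) {y : E3} (hy : y ∈ D)
    (hy0 : 0 < y 0) : scalar (conf w G) y =
      Real.exp (-(2 * w y)) * (scalar G y - 4 * laplacian G w y - 2 * gradSq G w y) := by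
  -- Both sides are invariant under coordinate changes, so the identity is checked in normal
  -- coordinates.
  obtain ⟨D', G', τ, T, hy', hτ, hn⟩ := exists_normal hD h hy hy0
  have hw' : Sm D' (fun z => w (τ z)) := Sm.comp_map T.sm T.maps hw
  have T' : Trans D' D (conf (fun z => w (τ z)) G') (conf w G) τ :=
    ⟨T.dom, T.dom', met_conf T.met hw', met_conf T.met' hw, T.sm, T.maps, fun z hz => by
      rw [conf, conf, T.pull z hz, Matrix.mul_smul, Matrix.smul_mul]⟩
  have h1 := scalar_conf_of_normal T.dom T.met hw' hy' hn
  rwa [T'.scalar_eq hy', T.scalar_eq hy', T.laplacian_eq hw hy', T.gradSq_eq hw hy', hτ] at h1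

/-! ### Static metrics -/

/-- The formal adjoint of the linearised scalar curvature, in coordinates. -/
def adjLin (G : E3 → Matrix (Fin 3) (Fin 3) ℝ) (f : E3 → ℝ) (i j : Fin 3) (y : E3) : ℝ :=
  hessian G f i j y - laplacian G f y * G y i j - f y * ricci G i j y

theorem Trans.adjLin_eq {D D' : Set E3} {G' G : E3 → Matrix (Fin 3) (Fin 3) ℝ}
    {τ : E3 → E3} (T : Trans D D' G' G τ) {f : E3 → ℝ} (hf : Sm D' f) {y : E3} (hy : y ∈ D)
    (i j : Fin 3) : adjLin G' (fun z => f (τ z)) i j y =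
      ∑ a, ∑ b, jac τ y a i * jac τ y b j * adjLin G f a b (τ y) := by
  simp only [adjLin, T.hessian_eq hf hy, T.laplacian_eq hf hy, T.ricci_eq hy, T.pull_apply hy,
    Finset.mul_sum, ← Finset.sum_sub_distrib]
  exact Finset.sum_congr rfl fun a _ => Finset.sum_congr rfl fun b _ => by ring

theorem pd_scalar_of_normal (hD : Dom D) (h : Met D G) {y : E3} (hy : y ∈ D) (hn : NormalAt G y)
    (m : Fin 3) : pd m (scalar G) y = ∑ i, pd m (ricci G i i) y := by
  have hs := fun i j => (h.sm_inv i j).mul (sm_ricci hD h i j)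
  have e : scalar G = fun z => ∑ i, ∑ j, (G z)⁻¹ i j * ricci G i j z := rfl
  rw [e, hD.pd_sum _ (fun i _ => ContDiffOn.sum fun j _ => hs i j) m hy]
  refine Finset.sum_congr rfl fun i _ => ?_
  rw [hD.pd_sum _ (fun j _ => hs i j) m hy]
  simp [fun j => hD.pd_mul (h.sm_inv i j) (sm_ricci hD h i j) m hy, hn.eq_one,
    pd_inv_of_normal hD h hy hn, Matrix.one_apply]

theorem pd_laplacian_of_normal (hD : Dom D) (h : Met D G) {f : E3 → ℝ} (hf : Sm D f) {y : E3}
    (hy : y ∈ D) (hn : NormalAt G y) (m : Fin 3) :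
    pd m (laplacian G f) y = ∑ i, pd m (hessian G f i i) y := by
  have hs := fun i j => (h.sm_inv i j).mul (sm_hessian hD h hf i j)
  have e : laplacian G f = fun z => ∑ i, ∑ j, (G z)⁻¹ i j * hessian G f i j z := rfl
  rw [e, hD.pd_sum _ (fun i _ => ContDiffOn.sum fun j _ => hs i j) m hy]
  refine Finset.sum_congr rfl fun i _ => ?_
  rw [hD.pd_sum _ (fun j _ => hs i j) m hy]
  simp [fun j => hD.pd_mul (h.sm_inv i j) (sm_hessian hD h hf i j) m hy, hn.eq_one,
    pd_inv_of_normal hD h hy hn, Matrix.one_apply]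

theorem pd_hessian_of_normal (hD : Dom D) (h : Met D G) {f : E3 → ℝ} (hf : Sm D f) {y : E3}
    (hy : y ∈ D) (hn : NormalAt G y) (m i j : Fin 3) : pd m (hessian G f i j) y =
      pd m (pd i (pd j f)) y - ∑ k, pd m (christoffel G k i j) y * pd k f y := by
  have hs := fun k => (sm_christoffel hD h k i j).mul (hD.sm_pd hf k)
  have e : hessian G f i j = fun z => pd i (pd j f) z - ∑ k, christoffel G k i j z * pd k f z := rfl
  rw [e, hD.pd_sub (hD.sm_pd (hD.sm_pd hf j) i) (ContDiffOn.sum fun k _ => hs k) m hy,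
    hD.pd_sum _ (fun k _ => hs k) m hy]
  congr 1
  refine Finset.sum_congr rfl fun k _ => ?_
  rw [hD.pd_mul (sm_christoffel hD h k i j) (hD.sm_pd hf k) m hy, christoffel_of_normal hn]
  ring

theorem pd_christoffel_of_normal (hD : Dom D) (h : Met D G) {y : E3} (hy : y ∈ D)
    (hn : NormalAt G y) (m k i j : Fin 3) : pd m (christoffel G k i j) y =
      pd m (christoffelLow G k i j) y := by
  have hs := fun l => (h.sm_inv k l).mul (sm_christoffelLow hD h l i j)
  rw [hD.pd_congr (fun z _ => christoffel_eq_low G k i j z) m hy, hD.pd_sum _ (fun l _ => hs l) m hy]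
  simp [fun l => hD.pd_mul (h.sm_inv k l) (sm_christoffelLow hD h l i j) m hy, hn.eq_one,
    pd_inv_of_normal hD h hy hn, Matrix.one_apply]

/-- Second derivatives of the inverse metric need not vanish at `y`, but they multiply lowered
Christoffel symbols, which do. -/
theorem pd_pd_christoffel_of_normal (hD : Dom D) (h : Met D G) {y : E3} (hy : y ∈ D)
    (hn : NormalAt G y) (n m k i j : Fin 3) : pd n (pd m (christoffel G k i j)) y =
      pd n (pd m (christoffelLow G k i j)) y := by
  have hl := fun l => sm_christoffelLow hD h l i j
  have hs := fun l => (h.sm_inv k l).mul (hl l)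
  have e : ∀ z ∈ D, pd m (christoffel G k i j) z = ∑ l, (pd m (fun z => (G z)⁻¹ k l) z *
      christoffelLow G l i j z + (G z)⁻¹ k l * pd m (christoffelLow G l i j) z) := fun z hz => by
    rw [hD.pd_congr (fun z _ => christoffel_eq_low G k i j z) m hz,
      hD.pd_sum _ (fun l _ => hs l) m hz]
    exact Finset.sum_congr rfl fun l _ => hD.pd_mul (h.sm_inv k l) (hl l) m hz
  have t1 := fun l => (hD.sm_pd (h.sm_inv k l) m).mul (hl l)
  have t2 := fun l => (h.sm_inv k l).mul (hD.sm_pd (hl l) m)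
  rw [hD.pd_congr e n hy, hD.pd_sum _ (fun l _ => (t1 l).add (t2 l)) n hy]
  have e0 : ∀ l, christoffelLow G l i j y = 0 := fun l => by
    simp [christoffelLow, hn.pd_eq_zero]
  have e1 : ∀ l, pd n (fun z => pd m (fun z => (G z)⁻¹ k l) z * christoffelLow G l i j z +
      (G z)⁻¹ k l * pd m (christoffelLow G l i j) z) y =
      (1 : Matrix (Fin 3) (Fin 3) ℝ) k l * pd n (pd m (christoffelLow G l i j)) y := fun l => by
    rw [hD.pd_add (t1 l) (t2 l) n hy, hD.pd_mul (hD.sm_pd (h.sm_inv k l) m) (hl l) n hy,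
      hD.pd_mul (h.sm_inv k l) (hD.sm_pd (hl l) m) n hy, pd_inv_of_normal hD h hy hn,
      pd_inv_of_normal hD h hy hn, e0, hn.eq_one]
    simp
  simp [e1, Matrix.one_apply]

theorem pd_christoffelLow (hD : Dom D) (h : Met D G) {y : E3} (hy : y ∈ D) (m l i j : Fin 3) :
    pd m (christoffelLow G l i j) y = (1 / 2) * (pd m (pd i (fun z => G z j l)) y +
      pd m (pd j (fun z => G z i l)) y - pd m (pd l (fun z => G z i j)) y) := by
  have s := fun i j k => hD.sm_pd (h.sm j k) i
  have e : christoffelLow G l i j = fun z => (1 / 2) * (pd i (fun z => G z j l) z +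
    pd j (fun z => G z i l) z - pd l (fun z => G z i j) z) := rfl
  rw [e, hD.pd_const_mul _ (((s _ _ _).add (s _ _ _)).sub (s _ _ _)) m hy,
    hD.pd_sub ((s _ _ _).add (s _ _ _)) (s _ _ _) m hy, hD.pd_add (s _ _ _) (s _ _ _) m hy]

theorem pd_pd_christoffelLow (hD : Dom D) (h : Met D G) {y : E3} (hy : y ∈ D) (n m l i j : Fin 3) :
    pd n (pd m (christoffelLow G l i j)) y = (1 / 2) * (pd n (pd m (pd i (fun z => G z j l))) y +
      pd n (pd m (pd j (fun z => G z i l))) y - pd n (pd m (pd l (fun z => G z i j))) y) := by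
  have s := fun m i j k => hD.sm_pd (hD.sm_pd (h.sm j k) i) m
  rw [hD.pd_congr (fun z hz => pd_christoffelLow hD h hz m l i j) n hy,
    hD.pd_const_mul _ (((s _ _ _ _).add (s _ _ _ _)).sub (s _ _ _ _)) n hy,
    hD.pd_sub ((s _ _ _ _).add (s _ _ _ _)) (s _ _ _ _) n hy,
    hD.pd_add (s _ _ _ _) (s _ _ _ _) n hy]

/-- The quadratic terms of the Ricci curvature are products of two factors that vanish at `y`, so
their first derivatives vanish too. -/
theorem pd_ricci_of_normal (hD : Dom D) (h : Met D G) {y : E3} (hy : y ∈ D) (hn : NormalAt G y)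
    (m i j : Fin 3) : pd m (ricci G i j) y =
      ∑ k, (pd m (pd k (christoffelLow G k i j)) y - pd m (pd j (christoffelLow G k i k)) y) := by
  have s := sm_christoffel hD h
  have sq : ∀ k, Sm D (fun z => ∑ l, (christoffel G k k l z * christoffel G l i j z -
      christoffel G k j l z * christoffel G l i k z)) := fun k =>
    ContDiffOn.sum fun l _ => ((s _ _ _).mul (s _ _ _)).sub ((s _ _ _).mul (s _ _ _))
  have sl : ∀ k, Sm D (fun z => pd k (christoffel G k i j) z - pd j (christoffel G k i k) z) :=
    fun k => (hD.sm_pd (s _ _ _) _).sub (hD.sm_pd (s _ _ _) _)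
  have e : ricci G i j = fun z => ∑ k, (pd k (christoffel G k i j) z - pd j (christoffel G k i k) z +
      ∑ l, (christoffel G k k l z * christoffel G l i j z -
      christoffel G k j l z * christoffel G l i k z)) := rfl
  rw [e, hD.pd_sum _ (fun k _ => (sl k).add (sq k)) m hy]
  refine Finset.sum_congr rfl fun k _ => ?_
  rw [hD.pd_add (sl k) (sq k) m hy, hD.pd_sub (hD.sm_pd (s _ _ _) _) (hD.sm_pd (s _ _ _) _) m hy,
    pd_pd_christoffel_of_normal hD h hy hn, pd_pd_christoffel_of_normal hD h hy hn,
    hD.pd_sum _ (fun l _ => ((s _ _ _).mul (s _ _ _)).sub ((s _ _ _).mul (s _ _ _))) m hy]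
  simp [fun l => hD.pd_sub ((s k k l).mul (s l i j)) ((s k j l).mul (s l i k)) m hy,
    fun l => hD.pd_mul (s k k l) (s l i j) m hy, fun l => hD.pd_mul (s k j l) (s l i k) m hy,
    christoffel_of_normal hn]

/-- The contracted second Bianchi identity. -/
theorem bianchi_of_normal (hD : Dom D) (h : Met D G) {y : E3} (hy : y ∈ D) (hn : NormalAt G y)
    (j : Fin 3) : ∑ i, pd i (ricci G i j) y = (1 / 2) * pd j (scalar G) y := by
  have c3 : ∀ a b c k l, pd a (pd b (pd c (fun z => G z k l))) y =
      pd b (pd a (pd c (fun z => G z k l))) y := fun a b c k l =>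
    hD.pd_comm (hD.sm_pd (h.sm k l) c) a b hy
  have c3' : ∀ a b c k l, pd a (pd b (pd c (fun z => G z k l))) y =
      pd a (pd c (pd b (fun z => G z k l))) y := fun a b c k l =>
    hD.pd_congr (fun z hz => hD.pd_comm (h.sm k l) b c hz) a hy
  have sy : ∀ a b c k l, pd a (pd b (pd c (fun z => G z k l))) y =
      pd a (pd b (pd c (fun z => G z l k))) y := fun a b c k l =>
    hD.pd_congr (fun z hz => hD.pd_congr (fun x hx => hD.pd_congr (fun t ht => h.symm ht k l) c hx)
      b hz) a hy
  rw [pd_scalar_of_normal hD h hy hn]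
  -- At the centre of normal coordinates the identity is linear in the third derivatives of the
  -- metric. It holds once derivatives and metric indices are sorted.
  simp only [pd_ricci_of_normal hD h hy hn, pd_pd_christoffelLow hD h hy, Fin.sum_univ_three]
  fin_cases j <;> simp only [Fin.zero_eta, Fin.mk_one, Fin.reduceFinMk, Fin.isValue,
    sy _ _ _ 1 0, sy _ _ _ 2 0, sy _ _ _ 2 1, c3 1 0, c3 2 0, c3 2 1, c3' _ 1 0, c3' _ 2 0,
    c3' _ 2 1] <;> ring

theorem ricci_of_normal (hD : Dom D) (h : Met D G) {y : E3} (hy : y ∈ D) (hn : NormalAt G y)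
    (i j : Fin 3) : ricci G i j y =
      ∑ k, (pd k (christoffelLow G k i j) y - pd j (christoffelLow G k i k) y) := by
  simp [ricci, christoffel_of_normal hn, pd_christoffel_of_normal hD h hy hn]

/-- The divergence of the static equation. The Ricci identity `div ∇²f - d(Δf) = Ric(∇f)` cancels
the part of `div(f Ric)` in which `f` is differentiated; the Bianchi identity turns the rest, `f div
Ric`, into `f dR / 2`. -/
theorem static_of_normal (hD : Dom D) (h : Met D G) {f : E3 → ℝ} (hf : Sm D f) {y : E3}
    (hy : y ∈ D) (hn : NormalAt G y) (hs : ∀ z ∈ D, ∀ i j, adjLin G f i j z = 0) (j : Fin 3) :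
    f y * pd j (scalar G) y = 0 := by
  have sL := sm_laplacian hD h hf
  have hT : ∀ i, pd i (hessian G f i j) y - pd i (laplacian G f) y * G y i j -
      (pd i f y * ricci G i j y + f y * pd i (ricci G i j) y) = 0 := by
    intro i
    have sG := sL.mul (h.sm i j)
    have h0 : pd i (fun z => hessian G f i j z - laplacian G f z * G z i j - f z * ricci G i j z) y
        = 0 := by
      exact (hD.pd_congr (g := fun _ => 0) (fun z hz => hs z hz i j) i hy).trans
        (Dom.pd_const _ _ _)
    rw [hD.pd_sub ((sm_hessian hD h hf i j).sub sG) (hf.mul (sm_ricci hD h i j)) i hy,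
      hD.pd_sub (sm_hessian hD h hf i j) sG i hy, hD.pd_mul sL (h.sm i j) i hy,
      hD.pd_mul hf (sm_ricci hD h i j) i hy, hn.pd_eq_zero] at h0
    linarith
  have hB := bianchi_of_normal hD h hy hn j
  have h1 : ∑ i, (pd i (hessian G f i j) y - pd i (laplacian G f) y * G y i j -
      pd i f y * ricci G i j y) = f y * ∑ i, pd i (ricci G i j) y := by
    rw [Finset.mul_sum]
    exact Finset.sum_congr rfl fun i _ => by linarith [hT i]
  have h2 : ∑ i, (pd i (hessian G f i j) y - pd i (laplacian G f) y * G y i j -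
      pd i f y * ricci G i j y) = 0 := by
    have c3 : ∀ a b c, pd a (pd b (pd c f)) y = pd b (pd a (pd c f)) y := fun a b c =>
      hD.pd_comm (hD.sm_pd hf c) a b hy
    have c3' : ∀ a b c, pd a (pd b (pd c f)) y = pd a (pd c (pd b f)) y := fun a b c =>
      hD.pd_congr (fun z hz => hD.pd_comm hf b c hz) a hy
    have c2 : ∀ a b k l, pd a (pd b (fun z => G z k l)) y = pd b (pd a (fun z => G z k l)) y :=
      fun a b k l => hD.pd_comm (h.sm k l) a b hy
    have sy : ∀ a b k l, pd a (pd b (fun z => G z k l)) y = pd a (pd b (fun z => G z l k)) y :=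
      fun a b k l => hD.pd_congr (fun z hz => hD.pd_congr (fun x hx => h.symm hx k l) b hz) a hy
    simp only [pd_laplacian_of_normal hD h hf hy hn, pd_hessian_of_normal hD h hf hy hn,
      ricci_of_normal hD h hy hn, pd_christoffel_of_normal hD h hy hn, pd_christoffelLow hD h hy,
      Fin.sum_univ_three, hn.eq_one]
    fin_cases j <;> simp only [Matrix.one_apply, Fin.zero_eta, Fin.mk_one, Fin.reduceFinMk,
      Fin.isValue, Fin.reduceEq, if_true, if_false,
      sy _ _ 1 0, sy _ _ 2 0, sy _ _ 2 1, c2 1 0, c2 2 0, c2 2 1, c3 1 0, c3 2 0, c3 2 1, c3' _ 1 0,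
      c3' _ 2 0, c3' _ 2 1] <;> ring
  rw [h2, hB] at h1
  linarith

/-- A static metric has locally constant scalar curvature where the potential does not vanish. -/
theorem static_pd_scalar (hD : Dom D) (h : Met D G) {f : E3 → ℝ} (hf : Sm D f) {y : E3}
    (hy : y ∈ D) (hy0 : 0 < y 0) (hs : ∀ z ∈ D, ∀ i j, adjLin G f i j z = 0) (hfy : f y ≠ 0)
    (j : Fin 3) : pd j (scalar G) y = 0 := by
  obtain ⟨D', G', τ, T, hy', hτ, hn⟩ := exists_normal hD h hy hy0
  have hf' : Sm D' (fun z => f (τ z)) := Sm.comp_map T.sm T.maps hf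
  have h1 : ∀ j, pd j (scalar G') y = 0 := fun j => by
    have := static_of_normal T.dom T.met hf' hy' hn (fun z hz i j => by
      rw [T.adjLin_eq hf hz]; simp [hs _ (T.maps hz)]) j
    simpa [hτ, hfy] using this
  -- The vanishing differential in normal coordinates is `Jᵀ dR`; invertibility of `J` gives `dR =
  -- 0` in the original ones.
  have h2 : (jac τ y)ᵀ *ᵥ (fun a => pd a (scalar G) y) = 0 := by
    ext i
    have := h1 i
    rw [T.dom.pd_congr (fun z hz => T.scalar_eq hz) i hy',
      T.dom.pd_comp T.dom' T.sm T.maps (sm_scalar hD h) i hy', hτ] at this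
    exact this
  have hd : (jac τ y)ᵀ.det ≠ 0 := by rw [Matrix.det_transpose]; exact T.det_ne_zero hy'
  exact congrFun (Matrix.eq_zero_of_mulVec_eq_zero hd h2) j

end

open Bundle
set_option linter.unusedSectionVars false

/-! ### Charts, metrics and vector fields -/

section Manifold

variable {M : Type u} [TopologicalSpace M] [ChartedSpace (EuclideanHalfSpace 3) M]
  [IsManifold (𝓡∂ 3) ∞ M]

theorem dom_inter_preimage (p : M) {U : Set M} (hU : IsOpen U) :
    Dom ((extChartAt (𝓡∂ 3) p).target ∩ (extChartAt (𝓡∂ 3) p).symm ⁻¹' U) := by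
  refine ⟨(𝓡∂ 3).symm ⁻¹' ((chartAt (EuclideanHalfSpace 3) p).target ∩
    (chartAt (EuclideanHalfSpace 3) p).symm ⁻¹' U),
    ((chartAt (EuclideanHalfSpace 3) p).isOpen_inter_preimage_symm hU).preimage
      (𝓡∂ 3).continuous_symm, ?_⟩
  rw [extChartAt_target]
  ext y
  simp only [mem_inter_iff, mem_preimage, extChartAt_coe_symm, Function.comp_apply]
  tauto

theorem dom_target (p : M) : Dom (extChartAt (𝓡∂ 3) p).target := by
  simpa using dom_inter_preimage p isOpen_univ

theorem target_subset_HS (p : M) : (extChartAt (𝓡∂ 3) p).target ⊆ HS := (dom_target p).sub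

/-- The coordinate vector fields of the chart at `p`. -/
def cframe (p : M) (i : Fin 3) (q : M) : TangentSpace (𝓡∂ 3) q :=
  (trivializationAt E3 (TangentSpace (𝓡∂ 3)) p).symmL ℝ q (EuclideanSpace.single i (1 : ℝ) : E3)

/-- `cframe` comes from the trivialisation of the tangent bundle and is visibly smooth, while the
metric matrix is defined through `coordVec`. This lemma transfers the smoothness. -/
theorem cframe_symm (p : M) (i : Fin 3) {y : E3} (hy : y ∈ (extChartAt (𝓡∂ 3) p).target) :
    cframe p i ((extChartAt (𝓡∂ 3) p).symm y) = coordVec p y i := by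
  have hq : (extChartAt (𝓡∂ 3) p).symm y ∈ (chartAt (EuclideanHalfSpace 3) p).source := by
    rw [← extChartAt_source (𝓡∂ 3)]; exact (extChartAt (𝓡∂ 3) p).map_target hy
  have key : ∀ y', y' = y → (mfderivWithin 𝓘(ℝ, E3) (𝓡∂ 3) (extChartAt (𝓡∂ 3) p).symm HS y'
      (EuclideanSpace.single i (1 : ℝ) : E3) : E3) = (mfderivWithin 𝓘(ℝ, E3) (𝓡∂ 3)
      (extChartAt (𝓡∂ 3) p).symm HS y (EuclideanSpace.single i (1 : ℝ) : E3) : E3) := by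
    rintro _ rfl; rfl
  rw [cframe, TangentBundle.symmL_trivializationAt hq]
  exact key _ ((extChartAt (𝓡∂ 3) p).right_inv hy)

theorem contMDiffOn_cframe (p : M) (i : Fin 3) :
    ContMDiffOn (𝓡∂ 3) (𝓡∂ 3).tangent ∞
      (fun q => (⟨q, cframe p i q⟩ : TangentBundle (𝓡∂ 3) M))
      (chartAt (EuclideanHalfSpace 3) p).source := by
  have h := (trivializationAt E3 (TangentSpace (𝓡∂ 3) : M → Type) p).contMDiffOn_localFrame_baseSet
    (I := 𝓡∂ 3) ∞ (EuclideanSpace.basisFun (Fin 3) ℝ).toBasis i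
  refine h.congr fun q hq => ?_
  have hq' : q ∈ (trivializationAt E3 (TangentSpace (𝓡∂ 3) : M → Type) p).baseSet := hq
  rw [Bundle.Trivialization.localFrame_apply_of_mem_baseSet _ _ hq']
  congr 1
  simp [cframe, Bundle.Trivialization.basisAt]
  exact Bundle.Trivialization.symmL_apply _ hq' _

/-- The matrix of the metric in the frame of the chart at `p`, as a function on the manifold. -/
theorem contMDiffOn_inner_cframe (g : RMetric M) (p : M) (i j : Fin 3) :
    ContMDiffOn (𝓡∂ 3) 𝓘(ℝ, ℝ) ∞ (fun q => g.inner q (cframe p i q) (cframe p j q))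
      (chartAt (EuclideanHalfSpace 3) p).source := by
  intro q hq
  have : ContMDiffWithinAt (𝓡∂ 3) ((𝓡∂ 3).prod 𝓘(ℝ)) ∞
      (fun m ↦ TotalSpace.mk' ℝ (E := Bundle.Trivial M ℝ) m
        (g.inner m (cframe p i m) (cframe p j m))) (chartAt (EuclideanHalfSpace 3) p).source q := by
    apply ContMDiffWithinAt.clm_bundle_apply₂ (F₁ := E3) (F₂ := E3)
    · exact (g.contMDiff q).contMDiffWithinAt
    · exact contMDiffOn_cframe p i q hq
    · exact contMDiffOn_cframe p j q hq
  simp only [contMDiffWithinAt_totalSpace] at this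
  exact this.2

theorem gram_apply (g : RMetric M) (p : M) {y : E3} (hy : y ∈ (extChartAt (𝓡∂ 3) p).target)
    (i j : Fin 3) : gram g p y i j = g.inner ((extChartAt (𝓡∂ 3) p).symm y)
      (cframe p i ((extChartAt (𝓡∂ 3) p).symm y)) (cframe p j ((extChartAt (𝓡∂ 3) p).symm y)) := by
  rw [cframe_symm p i hy, cframe_symm p j hy]; rfl

theorem mapsTo_symm_target (p : M) : MapsTo (extChartAt (𝓡∂ 3) p).symm
    (extChartAt (𝓡∂ 3) p).target (chartAt (EuclideanHalfSpace 3) p).source := by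
  rw [← extChartAt_source (𝓡∂ 3)]; exact (extChartAt (𝓡∂ 3) p).mapsTo_symm

theorem sm_comp_symm {p : M} {U : Set M} {f : M → ℝ} (hf : ContMDiffOn (𝓡∂ 3) 𝓘(ℝ, ℝ) ∞ f U) :
    Sm ((extChartAt (𝓡∂ 3) p).target ∩ (extChartAt (𝓡∂ 3) p).symm ⁻¹' U)
      (fun y => f ((extChartAt (𝓡∂ 3) p).symm y)) := by
  rw [Sm, ← contMDiffOn_iff_contDiffOn]
  exact hf.comp ((contMDiffOn_extChartAt_symm p).mono inter_subset_left) fun y hy => hy.2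

theorem sm_gram (g : RMetric M) (p : M) (i j : Fin 3) :
    Sm (extChartAt (𝓡∂ 3) p).target (fun y => gram g p y i j) := by
  refine ((sm_comp_symm (contMDiffOn_inner_cframe g p i j)).mono ?_).congr
    fun y hy => gram_apply g p hy i j
  exact fun y hy => ⟨hy, mapsTo_symm_target p hy⟩

theorem sum_cframe (p : M) (q : M) (x : Fin 3 → ℝ) :
    ∑ i, x i • cframe p i q = (trivializationAt E3 (TangentSpace (𝓡∂ 3)) p).symmL ℝ q
      (WithLp.toLp 2 x : E3) := by
  simp only [cframe, ← map_smul, ← map_sum]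
  congr 1
  ext i
  fin_cases i <;> simp [Fin.sum_univ_three]

theorem symmL_injective (p : M) {q : M} (hq : q ∈ (chartAt (EuclideanHalfSpace 3) p).source) :
    Function.Injective ((trivializationAt E3 (TangentSpace (𝓡∂ 3)) p).symmL ℝ q) := by
  have hq' : q ∈ (trivializationAt E3 (TangentSpace (𝓡∂ 3) : M → Type) p).baseSet := hq
  intro v w h
  have := congrArg ((trivializationAt E3 (TangentSpace (𝓡∂ 3)) p).continuousLinearMapAt ℝ q) h
  simpa [Bundle.Trivialization.continuousLinearMapAt_symmL _ hq'] using this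

theorem met_gram (g : RMetric M) (p : M) : Met (extChartAt (𝓡∂ 3) p).target (gram g p) := by
  refine ⟨sm_gram g p, fun y hy => ?_⟩
  refine Matrix.PosDef.of_dotProduct_mulVec_pos ?_ fun x hx => ?_
  · ext i j
    change star (gram g p y j i) = gram g p y i j
    rw [star_trivial, gram_apply g p hy, gram_apply g p hy]
    exact g.symm _ _ _
  · have hq := mapsTo_symm_target p hy
    have hne : ∑ i, x i • cframe p i ((extChartAt (𝓡∂ 3) p).symm y) ≠ 0 := by
      rw [sum_cframe]
      intro h0
      rw [← map_zero ((trivializationAt E3 (TangentSpace (𝓡∂ 3)) p).symmL ℝ _)] at h0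
      have := symmL_injective p hq h0
      exact hx (by simpa using congrArg WithLp.ofLp this)
    have := g.pos _ _ hne
    simp only [map_sum, map_smul, sum_apply, smul_apply,
      smul_eq_mul, Finset.mul_sum] at this
    simp only [Matrix.mulVec, dotProduct, gram_apply g p hy, Pi.star_apply, star_trivial,
      Finset.mul_sum]
    refine this.trans_le (le_of_eq ?_)
    rw [Finset.sum_comm]
    exact Finset.sum_congr rfl fun i _ => Finset.sum_congr rfl fun j _ => by ring

theorem components_apply (X : ∀ q : M, TangentSpace (𝓡∂ 3) q) (p : M) {y : E3}
    (hy : y ∈ (extChartAt (𝓡∂ 3) p).target) (k : Fin 3) : components X p y k =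
      (trivializationAt E3 (TangentSpace (𝓡∂ 3)) p
        ⟨(extChartAt (𝓡∂ 3) p).symm y, X ((extChartAt (𝓡∂ 3) p).symm y)⟩).2 k := by
  have hq := mapsTo_symm_target p hy
  have hq' : (extChartAt (𝓡∂ 3) p).symm y ∈
    (trivializationAt E3 (TangentSpace (𝓡∂ 3) : M → Type) p).baseSet := hq
  have key : ((trivializationAt E3 (TangentSpace (𝓡∂ 3)) p).continuousLinearMapAt ℝ _
      (X ((extChartAt (𝓡∂ 3) p).symm y)) : E3) = (trivializationAt E3 (TangentSpace (𝓡∂ 3)) p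
        ⟨(extChartAt (𝓡∂ 3) p).symm y, X ((extChartAt (𝓡∂ 3) p).symm y)⟩).2 := by
    rw [Bundle.Trivialization.continuousLinearMapAt_apply,
      Bundle.Trivialization.linearMapAt_apply, if_pos hq']
  rw [components, ← TangentBundle.continuousLinearMapAt_trivializationAt hq]
  exact congrArg (fun v : E3 => v k) key

theorem sm_components {X : ∀ q : M, TangentSpace (𝓡∂ 3) q} {U : Set M} (hX : ContMDiffOn (𝓡∂ 3)
    (𝓡∂ 3).tangent ∞ (fun q => (⟨q, X q⟩ : TangentBundle (𝓡∂ 3) M)) U) (p : M) (k : Fin 3) :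
    Sm ((extChartAt (𝓡∂ 3) p).target ∩ (extChartAt (𝓡∂ 3) p).symm ⁻¹' U)
      (fun y => components X p y k) := by
  have h : ContMDiffOn (𝓡∂ 3) 𝓘(ℝ, E3) ∞
      (fun q => (trivializationAt E3 (TangentSpace (𝓡∂ 3)) p ⟨q, X q⟩).2)
      (U ∩ (chartAt (EuclideanHalfSpace 3) p).source) := by
    intro q hq
    exact (((trivializationAt E3 (TangentSpace (𝓡∂ 3) : M → Type) p).contMDiffWithinAt_iff
      (by rw [Bundle.Trivialization.mem_source]; exact hq.2)).1 ((hX q hq.1).mono inter_subset_left)).2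
  have h2 : ContMDiffOn (𝓡∂ 3) 𝓘(ℝ, ℝ) ∞
      (fun q => (trivializationAt E3 (TangentSpace (𝓡∂ 3)) p ⟨q, X q⟩).2 k)
      (U ∩ (chartAt (EuclideanHalfSpace 3) p).source) :=
    (EuclideanSpace.proj (𝕜 := ℝ) k).contDiff.contMDiff.comp_contMDiffOn h
  refine ((sm_comp_symm (p := p) h2).mono ?_).congr fun y hy => components_apply X p hy.1 k
  exact fun y hy => ⟨hy.1, hy.2, mapsTo_symm_target p hy.1⟩

theorem sum_components (X : ∀ q : M, TangentSpace (𝓡∂ 3) q) (p : M) {y : E3}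
    (hy : y ∈ (extChartAt (𝓡∂ 3) p).target) : X ((extChartAt (𝓡∂ 3) p).symm y) =
      ∑ k, components X p y k • cframe p k ((extChartAt (𝓡∂ 3) p).symm y) := by
  have hq := mapsTo_symm_target p hy
  have hq' : (extChartAt (𝓡∂ 3) p).symm y ∈
    (trivializationAt E3 (TangentSpace (𝓡∂ 3) : M → Type) p).baseSet := hq
  rw [sum_cframe]
  have : (WithLp.toLp 2 (fun k => components X p y k) : E3) =
      (trivializationAt E3 (TangentSpace (𝓡∂ 3)) p).continuousLinearMapAt ℝ _
        (X ((extChartAt (𝓡∂ 3) p).symm y)) := by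
    ext k
    rw [TangentBundle.continuousLinearMapAt_trivializationAt hq]; rfl
  rw [this, Bundle.Trivialization.symmL_continuousLinearMapAt _ hq']

theorem components_eq_iff (X : ∀ q : M, TangentSpace (𝓡∂ 3) q) (p : M) {y : E3}
    (hy : y ∈ (extChartAt (𝓡∂ 3) p).target) (x : Fin 3 → ℝ)
    (h : X ((extChartAt (𝓡∂ 3) p).symm y) = ∑ k, x k • cframe p k ((extChartAt (𝓡∂ 3) p).symm y))
    (k : Fin 3) : components X p y k = x k := by
  rw [sum_components X p hy, sum_cframe, sum_cframe] at h
  have := symmL_injective p (mapsTo_symm_target p hy) h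
  exact congrArg (fun v : E3 => v k) this

end Manifold

/-! ### Isometric maps in coordinates -/

section

variable {M : Type u} [TopologicalSpace M] [ChartedSpace (EuclideanHalfSpace 3) M]
  [IsManifold (𝓡∂ 3) ∞ M] {N : Type v} [TopologicalSpace N] [ChartedSpace (EuclideanHalfSpace 3) N]
  [IsManifold (𝓡∂ 3) ∞ N]

/-- Smooth maps that preserve the metric. -/
structure IsoMap (g : RMetric M) (h : RMetric N) (ι : M → N) : Prop where
  smooth : ContMDiff (𝓡∂ 3) (𝓡∂ 3) ∞ ι
  isometric : ∀ (p : M) (v w : TangentSpace (𝓡∂ 3) p),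
    h.inner (ι p) (mfderiv (𝓡∂ 3) (𝓡∂ 3) ι p v) (mfderiv (𝓡∂ 3) (𝓡∂ 3) ι p w) = g.inner p v w

theorem IsIsometricEmbedding.isoMap {g : RMetric M} {h : RMetric N} {ι : M → N}
    (hι : IsIsometricEmbedding g h ι) : IsoMap g h ι :=
  ⟨hι.isSmoothEmbedding.contMDiff, hι.isometric⟩

theorem IsoMap.id (g : RMetric M) : IsoMap g g (fun q => q) :=
  ⟨contMDiff_id, fun p v w => by
    have : mfderiv (𝓡∂ 3) (𝓡∂ 3) (fun q : M => q) p = ContinuousLinearMap.id ℝ _ := mfderiv_id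
    rw [this]; rfl⟩

/-- The map `ι` in the charts at `p` and `p'`. -/
def coordMap (ι : M → N) (p : M) (p' : N) (y : E3) : E3 :=
  extChartAt (𝓡∂ 3) p' (ι ((extChartAt (𝓡∂ 3) p).symm y))

/-- The domain of `coordMap ι p p'`. -/
def coordDom (ι : M → N) (p : M) (p' : N) : Set E3 :=
  (extChartAt (𝓡∂ 3) p).target ∩ (extChartAt (𝓡∂ 3) p).symm ⁻¹' (ι ⁻¹' (extChartAt (𝓡∂ 3) p').source)

theorem mem_coordDom {ι : M → N} {p q : M} {p' : N} (hq : q ∈ (extChartAt (𝓡∂ 3) p).source)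
    (hq' : ι q ∈ (extChartAt (𝓡∂ 3) p').source) : extChartAt (𝓡∂ 3) p q ∈ coordDom ι p p' := by
  refine ⟨(extChartAt (𝓡∂ 3) p).map_source hq, ?_⟩
  rwa [mem_preimage, (extChartAt (𝓡∂ 3) p).left_inv hq]

theorem coordMap_apply {ι : M → N} {p q : M} {p' : N} (hq : q ∈ (extChartAt (𝓡∂ 3) p).source) :
    coordMap ι p p' (extChartAt (𝓡∂ 3) p q) = extChartAt (𝓡∂ 3) p' (ι q) := by
  rw [coordMap, (extChartAt (𝓡∂ 3) p).left_inv hq]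

theorem symm_coordMap {ι : M → N} {p : M} {p' : N} {y : E3} (hy : y ∈ coordDom ι p p') :
    (extChartAt (𝓡∂ 3) p').symm (coordMap ι p p' y) = ι ((extChartAt (𝓡∂ 3) p).symm y) :=
  (extChartAt (𝓡∂ 3) p').left_inv hy.2

variable {ι : M → N} (hs : ContMDiff (𝓡∂ 3) (𝓡∂ 3) ∞ ι)
include hs

theorem dom_coordDom (p : M) (p' : N) : Dom (coordDom ι p p') :=
  dom_inter_preimage p ((isOpen_extChartAt_source p').preimage hs.continuous)

theorem contDiffOn_coordMap (p : M) (p' : N) :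
    ContDiffOn ℝ ∞ (coordMap ι p p') (coordDom ι p p') := by
  rw [← contMDiffOn_iff_contDiffOn]
  have h1 : ContMDiffOn (𝓡∂ 3) 𝓘(ℝ, E3) ∞ (extChartAt (𝓡∂ 3) p') (extChartAt (𝓡∂ 3) p').source := by
    rw [extChartAt_source]
    exact contMDiffOn_extChartAt
  exact h1.comp (hs.comp_contMDiffOn ((contMDiffOn_extChartAt_symm p).mono inter_subset_left))
    fun y hy => hy.2

omit hs in
theorem mapsTo_coordMap (p : M) (p' : N) :
    MapsTo (coordMap ι p p') (coordDom ι p p') (extChartAt (𝓡∂ 3) p').target :=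
  fun _ hy => (extChartAt (𝓡∂ 3) p').map_source hy.2

/-- The Jacobian of `ι` in charts is the matrix of `dι` in the coordinate frames; this converts the
isometry condition into the matrix identity required by `Trans`. -/
theorem mfderiv_cframe (p : M) (p' : N) {y : E3} (hy : y ∈ coordDom ι p p') (i : Fin 3) :
    mfderiv (𝓡∂ 3) (𝓡∂ 3) ι ((extChartAt (𝓡∂ 3) p).symm y)
        (cframe p i ((extChartAt (𝓡∂ 3) p).symm y)) =
      ∑ a, jac (coordMap ι p p') y a i • cframe p' a (ι ((extChartAt (𝓡∂ 3) p).symm y)) := by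
  have hq' : ι ((extChartAt (𝓡∂ 3) p).symm y) ∈ (chartAt (EuclideanHalfSpace 3) p').source := by
    rw [← extChartAt_source (𝓡∂ 3)]; exact hy.2
  have h1 := (mdifferentiableWithinAt_extChartAt_symm (I := 𝓡∂ 3) hy.1).hasMFDerivWithinAt
  have h2 := (hs.mdifferentiableAt (by simp) (x := (extChartAt (𝓡∂ 3) p).symm y)).hasMFDerivAt
  have h3 := (mdifferentiableAt_extChartAt (I := 𝓡∂ 3) hq').hasMFDerivAt
  have h4 := (h3.comp _ h2).comp_hasMFDerivWithinAt _ h1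
  rw [hasMFDerivWithinAt_iff_hasFDerivWithinAt] at h4
  have h5 : ∀ a, jac (coordMap ι p p') y a i = EuclideanSpace.proj (𝕜 := ℝ) a
      (mfderiv (𝓡∂ 3) 𝓘(ℝ, E3) (extChartAt (𝓡∂ 3) p') (ι ((extChartAt (𝓡∂ 3) p).symm y))
        (mfderiv (𝓡∂ 3) (𝓡∂ 3) ι ((extChartAt (𝓡∂ 3) p).symm y) (coordVec p y i))) := by
    intro a
    have h6 := (EuclideanSpace.proj (𝕜 := ℝ) a).hasFDerivAt.comp_hasFDerivWithinAt y h4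
    have h7 := h6.fderivWithin (uniqueDiffOn_HS y (target_subset_HS p hy.1))
    rw [jac_apply, pd]
    have e : (fun z => coordMap ι p p' z a) = (EuclideanSpace.proj (𝕜 := ℝ) a) ∘
      ((extChartAt (𝓡∂ 3) p' ∘ ι) ∘ (extChartAt (𝓡∂ 3) p).symm) := rfl
    rw [e, h7]
    rfl
  rw [sum_cframe, cframe_symm p i hy.1]
  have e : (WithLp.toLp 2 (fun a => jac (coordMap ι p p') y a i) : E3) =
      (trivializationAt E3 (TangentSpace (𝓡∂ 3)) p').continuousLinearMapAt ℝ _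
        (mfderiv (𝓡∂ 3) (𝓡∂ 3) ι ((extChartAt (𝓡∂ 3) p).symm y) (coordVec p y i)) := by
    ext a
    rw [TangentBundle.continuousLinearMapAt_trivializationAt hq']
    exact h5 a
  rw [e, Bundle.Trivialization.symmL_continuousLinearMapAt _ hq']

-- The passage from coordinates to manifolds: with `ι` the identity it expresses independence of the
-- chart, with `ι` an embedding it gives isometry invariance.
omit hs in
theorem IsoMap.trans {g : RMetric M} {h : RMetric N} (H : IsoMap g h ι) (p : M) (p' : N) :
    Trans (coordDom ι p p') (extChartAt (𝓡∂ 3) p').target (gram g p) (gram h p')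
      (coordMap ι p p') := by
  refine ⟨dom_coordDom H.smooth p p', dom_target p', (met_gram g p).mono inter_subset_left,
    met_gram h p', contDiffOn_coordMap H.smooth p p', mapsTo_coordMap p p', fun y hy => ?_⟩
  have hg : ∀ a b, gram h p' (coordMap ι p p' y) a b =
      h.inner (ι ((extChartAt (𝓡∂ 3) p).symm y)) (cframe p' a (ι ((extChartAt (𝓡∂ 3) p).symm y)))
        (cframe p' b (ι ((extChartAt (𝓡∂ 3) p).symm y))) := fun a b => by
    rw [gram_apply h p' (mapsTo_coordMap p p' hy), symm_coordMap hy]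
  ext i j
  rw [gram_apply g p hy.1, ← H.isometric, mfderiv_cframe H.smooth p p' hy,
    mfderiv_cframe H.smooth p p' hy]
  simp only [map_sum, map_smul, sum_apply, smul_apply, smul_eq_mul, Matrix.mul_apply,
    Matrix.transpose_apply, hg,
    Finset.sum_mul, Finset.mul_sum]
  refine Finset.sum_congr rfl fun a _ => Finset.sum_congr rfl fun b _ => ?_
  ring

theorem jac_components {X : ∀ q : M, TangentSpace (𝓡∂ 3) q} {Y : ∀ q : N, TangentSpace (𝓡∂ 3) q}
    (p : M) (p' : N) {y : E3} (hy : y ∈ coordDom ι p p')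
    (hXY : mfderiv (𝓡∂ 3) (𝓡∂ 3) ι ((extChartAt (𝓡∂ 3) p).symm y)
      (X ((extChartAt (𝓡∂ 3) p).symm y)) = Y (ι ((extChartAt (𝓡∂ 3) p).symm y))) (a : Fin 3) :
    ∑ k, jac (coordMap ι p p') y a k * components X p y k =
      components Y p' (coordMap ι p p' y) a := by
  refine (components_eq_iff Y p' (mapsTo_coordMap p p' hy)
    (fun a => ∑ k, jac (coordMap ι p p') y a k * components X p y k) ?_ a).symm
  rw [symm_coordMap hy, ← hXY, sum_components X p hy.1, map_sum]
  simp only [map_smul, mfderiv_cframe hs p p' hy, Finset.sum_smul, Finset.smul_sum, smul_smul]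
  rw [Finset.sum_comm]
  exact Finset.sum_congr rfl fun a _ => Finset.sum_congr rfl fun b _ => by rw [mul_comm]

end

/-! ### Chart independence and smoothness of scalar curvature, Laplacian, gradient and divergence -/

section

variable {M : Type u} [TopologicalSpace M] [ChartedSpace (EuclideanHalfSpace 3) M]
  [IsManifold (𝓡∂ 3) ∞ M] {N : Type v} [TopologicalSpace N] [ChartedSpace (EuclideanHalfSpace 3) N]
  [IsManifold (𝓡∂ 3) ∞ N]

/-- The Laplacian on a Riemannian manifold. -/
def lap (g : RMetric M) (f : M → ℝ) (q : M) : ℝ :=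
  laplacian (gram g q) (fun y => f ((extChartAt (𝓡∂ 3) q).symm y)) (extChartAt (𝓡∂ 3) q q)

/-- The squared length of the gradient on a Riemannian manifold. -/
def gsq (g : RMetric M) (f : M → ℝ) (q : M) : ℝ :=
  gradSq (gram g q) (fun y => f ((extChartAt (𝓡∂ 3) q).symm y)) (extChartAt (𝓡∂ 3) q q)

theorem hessian_congr {D : Set E3} (hD : Dom D) {G : E3 → Matrix (Fin 3) (Fin 3) ℝ} {f f' : E3 → ℝ}
    (hf : EqOn f f' D) {y : E3} (hy : y ∈ D) (i j : Fin 3) :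
    hessian G f i j y = hessian G f' i j y := by
  rw [hessian, hessian, hD.pd_congr (fun z hz => hD.pd_congr hf j hz) i hy]
  simp only [fun k => hD.pd_congr hf k hy]

theorem laplacian_congr {D : Set E3} (hD : Dom D) {G : E3 → Matrix (Fin 3) (Fin 3) ℝ}
    {f f' : E3 → ℝ} (hf : EqOn f f' D) {y : E3} (hy : y ∈ D) :
    laplacian G f y = laplacian G f' y := by
  simp only [laplacian, hessian_congr hD hf hy]

theorem gradSq_congr {D : Set E3} (hD : Dom D) {G : E3 → Matrix (Fin 3) (Fin 3) ℝ}
    {f f' : E3 → ℝ} (hf : EqOn f f' D) {y : E3} (hy : y ∈ D) :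
    gradSq G f y = gradSq G f' y := by
  simp only [gradSq, fun k => hD.pd_congr hf k hy]

theorem adjLin_congr {D : Set E3} (hD : Dom D) {G : E3 → Matrix (Fin 3) (Fin 3) ℝ}
    {f f' : E3 → ℝ} (hf : EqOn f f' D) {y : E3} (hy : y ∈ D) (i j : Fin 3) :
    adjLin G f i j y = adjLin G f' i j y := by
  simp only [adjLin, laplacian_congr hD hf hy, hessian_congr hD hf hy, hf hy]

theorem adjointLinScal_eq (g : RMetric M) (f : M → ℝ) (q : M) (i j : Fin 3) :
    adjointLinScal g f q i j = adjLin (gram g q) (fun y => f ((extChartAt (𝓡∂ 3) q).symm y)) i j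
      (extChartAt (𝓡∂ 3) q q) := by
  simp only [adjLin, extChartAt_to_inv]
  rfl

theorem Trans.restrict {D D' E E' : Set E3} {G' G : E3 → Matrix (Fin 3) (Fin 3) ℝ} {τ : E3 → E3}
    (T : Trans D D' G' G τ) (hE : Dom E) (hE' : Dom E') (h : E ⊆ D) (h' : E' ⊆ D')
    (hm : MapsTo τ E E') : Trans E E' G' G τ :=
  ⟨hE, hE', T.met.mono h, T.met'.mono h', T.sm.mono h, hm, fun y hy => T.pull y (h hy)⟩

/-- The part of the chart domain at `p` that lies in `U`, in coordinates. -/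
def chartDom (p : M) (U : Set M) : Set E3 :=
  (extChartAt (𝓡∂ 3) p).target ∩ (extChartAt (𝓡∂ 3) p).symm ⁻¹' U

theorem mem_chartDom {p q : M} {U : Set M} (hq : q ∈ (extChartAt (𝓡∂ 3) p).source) (hU : q ∈ U) :
    extChartAt (𝓡∂ 3) p q ∈ chartDom p U := by
  refine ⟨(extChartAt (𝓡∂ 3) p).map_source hq, ?_⟩
  rwa [mem_preimage, (extChartAt (𝓡∂ 3) p).left_inv hq]

theorem dom_chartDom (p : M) {U : Set M} (hU : IsOpen U) : Dom (chartDom p U) :=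
  dom_inter_preimage p hU

theorem met_chartDom (g : RMetric M) (p : M) (U : Set M) : Met (chartDom p U) (gram g p) :=
  (met_gram g p).mono inter_subset_left

theorem sm_chartDom {p : M} {U : Set M} {f : M → ℝ} (hf : ContMDiffOn (𝓡∂ 3) 𝓘(ℝ, ℝ) ∞ f U) :
    Sm (chartDom p U) (fun y => f ((extChartAt (𝓡∂ 3) p).symm y)) := sm_comp_symm hf

section Iso

variable {g : RMetric M} {h : RMetric N} {ι : M → N} (H : IsoMap g h ι)
include H

theorem IsoMap.transOn (p : M) (p' : N) {U : Set N} (hU : IsOpen U) :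
    Trans (chartDom p (ι ⁻¹' ((extChartAt (𝓡∂ 3) p').source ∩ U))) (chartDom p' U) (gram g p)
      (gram h p') (coordMap ι p p') := by
  refine (H.trans p p').restrict (dom_chartDom p (((isOpen_extChartAt_source p').inter hU).preimage
    H.smooth.continuous)) (dom_chartDom p' hU) (fun y hy => ⟨hy.1, hy.2.1⟩) inter_subset_left
    fun y hy => ⟨mapsTo_coordMap p p' ⟨hy.1, hy.2.1⟩, ?_⟩
  rw [mem_preimage, symm_coordMap ⟨hy.1, hy.2.1⟩]
  exact hy.2.2

theorem IsoMap.scalar_eq {p q : M} {p' : N} (hq : q ∈ (extChartAt (𝓡∂ 3) p).source)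
    (hq' : ι q ∈ (extChartAt (𝓡∂ 3) p').source) :
    scalar (gram g p) (extChartAt (𝓡∂ 3) p q) = scalar (gram h p') (extChartAt (𝓡∂ 3) p' (ι q)) := by
  rw [(H.trans p p').scalar_eq (mem_coordDom hq hq'), coordMap_apply hq]

theorem IsoMap.laplacian_eq {f : N → ℝ} {U : Set N} (hU : IsOpen U)
    (hf : ContMDiffOn (𝓡∂ 3) 𝓘(ℝ, ℝ) ∞ f U) {p q : M} {p' : N}
    (hq : q ∈ (extChartAt (𝓡∂ 3) p).source) (hq' : ι q ∈ (extChartAt (𝓡∂ 3) p').source)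
    (hqU : ι q ∈ U) :
    laplacian (gram g p) (fun y => f (ι ((extChartAt (𝓡∂ 3) p).symm y))) (extChartAt (𝓡∂ 3) p q) =
      laplacian (gram h p') (fun y => f ((extChartAt (𝓡∂ 3) p').symm y))
        (extChartAt (𝓡∂ 3) p' (ι q)) := by
  have T := H.transOn p p' hU
  have hm := mem_chartDom (U := ι ⁻¹' ((extChartAt (𝓡∂ 3) p').source ∩ U)) hq ⟨hq', hqU⟩
  rw [← coordMap_apply (p' := p') hq, ← T.laplacian_eq (sm_chartDom hf) hm]
  exact laplacian_congr T.dom (fun y hy => by rw [symm_coordMap ⟨hy.1, hy.2.1⟩]) hm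

theorem IsoMap.gradSq_eq {f : N → ℝ} {U : Set N} (hU : IsOpen U)
    (hf : ContMDiffOn (𝓡∂ 3) 𝓘(ℝ, ℝ) ∞ f U) {p q : M} {p' : N}
    (hq : q ∈ (extChartAt (𝓡∂ 3) p).source) (hq' : ι q ∈ (extChartAt (𝓡∂ 3) p').source)
    (hqU : ι q ∈ U) :
    gradSq (gram g p) (fun y => f (ι ((extChartAt (𝓡∂ 3) p).symm y))) (extChartAt (𝓡∂ 3) p q) =
      gradSq (gram h p') (fun y => f ((extChartAt (𝓡∂ 3) p').symm y))
        (extChartAt (𝓡∂ 3) p' (ι q)) := by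
  have T := H.transOn p p' hU
  have hm := mem_chartDom (U := ι ⁻¹' ((extChartAt (𝓡∂ 3) p').source ∩ U)) hq ⟨hq', hqU⟩
  rw [← coordMap_apply (p' := p') hq, ← T.gradSq_eq (sm_chartDom hf) hm]
  exact gradSq_congr T.dom (fun y hy => by rw [symm_coordMap ⟨hy.1, hy.2.1⟩]) hm

theorem IsoMap.adjLin_eq_zero {f : N → ℝ} {U : Set N} (hU : IsOpen U)
    (hf : ContMDiffOn (𝓡∂ 3) 𝓘(ℝ, ℝ) ∞ f U) {p q : M} {p' : N}
    (hq : q ∈ (extChartAt (𝓡∂ 3) p).source) (hq' : ι q ∈ (extChartAt (𝓡∂ 3) p').source)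
    (hqU : ι q ∈ U) (h0 : ∀ i j, adjLin (gram h p') (fun y => f ((extChartAt (𝓡∂ 3) p').symm y)) i j
        (extChartAt (𝓡∂ 3) p' (ι q)) = 0) (i j : Fin 3) :
    adjLin (gram g p) (fun y => f (ι ((extChartAt (𝓡∂ 3) p).symm y))) i j
      (extChartAt (𝓡∂ 3) p q) = 0 := by
  have T := H.transOn p p' hU
  have hm := mem_chartDom (U := ι ⁻¹' ((extChartAt (𝓡∂ 3) p').source ∩ U)) hq ⟨hq', hqU⟩
  have := T.adjLin_eq (sm_chartDom hf) hm i j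
  simp only [coordMap_apply (p' := p') hq, h0, mul_zero, Finset.sum_const_zero] at this
  rw [← this]
  exact adjLin_congr T.dom (fun y hy => by rw [symm_coordMap ⟨hy.1, hy.2.1⟩]) hm i j

theorem IsoMap.divergence_eq {X : ∀ q : M, TangentSpace (𝓡∂ 3) q}
    {Y : ∀ q : N, TangentSpace (𝓡∂ 3) q} {U : Set N} (hU : IsOpen U)
    (hX : ContMDiffOn (𝓡∂ 3) (𝓡∂ 3).tangent ∞ (fun q => (⟨q, X q⟩ : TangentBundle (𝓡∂ 3) M))
      (ι ⁻¹' U))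
    (hY : ContMDiffOn (𝓡∂ 3) (𝓡∂ 3).tangent ∞ (fun q => (⟨q, Y q⟩ : TangentBundle (𝓡∂ 3) N)) U)
    (hXY : ∀ q ∈ ι ⁻¹' U, mfderiv (𝓡∂ 3) (𝓡∂ 3) ι q (X q) = Y (ι q)) {p q : M} {p' : N}
    (hq : q ∈ (extChartAt (𝓡∂ 3) p).source) (hq' : ι q ∈ (extChartAt (𝓡∂ 3) p').source)
    (hqU : ι q ∈ U) : divergence (gram g p) (components X p) (extChartAt (𝓡∂ 3) p q) =
      divergence (gram h p') (components Y p') (extChartAt (𝓡∂ 3) p' (ι q)) := by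
  have T := H.transOn p p' hU
  have hm := mem_chartDom (U := ι ⁻¹' ((extChartAt (𝓡∂ 3) p').source ∩ U)) hq ⟨hq', hqU⟩
  rw [T.divergence_eq (fun k => (sm_components hX p k).mono fun y hy => ⟨hy.1, hy.2.2⟩)
    (fun k => sm_components hY p' k) (fun z hz a => jac_components H.smooth p p' ⟨hz.1, hz.2.1⟩
      (hXY _ hz.2.2) a) hm, coordMap_apply hq]

end Iso

variable (g : RMetric M)

/-- The definition uses a different chart at every point. Since the identity is isometric, a single
chart may be used near a given point, and smoothness in `q` follows; the next lemmas do the same for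
the other operators. -/
theorem scalarCurvature_eq {p q : M} (hq : q ∈ (extChartAt (𝓡∂ 3) p).source) :
    scalarCurvature g q = scalar (gram g p) (extChartAt (𝓡∂ 3) p q) :=
  (IsoMap.id g).scalar_eq (mem_extChartAt_source q) hq

theorem lap_eq {f : M → ℝ} {U : Set M} (hU : IsOpen U) (hf : ContMDiffOn (𝓡∂ 3) 𝓘(ℝ, ℝ) ∞ f U)
    {p q : M} (hq : q ∈ (extChartAt (𝓡∂ 3) p).source) (hqU : q ∈ U) : lap g f q =
      laplacian (gram g p) (fun y => f ((extChartAt (𝓡∂ 3) p).symm y)) (extChartAt (𝓡∂ 3) p q) :=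
  (IsoMap.id g).laplacian_eq hU hf (mem_extChartAt_source q) hq hqU

theorem gsq_eq {f : M → ℝ} {U : Set M} (hU : IsOpen U) (hf : ContMDiffOn (𝓡∂ 3) 𝓘(ℝ, ℝ) ∞ f U)
    {p q : M} (hq : q ∈ (extChartAt (𝓡∂ 3) p).source) (hqU : q ∈ U) : gsq g f q =
      gradSq (gram g p) (fun y => f ((extChartAt (𝓡∂ 3) p).symm y)) (extChartAt (𝓡∂ 3) p q) :=
  (IsoMap.id g).gradSq_eq hU hf (mem_extChartAt_source q) hq hqU

theorem div_eq {X : ∀ q : M, TangentSpace (𝓡∂ 3) q} {U : Set M} (hU : IsOpen U)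
    (hX : ContMDiffOn (𝓡∂ 3) (𝓡∂ 3).tangent ∞ (fun q => (⟨q, X q⟩ : TangentBundle (𝓡∂ 3) M)) U)
    {p q : M} (hq : q ∈ (extChartAt (𝓡∂ 3) p).source) (hqU : q ∈ U) :
    div g X q = divergence (gram g p) (components X p) (extChartAt (𝓡∂ 3) p q) :=
  (IsoMap.id g).divergence_eq hU hX hX (fun q _ => by
    have : mfderiv (𝓡∂ 3) (𝓡∂ 3) (fun q : M => q) q = ContinuousLinearMap.id ℝ _ := mfderiv_id
    rw [this]; rfl) (mem_extChartAt_source q) hq hqU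

theorem adjLin_eq_zero_of_adjointLinScal {f : M → ℝ} {U : Set M} (hU : IsOpen U)
    (hf : ContMDiffOn (𝓡∂ 3) 𝓘(ℝ, ℝ) ∞ f U) (h0 : ∀ q ∈ U, ∀ i j, adjointLinScal g f q i j = 0)
    (p : M) : ∀ y ∈ chartDom p U, ∀ i j,
      adjLin (gram g p) (fun y => f ((extChartAt (𝓡∂ 3) p).symm y)) i j y = 0 := by
  intro y hy i j
  have h1 := (IsoMap.id g).adjLin_eq_zero hU hf ((extChartAt (𝓡∂ 3) p).map_target hy.1)
    (mem_extChartAt_source ((extChartAt (𝓡∂ 3) p).symm y)) hy.2 (fun i j => by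
      rw [← adjointLinScal_eq]; exact h0 _ hy.2 i j) i j
  rwa [(extChartAt (𝓡∂ 3) p).right_inv hy.1] at h1

theorem contMDiffOn_of_chart {f : M → ℝ} {p : M} {U : Set M} {F : E3 → ℝ}
    (hF : Sm (chartDom p U) F)
    (h : ∀ q ∈ U ∩ (extChartAt (𝓡∂ 3) p).source, f q = F (extChartAt (𝓡∂ 3) p q)) :
    ContMDiffOn (𝓡∂ 3) 𝓘(ℝ, ℝ) ∞ f (U ∩ (extChartAt (𝓡∂ 3) p).source) := by
  rw [Sm, ← contMDiffOn_iff_contDiffOn] at hF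
  refine (hF.comp (contMDiffOn_extChartAt.mono ?_) fun q hq => mem_chartDom hq.2 hq.1).congr h
  rw [extChartAt_source]
  exact inter_subset_right

theorem contMDiffOn_of_charts {f : M → ℝ} {U : Set M} {F : M → E3 → ℝ}
    (hF : ∀ p, Sm (chartDom p U) (F p)) (hU : IsOpen U)
    (h : ∀ p, ∀ q ∈ U ∩ (extChartAt (𝓡∂ 3) p).source, f q = F p (extChartAt (𝓡∂ 3) p q)) :
    ContMDiffOn (𝓡∂ 3) 𝓘(ℝ, ℝ) ∞ f U := by
  intro q hq
  refine ContMDiffAt.contMDiffWithinAt ?_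
  exact (contMDiffOn_of_chart (hF q) (h q)).contMDiffAt
    ((hU.inter (isOpen_extChartAt_source q)).mem_nhds ⟨hq, mem_extChartAt_source q⟩)

theorem contMDiff_scalarCurvature : ContMDiff (𝓡∂ 3) 𝓘(ℝ, ℝ) ∞ (scalarCurvature g) := by
  rw [← contMDiffOn_univ]
  exact contMDiffOn_of_charts (F := fun p => scalar (gram g p))
    (fun p => sm_scalar (dom_chartDom p isOpen_univ) (met_chartDom g p _)) isOpen_univ
    fun p q hq => scalarCurvature_eq g hq.2

theorem contMDiffOn_lap {f : M → ℝ} {U : Set M} (hU : IsOpen U)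
    (hf : ContMDiffOn (𝓡∂ 3) 𝓘(ℝ, ℝ) ∞ f U) : ContMDiffOn (𝓡∂ 3) 𝓘(ℝ, ℝ) ∞ (lap g f) U :=
  contMDiffOn_of_charts (fun p => sm_laplacian (dom_chartDom p hU) (met_chartDom g p _)
    (sm_chartDom hf)) hU fun _ _ hq => lap_eq g hU hf hq.2 hq.1

theorem contMDiffOn_gsq {f : M → ℝ} {U : Set M} (hU : IsOpen U)
    (hf : ContMDiffOn (𝓡∂ 3) 𝓘(ℝ, ℝ) ∞ f U) : ContMDiffOn (𝓡∂ 3) 𝓘(ℝ, ℝ) ∞ (gsq g f) U :=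
  contMDiffOn_of_charts (fun p => sm_gradSq (dom_chartDom p hU) (met_chartDom g p _)
    (sm_chartDom hf)) hU fun _ _ hq => gsq_eq g hU hf hq.2 hq.1

theorem contMDiffOn_div {X : ∀ q : M, TangentSpace (𝓡∂ 3) q} {U : Set M} (hU : IsOpen U)
    (hX : ContMDiffOn (𝓡∂ 3) (𝓡∂ 3).tangent ∞ (fun q => (⟨q, X q⟩ : TangentBundle (𝓡∂ 3) M)) U) :
    ContMDiffOn (𝓡∂ 3) 𝓘(ℝ, ℝ) ∞ (div g X) U :=
  contMDiffOn_of_charts (fun p => sm_divergence (dom_chartDom p hU) (met_chartDom g p _)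
    (sm_components hX p)) hU fun _ _ hq => div_eq g hU hX hq.2 hq.1

end

/-! ### Gradients -/

section

variable {M : Type u} [TopologicalSpace M] [ChartedSpace (EuclideanHalfSpace 3) M]
  [IsManifold (𝓡∂ 3) ∞ M] (g : RMetric M)

/-- The differential of a function, as a linear form with values in `ℝ`. -/
def dd (f : M → ℝ) (q : M) (v : TangentSpace (𝓡∂ 3) q) : ℝ := mfderiv (𝓡∂ 3) 𝓘(ℝ, ℝ) f q v

theorem dd_sub (f : M → ℝ) (q : M) (v w : TangentSpace (𝓡∂ 3) q) :
    dd f q (v - w) = dd f q v - dd f q w := map_sub (mfderiv (𝓡∂ 3) 𝓘(ℝ, ℝ) f q) v w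

theorem dd_smul (f : M → ℝ) (q : M) (c : ℝ) (v : TangentSpace (𝓡∂ 3) q) :
    dd f q (c • v) = c * dd f q v := map_smul (mfderiv (𝓡∂ 3) 𝓘(ℝ, ℝ) f q) c v

theorem dd_sum (f : M → ℝ) (q : M) {ι : Type*} (s : Finset ι) (v : ι → TangentSpace (𝓡∂ 3) q) :
    dd f q (∑ i ∈ s, v i) = ∑ i ∈ s, dd f q (v i) := map_sum (mfderiv (𝓡∂ 3) 𝓘(ℝ, ℝ) f q) v s

theorem dd_cframe {f : M → ℝ} {p : M} {y : E3} (hy : y ∈ (extChartAt (𝓡∂ 3) p).target)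
    (hf : MDifferentiableAt (𝓡∂ 3) 𝓘(ℝ, ℝ) f ((extChartAt (𝓡∂ 3) p).symm y)) (i : Fin 3) :
    dd f ((extChartAt (𝓡∂ 3) p).symm y) (cframe p i ((extChartAt (𝓡∂ 3) p).symm y)) =
      pd i (fun z => f ((extChartAt (𝓡∂ 3) p).symm z)) y := by
  have h1 := (mdifferentiableWithinAt_extChartAt_symm (I := 𝓡∂ 3) hy).hasMFDerivWithinAt
  have h4 := hf.hasMFDerivAt.comp_hasMFDerivWithinAt _ h1
  rw [hasMFDerivWithinAt_iff_hasFDerivWithinAt] at h4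
  rw [pd, dd, cframe_symm p i hy]
  obtain ⟨L, hL⟩ : ∃ L : E3 →L[ℝ] ℝ, L = (mfderiv (𝓡∂ 3) 𝓘(ℝ, ℝ) f
      ((extChartAt (𝓡∂ 3) p).symm y)).comp (mfderivWithin 𝓘(ℝ, E3) (𝓡∂ 3)
        (extChartAt (𝓡∂ 3) p).symm (Set.range (𝓡∂ 3)) y) := ⟨_, rfl⟩
  have h5 : HasFDerivWithinAt (fun z : E3 => f ((extChartAt (𝓡∂ 3) p).symm z)) L
      (Set.range (𝓡∂ 3)) y := by
    rw [hL]; exact h4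
  have h7 := h5.fderivWithin (uniqueDiffOn_HS y (target_subset_HS p hy))
  rw [h7, hL]
  rfl

theorem dd_apply {f : M → ℝ} {p : M} {y : E3} (hy : y ∈ (extChartAt (𝓡∂ 3) p).target)
    (hf : MDifferentiableAt (𝓡∂ 3) 𝓘(ℝ, ℝ) f ((extChartAt (𝓡∂ 3) p).symm y))
    (X : ∀ q : M, TangentSpace (𝓡∂ 3) q) :
    dd f ((extChartAt (𝓡∂ 3) p).symm y) (X ((extChartAt (𝓡∂ 3) p).symm y)) =
      ∑ k, components X p y k * pd k (fun z => f ((extChartAt (𝓡∂ 3) p).symm z)) y := by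
  rw [sum_components X p hy, dd_sum]
  exact Finset.sum_congr rfl fun k _ => by rw [dd_smul, dd_cframe hy hf]

/-- Positivity makes `v ↦ g(v, ·)` injective, hence surjective onto the dual space by equality of
dimensions. -/
theorem exists_grad (f : M → ℝ) (q : M) :
    ∃ v : TangentSpace (𝓡∂ 3) q, ∀ w, g.inner q v w = dd f q w := by
  have : FiniteDimensional ℝ (TangentSpace (𝓡∂ 3) q) := inferInstanceAs (FiniteDimensional ℝ E3)
  let L : TangentSpace (𝓡∂ 3) q →ₗ[ℝ] Module.Dual ℝ (TangentSpace (𝓡∂ 3) q) :=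
    { toFun := fun v => (g.inner q v).toLinearMap
      map_add' := fun v w => by ext; simp
      map_smul' := fun c v => by ext; simp }
  have hL : Function.Injective L := by
    rw [← LinearMap.ker_eq_bot, LinearMap.ker_eq_bot']
    intro v hv
    by_contra hne
    have h1 := g.pos q v hne
    have h2 : L v v = 0 := by rw [hv]; rfl
    exact h1.ne' h2
  have hs : Function.Surjective L :=
    (LinearMap.injective_iff_surjective_of_finrank_eq_finrank
      (Subspace.dual_finrank_eq (K := ℝ) (V := TangentSpace (𝓡∂ 3) q)).symm).1 hL
  obtain ⟨v, hv⟩ := hs (mfderiv (𝓡∂ 3) 𝓘(ℝ, ℝ) f q).toLinearMap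
  exact ⟨v, fun w => LinearMap.congr_fun hv w⟩

/-- The gradient of a function. -/
def grad (f : M → ℝ) (q : M) : TangentSpace (𝓡∂ 3) q := (exists_grad g f q).choose

theorem inner_grad (f : M → ℝ) (q : M) (w : TangentSpace (𝓡∂ 3) q) :
    g.inner q (grad g f q) w = dd f q w := (exists_grad g f q).choose_spec w

theorem components_grad {f : M → ℝ} {p : M} {y : E3} (hy : y ∈ (extChartAt (𝓡∂ 3) p).target)
    (hf : MDifferentiableAt (𝓡∂ 3) 𝓘(ℝ, ℝ) f ((extChartAt (𝓡∂ 3) p).symm y)) (k : Fin 3) :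
    components (grad g f) p y k =
      ∑ l, (gram g p y)⁻¹ k l * pd l (fun z => f ((extChartAt (𝓡∂ 3) p).symm z)) y := by
  have h := met_gram g p
  have h1 : ∀ l, ∑ m, gram g p y l m * components (grad g f) p y m =
      pd l (fun z => f ((extChartAt (𝓡∂ 3) p).symm z)) y := by
    intro l
    rw [← dd_cframe hy hf, ← inner_grad g, sum_components (grad g f) p hy]
    simp only [map_sum, map_smul, sum_apply, smul_apply, smul_eq_mul]
    refine Finset.sum_congr rfl fun m _ => ?_
    rw [h.symm hy l m, gram_apply g p hy, mul_comm]
  simp only [← h1, Finset.mul_sum]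
  rw [Finset.sum_comm]
  simp only [← mul_assoc, ← Finset.sum_mul, h.sum_inv_mul hy]
  simp

theorem contMDiffOn_of_components {X : ∀ q : M, TangentSpace (𝓡∂ 3) q} {U : Set M} (hU : IsOpen U)
    (hX : ∀ p k, Sm (chartDom p U) (fun y => components X p y k)) :
    ContMDiffOn (𝓡∂ 3) (𝓡∂ 3).tangent ∞ (fun q => (⟨q, X q⟩ : TangentBundle (𝓡∂ 3) M)) U := by
  intro p hp
  refine ContMDiffAt.contMDiffWithinAt ?_
  have hnhds : U ∩ (extChartAt (𝓡∂ 3) p).source ∈ 𝓝 p :=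
    (hU.inter (isOpen_extChartAt_source p)).mem_nhds ⟨hp, mem_extChartAt_source p⟩
  refine (Bundle.contMDiffAt_section (F := E3) (E := fun q : M => TangentSpace (𝓡∂ 3) q) p).2 ?_
  have h1 : ∀ k, ContMDiffOn (𝓡∂ 3) 𝓘(ℝ, ℝ) ∞
      (fun q => (trivializationAt E3 (TangentSpace (𝓡∂ 3)) p ⟨q, X q⟩).2 k)
      (U ∩ (extChartAt (𝓡∂ 3) p).source) := fun k =>
    contMDiffOn_of_chart (hX p k) fun q hq => by
      rw [components_apply X p ((extChartAt (𝓡∂ 3) p).map_source hq.2),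
        (extChartAt (𝓡∂ 3) p).left_inv hq.2]
  have h2 : ContMDiffOn (𝓡∂ 3) 𝓘(ℝ, E3) ∞ (fun q => (WithLp.toLp 2 (fun k =>
      (trivializationAt E3 (TangentSpace (𝓡∂ 3)) p ⟨q, X q⟩).2 k) : E3))
      (U ∩ (extChartAt (𝓡∂ 3) p).source) := by
    have h3 : ContMDiffOn (𝓡∂ 3) 𝓘(ℝ, Fin 3 → ℝ) ∞ (fun q => fun k =>
      (trivializationAt E3 (TangentSpace (𝓡∂ 3)) p ⟨q, X q⟩).2 k)
      (U ∩ (extChartAt (𝓡∂ 3) p).source) := contMDiffOn_pi_space.2 h1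
    exact (PiLp.continuousLinearEquiv 2 ℝ (fun _ : Fin 3 => ℝ)).symm.contDiff.contMDiff.comp_contMDiffOn
      h3
  exact h2.contMDiffAt hnhds

theorem contMDiffOn_grad {f : M → ℝ} {U : Set M} (hU : IsOpen U)
    (hf : ContMDiffOn (𝓡∂ 3) 𝓘(ℝ, ℝ) ∞ f U) :
    ContMDiffOn (𝓡∂ 3) (𝓡∂ 3).tangent ∞
      (fun q => (⟨q, grad g f q⟩ : TangentBundle (𝓡∂ 3) M)) U := by
  refine contMDiffOn_of_components hU fun p k => ?_
  have hD := dom_chartDom p hU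
  refine (ContDiffOn.sum (s := Finset.univ) fun l _ => ((met_chartDom g p U).sm_inv k l).mul
    (hD.sm_pd (sm_chartDom hf) l)).congr fun y hy => components_grad g hy.1 ?_ k
  exact ((hf _ hy.2).contMDiffAt (hU.mem_nhds hy.2)).mdifferentiableAt (by simp)

theorem gsq_eq_dd {f : M → ℝ} {q : M} (hf : MDifferentiableAt (𝓡∂ 3) 𝓘(ℝ, ℝ) f q) :
    gsq g f q = dd f q (grad g f q) := by
  have hy := mem_extChartAt_target (I := 𝓡∂ 3) q
  have hq := extChartAt_to_inv (I := 𝓡∂ 3) q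
  have h := dd_apply hy (by rwa [hq]) (grad g f)
  have h' := components_grad g hy (by rwa [hq])
  rw [hq] at h
  rw [h, gsq, gradSq]
  simp only [h', Finset.sum_mul]
  refine Finset.sum_congr rfl fun i _ => Finset.sum_congr rfl fun j _ => ?_
  ring

theorem gsq_eq_inner {f : M → ℝ} {q : M} (hf : MDifferentiableAt (𝓡∂ 3) 𝓘(ℝ, ℝ) f q) :
    gsq g f q = g.inner q (grad g f q) (grad g f q) := by
  rw [gsq_eq_dd g hf, inner_grad]

theorem gsq_pos {f : M → ℝ} {q : M} (hf : MDifferentiableAt (𝓡∂ 3) 𝓘(ℝ, ℝ) f q)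
    {v : TangentSpace (𝓡∂ 3) q} (hv : dd f q v ≠ 0) : 0 < gsq g f q := by
  rw [gsq_eq_inner g hf]
  refine g.pos q _ fun h0 => hv ?_
  rw [← inner_grad g, h0]; simp

/-- Cauchy–Schwarz, from expanding the squared length of `∇f/|∇f| - v`. It is the pointwise
inequality that makes the unit normal a calibration. -/
theorem dd_le_sqrt_gsq {f : M → ℝ} {q : M} (hf : MDifferentiableAt (𝓡∂ 3) 𝓘(ℝ, ℝ) f q)
    (hpos : 0 < gsq g f q) {v : TangentSpace (𝓡∂ 3) q} (hv : g.inner q v v ≤ 1) :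
    dd f q v ≤ √(gsq g f q) := by
  set r := √(gsq g f q) with hr
  have hr0 : 0 < r := Real.sqrt_pos.2 hpos
  have hrr : r * r = gsq g f q := Real.mul_self_sqrt hpos.le
  have h0 : 0 ≤ g.inner q (r⁻¹ • grad g f q - v) (r⁻¹ • grad g f q - v) := by
    by_cases h : r⁻¹ • grad g f q - v = 0
    · rw [h]; simp
    · exact (g.pos q _ h).le
  have h1 : g.inner q (r⁻¹ • grad g f q - v) (r⁻¹ • grad g f q - v) =
      r⁻¹ * r⁻¹ * gsq g f q - 2 * r⁻¹ * dd f q v + g.inner q v v := by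
    simp only [map_sub, map_smul, sub_apply, smul_apply, smul_eq_mul, inner_grad,
      g.symm q v (grad g f q), gsq_eq_dd g hf]
    ring
  rw [h1, ← hrr] at h0
  have h2 : r⁻¹ * r⁻¹ * (r * r) = 1 := by field_simp
  rw [h2] at h0
  have h3 : r⁻¹ * dd f q v ≤ 1 := by linarith
  rwa [inv_mul_le_iff₀ hr0, mul_one] at h3

/-! ### Rules for the divergence -/

theorem components_sub (X Y : ∀ q : M, TangentSpace (𝓡∂ 3) q) (p : M) (y : E3) (k : Fin 3) :
    components (fun q => X q - Y q) p y k = components X p y k - components Y p y k := by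
  simp only [components, map_sub]; rfl

theorem components_smul (f : M → ℝ) (X : ∀ q : M, TangentSpace (𝓡∂ 3) q) (p : M) (y : E3)
    (k : Fin 3) : components (fun q => f q • X q) p y k =
      f ((extChartAt (𝓡∂ 3) p).symm y) * components X p y k := by
  simp only [components, map_smul]; rfl

theorem contMDiffOn_smul_field {f : M → ℝ} {X : ∀ q : M, TangentSpace (𝓡∂ 3) q} {U : Set M}
    (hU : IsOpen U) (hf : ContMDiffOn (𝓡∂ 3) 𝓘(ℝ, ℝ) ∞ f U)
    (hX : ContMDiffOn (𝓡∂ 3) (𝓡∂ 3).tangent ∞ (fun q => (⟨q, X q⟩ : TangentBundle (𝓡∂ 3) M)) U) :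
    ContMDiffOn (𝓡∂ 3) (𝓡∂ 3).tangent ∞
      (fun q => (⟨q, f q • X q⟩ : TangentBundle (𝓡∂ 3) M)) U :=
  contMDiffOn_of_components hU fun p k =>
    ((sm_chartDom hf).mul (sm_components hX p k)).congr fun y _ => components_smul f X p y k

theorem contMDiffOn_sub_field {X Y : ∀ q : M, TangentSpace (𝓡∂ 3) q} {U : Set M} (hU : IsOpen U)
    (hX : ContMDiffOn (𝓡∂ 3) (𝓡∂ 3).tangent ∞ (fun q => (⟨q, X q⟩ : TangentBundle (𝓡∂ 3) M)) U)
    (hY : ContMDiffOn (𝓡∂ 3) (𝓡∂ 3).tangent ∞ (fun q => (⟨q, Y q⟩ : TangentBundle (𝓡∂ 3) M)) U) :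
    ContMDiffOn (𝓡∂ 3) (𝓡∂ 3).tangent ∞
      (fun q => (⟨q, X q - Y q⟩ : TangentBundle (𝓡∂ 3) M)) U :=
  contMDiffOn_of_components hU fun p k =>
    ((sm_components hX p k).sub (sm_components hY p k)).congr fun y _ => components_sub X Y p y k

section
variable {X Y : ∀ q : M, TangentSpace (𝓡∂ 3) q} {U : Set M} (hU : IsOpen U)
  (hX : ContMDiffOn (𝓡∂ 3) (𝓡∂ 3).tangent ∞ (fun q => (⟨q, X q⟩ : TangentBundle (𝓡∂ 3) M)) U)
  (hY : ContMDiffOn (𝓡∂ 3) (𝓡∂ 3).tangent ∞ (fun q => (⟨q, Y q⟩ : TangentBundle (𝓡∂ 3) M)) U)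
  {f : M → ℝ} (hf : ContMDiffOn (𝓡∂ 3) 𝓘(ℝ, ℝ) ∞ f U) {q : M} (hq : q ∈ U)
include hU hq

include hX in
theorem div_eq_sum : div g X q = ∑ k, (pd k (fun z => components X q z k) (extChartAt (𝓡∂ 3) q q) +
    ∑ l, christoffel (gram g q) l k l (extChartAt (𝓡∂ 3) q q) *
      components X q (extChartAt (𝓡∂ 3) q q) k) :=
  divergence_eq (dom_chartDom q hU) (met_chartDom g q U) (sm_components hX q)
    (mem_chartDom (mem_extChartAt_source q) hq)

include hX hY in
theorem div_sub : div g (fun q => X q - Y q) q = div g X q - div g Y q := by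
  have hm := mem_chartDom (mem_extChartAt_source (I := 𝓡∂ 3) q) hq
  have hD := dom_chartDom q hU
  rw [div_eq_sum g hU (contMDiffOn_sub_field hU hX hY) hq, div_eq_sum g hU hX hq,
    div_eq_sum g hU hY hq, ← Finset.sum_sub_distrib]
  refine Finset.sum_congr rfl fun k _ => ?_
  rw [hD.pd_congr (fun y _ => components_sub X Y q y k) k hm,
    hD.pd_sub (sm_components hX q k) (sm_components hY q k) k hm, components_sub]
  simp only [mul_sub, Finset.sum_sub_distrib]
  ring

include hf hX in
theorem div_smul : div g (fun q => f q • X q) q = f q * div g X q + dd f q (X q) := by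
  have hm := mem_chartDom (mem_extChartAt_source (I := 𝓡∂ 3) q) hq
  have hD := dom_chartDom q hU
  have hdf : MDifferentiableAt (𝓡∂ 3) 𝓘(ℝ, ℝ) f q :=
    ((hf _ hq).contMDiffAt (hU.mem_nhds hq)).mdifferentiableAt (by simp)
  have hqi := extChartAt_to_inv (I := 𝓡∂ 3) q
  have hd := dd_apply (mem_extChartAt_target (I := 𝓡∂ 3) q) (by rwa [hqi]) X
  rw [hqi] at hd
  rw [div_eq_sum g hU (contMDiffOn_smul_field hU hf hX) hq, div_eq_sum g hU hX hq, hd,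
    Finset.mul_sum, ← Finset.sum_add_distrib]
  refine Finset.sum_congr rfl fun k _ => ?_
  rw [hD.pd_congr (fun y _ => components_smul f X q y k) k hm,
    hD.pd_mul (sm_chartDom hf) (sm_components hX q k) k hm, components_smul, hqi]
  simp only [mul_add, Finset.mul_sum]
  rw [Finset.sum_congr rfl fun l _ => show christoffel (gram g q) l k l (extChartAt (𝓡∂ 3) q q) *
    (f q * components X q (extChartAt (𝓡∂ 3) q q) k) = f q * (christoffel (gram g q) l k l
    (extChartAt (𝓡∂ 3) q q) * components X q (extChartAt (𝓡∂ 3) q q) k) by ring]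
  ring

end

theorem dd_comp {f : M → ℝ} {q : M} (hf : MDifferentiableAt (𝓡∂ 3) 𝓘(ℝ, ℝ) f q) {φ : ℝ → ℝ} {φ' : ℝ}
    (hφ : HasDerivAt φ φ' (f q)) (v : TangentSpace (𝓡∂ 3) q) :
    dd (fun x => φ (f x)) q v = φ' * dd f q v := by
  have h1 := (hasMFDerivAt_iff_hasFDerivAt.2 hφ.hasFDerivAt).comp q hf.hasMFDerivAt
  have e : (fun x => φ (f x)) = φ ∘ f := rfl
  have h2 : dd (φ ∘ f) q v = dd f q v * φ' := congrArg (fun L : E3 →L[ℝ] ℝ => L v) h1.mfderiv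
  rw [e, h2, mul_comm]

theorem contMDiffOn_comp_real {f : M → ℝ} {U : Set M} (hf : ContMDiffOn (𝓡∂ 3) 𝓘(ℝ, ℝ) ∞ f U)
    {φ : ℝ → ℝ} {V : Set ℝ} (hφ : ContDiffOn ℝ ∞ φ V) (hm : MapsTo f U V) :
    ContMDiffOn (𝓡∂ 3) 𝓘(ℝ, ℝ) ∞ (fun x => φ (f x)) U :=
  hφ.contMDiffOn.comp hf hm

end

/-! ### Construction of metrics -/

/-- On the compact unit sphere `β v v` has a positive minimum `m`, so `β v v < 1` forces `‖v‖² ≤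
1/m`. This condition is a field of the structure of Riemannian metrics. -/
theorem isVonNBounded_of_pos (β : E3 →L[ℝ] E3 →L[ℝ] ℝ) (h : ∀ v, v ≠ 0 → 0 < β v v) :
    Bornology.IsVonNBounded ℝ {v : E3 | β v v < 1} := by
  rw [NormedSpace.isVonNBounded_iff]
  have hc : Continuous fun v : E3 => β v v := by fun_prop
  obtain ⟨v₀, hv₀, hmin⟩ := (isCompact_sphere (0 : E3) 1).exists_isMinOn
    (NormedSpace.sphere_nonempty.2 zero_le_one) hc.continuousOn
  have hm : 0 < β v₀ v₀ := h v₀ (fun h0 => by simp [h0] at hv₀)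
  refine (Metric.isBounded_closedBall (x := (0 : E3)) (r := √(β v₀ v₀)⁻¹)).subset fun v hv => ?_
  rw [mem_closedBall_zero_iff]
  by_cases hv0 : v = 0
  · rw [hv0, norm_zero]; exact Real.sqrt_nonneg _
  have hn : 0 < ‖v‖ := norm_pos_iff.2 hv0
  have h1 : β v₀ v₀ ≤ β (‖v‖⁻¹ • v) (‖v‖⁻¹ • v) :=
    hmin (by simp [norm_smul, hn.ne'])
  have h2 : β (‖v‖⁻¹ • v) (‖v‖⁻¹ • v) = (‖v‖⁻¹) ^ 2 * β v v := by
    simp; ring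
  have h3 : β v v < 1 := hv
  refine Real.le_sqrt_of_sq_le ?_
  rw [h2, inv_pow, ← div_eq_inv_mul, le_div_iff₀ (by positivity)] at h1
  rw [le_inv_comm₀ (by positivity) hm, le_inv_comm₀ hm (by positivity)]
  rw [← one_div, le_div_iff₀ hm, mul_comm]
  exact h1.trans h3.le

section

variable {M : Type u} [TopologicalSpace M] [ChartedSpace (EuclideanHalfSpace 3) M]
  [IsManifold (𝓡∂ 3) ∞ M]

/-- In the trivialisation at `p` the form is the sum of its frame entries times the constant forms
`dxⁱ ⊗ dxʲ`, so smooth entries suffice. -/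
theorem contMDiff_of_cframe
    (B : ∀ q : M, TangentSpace (𝓡∂ 3) q →L[ℝ] TangentSpace (𝓡∂ 3) q →L[ℝ] ℝ)
    (h : ∀ p i j, ContMDiffOn (𝓡∂ 3) 𝓘(ℝ, ℝ) ∞ (fun q => B q (cframe p i q) (cframe p j q))
      (chartAt (EuclideanHalfSpace 3) p).source) :
    ContMDiff (𝓡∂ 3) ((𝓡∂ 3).prod 𝓘(ℝ, E3 →L[ℝ] E3 →L[ℝ] ℝ)) ∞
      (fun q => TotalSpace.mk' (E3 →L[ℝ] E3 →L[ℝ] ℝ)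
        (E := fun q : M => TangentSpace (𝓡∂ 3) q →L[ℝ] TangentSpace (𝓡∂ 3) q →L[ℝ] ℝ) q (B q)) := by
  intro p
  rw [contMDiffAt_hom_bundle]
  refine ⟨contMDiffAt_id, ?_⟩
  let D : Fin 3 → Fin 3 → (E3 →L[ℝ] E3 →L[ℝ] ℝ) := fun i j =>
    (EuclideanSpace.proj i : E3 →L[ℝ] ℝ).smulRight (EuclideanSpace.proj j : E3 →L[ℝ] ℝ)
  have hp : (chartAt (EuclideanHalfSpace 3) p).source ∈ 𝓝 p :=
    (chartAt (EuclideanHalfSpace 3) p).open_source.mem_nhds (mem_chart_source _ p)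
  have h1 : ContMDiffAt (𝓡∂ 3) 𝓘(ℝ, E3 →L[ℝ] E3 →L[ℝ] ℝ) ∞
      (fun q => ∑ i, ∑ j, B q (cframe p i q) (cframe p j q) • D i j) p := by
    refine ContMDiffAt.sum fun i _ => ContMDiffAt.sum fun j _ => ?_
    exact ((h p i j).contMDiffAt hp).smul contMDiffAt_const
  refine h1.congr_of_eventuallyEq ?_
  filter_upwards [hp] with q hq
  have hq' : q ∈ (trivializationAt E3 (TangentSpace (𝓡∂ 3) : M → Type) p).baseSet := hq
  refine ContinuousLinearMap.ext fun v => ContinuousLinearMap.ext fun w => ?_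
  have key := inCoordinates_apply_eq₂ (𝕜 := ℝ) (F₁ := E3)
    (E₁ := (TangentSpace (𝓡∂ 3) : M → Type)) (F₂ := E3) (E₂ := (TangentSpace (𝓡∂ 3) : M → Type))
    (F₃ := ℝ) (E₃ := fun _ : M => ℝ) (x₀ := p) (x := q) (ϕ := B q) (v := v) (w := w) hq' hq'
    (mem_univ _)
  refine key.trans ?_
  have hs : ∀ u : E3, (trivializationAt E3 (TangentSpace (𝓡∂ 3) : M → Type) p).symm q u =
      ∑ i, u i • cframe p i q := fun u => by
    rw [sum_cframe]; exact ((trivializationAt E3 (TangentSpace (𝓡∂ 3) : M → Type) p).symmL_apply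
      hq' u).symm
  rw [hs, hs]
  simp [D]
  rw [Finset.sum_comm]
  refine Finset.sum_congr rfl fun j _ => ?_
  rw [Finset.mul_sum]
  exact Finset.sum_congr rfl fun i _ => by ring

/-- The metric with a given inner product whose entries in the coordinate frames are smooth. -/
def mkMetric (B : ∀ q : M, TangentSpace (𝓡∂ 3) q →L[ℝ] TangentSpace (𝓡∂ 3) q →L[ℝ] ℝ)
    (symm : ∀ q v w, B q v w = B q w v) (pos : ∀ q v, v ≠ 0 → 0 < B q v v)
    (h : ∀ p i j, ContMDiffOn (𝓡∂ 3) 𝓘(ℝ, ℝ) ∞ (fun q => B q (cframe p i q) (cframe p j q))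
      (chartAt (EuclideanHalfSpace 3) p).source) : RMetric M where
  inner := B
  symm := symm
  pos := pos
  isVonNBounded q := isVonNBounded_of_pos (B q) (pos q)
  contMDiff := contMDiff_of_cframe B h

variable {N : Type v} [TopologicalSpace N] [ChartedSpace (EuclideanHalfSpace 3) N]
  [IsManifold (𝓡∂ 3) ∞ N]

/-- The pull-back of a bilinear form. -/
def pullForm (β : E3 →L[ℝ] E3 →L[ℝ] ℝ) (L : E3 →L[ℝ] E3) : E3 →L[ℝ] E3 →L[ℝ] ℝ :=
  β.bilinearComp L L

/-- The pull-back of a metric by an immersion. -/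
def pullMetric (h : RMetric N) {ι : M → N} (hι : ContMDiff (𝓡∂ 3) (𝓡∂ 3) ∞ ι)
    (hinj : ∀ q, Function.Injective (mfderiv (𝓡∂ 3) (𝓡∂ 3) ι q)) : RMetric M :=
  mkMetric (fun q => pullForm (h.inner (ι q)) (mfderiv (𝓡∂ 3) (𝓡∂ 3) ι q))
    (fun q v w => h.symm _ _ _)
    (fun q v hv => by
      refine h.pos (ι q) (mfderiv (𝓡∂ 3) (𝓡∂ 3) ι q v) fun h0 => hv (hinj q ?_)
      rw [h0]; exact (map_zero (mfderiv (𝓡∂ 3) (𝓡∂ 3) ι q)).symm)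
    (fun p i j q hq => by
      have hf : ∀ i, ContMDiffWithinAt (𝓡∂ 3) (𝓡∂ 3).tangent ∞
          (fun m => (⟨ι m, mfderiv (𝓡∂ 3) (𝓡∂ 3) ι m (cframe p i m)⟩ : TangentBundle (𝓡∂ 3) N))
          (chartAt (EuclideanHalfSpace 3) p).source q := fun i =>
        ((hι.contMDiff_tangentMap (m := ∞) (by simp)).comp_contMDiffOn
          (contMDiffOn_cframe p i)) q hq
      have : ContMDiffWithinAt (𝓡∂ 3) ((𝓡∂ 3).prod 𝓘(ℝ)) ∞
          (fun m ↦ TotalSpace.mk' ℝ (E := Bundle.Trivial N ℝ) (ι m)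
            (h.inner (ι m) (mfderiv (𝓡∂ 3) (𝓡∂ 3) ι m (cframe p i m))
              (mfderiv (𝓡∂ 3) (𝓡∂ 3) ι m (cframe p j m))))
          (chartAt (EuclideanHalfSpace 3) p).source q := by
        apply ContMDiffWithinAt.clm_bundle_apply₂ (F₁ := E3) (F₂ := E3)
        · exact ((h.contMDiff.comp hι) q).contMDiffWithinAt
        · exact hf i
        · exact hf j
      simp only [contMDiffWithinAt_totalSpace] at this
      exact this.2)

theorem isoMap_pullMetric (h : RMetric N) {ι : M → N} (hι : ContMDiff (𝓡∂ 3) (𝓡∂ 3) ∞ ι)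
    (hinj : ∀ q, Function.Injective (mfderiv (𝓡∂ 3) (𝓡∂ 3) ι q)) :
    IsoMap (pullMetric h hι hinj) h ι := ⟨hι, fun _ _ _ => rfl⟩

theorem sm_target_of_contMDiff {w : M → ℝ} (hw : ContMDiff (𝓡∂ 3) 𝓘(ℝ, ℝ) ∞ w) (p : M) :
    Sm (extChartAt (𝓡∂ 3) p).target (fun y => w ((extChartAt (𝓡∂ 3) p).symm y)) :=
  (sm_comp_symm (U := univ) hw.contMDiffOn).mono fun _ hy => ⟨hy, mem_univ _⟩

theorem extChartAt_zero_pos {q : M} (hq : (𝓡∂ 3).IsInteriorPoint q) :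
    0 < extChartAt (𝓡∂ 3) q q 0 := by
  have h : extChartAt (𝓡∂ 3) q q ∈ interior (range (𝓡∂ 3)) := hq
  rwa [interior_range_modelWithCornersEuclideanHalfSpace] at h

/-- The conformal metric `e^{2w} g`. -/
def conformal (g : RMetric M) {w : M → ℝ} (hw : ContMDiff (𝓡∂ 3) 𝓘(ℝ, ℝ) ∞ w) : RMetric M :=
  mkMetric (fun q => Real.exp (2 * w q) • g.inner q)
    (fun q v v' => congrArg (fun t => Real.exp (2 * w q) * t) (g.symm q v v'))
    (fun q v hv => mul_pos (Real.exp_pos _) (g.pos q v hv))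
    (fun p i j => by
      refine ContMDiffOn.mul ?_ (contMDiffOn_inner_cframe g p i j)
      exact (Real.contDiff_exp.comp (contDiff_const.mul contDiff_id)).contMDiff.comp_contMDiffOn
        hw.contMDiffOn)

variable (g : RMetric M) {w : M → ℝ} (hw : ContMDiff (𝓡∂ 3) 𝓘(ℝ, ℝ) ∞ w)

theorem conformal_inner (q : M) (v v' : TangentSpace (𝓡∂ 3) q) :
    (conformal g hw).inner q v v' = Real.exp (2 * w q) * g.inner q v v' := rfl

theorem gram_conformal (p : M) (y : E3) : gram (conformal g hw) p y =
    conf (fun y => w ((extChartAt (𝓡∂ 3) p).symm y)) (gram g p) y := rfl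

theorem gsq_conformal (f : M → ℝ) (q : M) :
    gsq (conformal g hw) f q = Real.exp (-(2 * w q)) * gsq g f q := by
  have hm := mem_extChartAt_target (I := 𝓡∂ 3) q
  unfold gsq gradSq
  simp only [Finset.mul_sum]
  refine Finset.sum_congr rfl fun i _ => Finset.sum_congr rfl fun j _ => ?_
  rw [show gram (conformal g hw) q = conf _ (gram g q) from funext (gram_conformal g hw q),
    conf_inv (met_gram g q) hm, extChartAt_to_inv]
  ring

theorem eq_of_inner {q : M} {v v' : TangentSpace (𝓡∂ 3) q}
    (h : ∀ u, g.inner q v u = g.inner q v' u) : v = v' := by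
  by_contra hne
  have h1 := g.pos q (v - v') (sub_ne_zero.2 hne)
  have h2 : g.inner q (v - v') (v - v') = g.inner q v (v - v') - g.inner q v' (v - v') :=
    congrArg (fun L : TangentSpace (𝓡∂ 3) q →L[ℝ] ℝ => L (v - v')) (map_sub (g.inner q) v v')
  rw [h2, h, sub_self] at h1
  exact lt_irrefl _ h1

theorem inner_smul_left (q : M) (c : ℝ) (v v' : TangentSpace (𝓡∂ 3) q) :
    g.inner q (c • v) v' = c * g.inner q v v' :=
  congrArg (fun L : TangentSpace (𝓡∂ 3) q →L[ℝ] ℝ => L v') (map_smul (g.inner q) c v)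

theorem inner_smul_right (q : M) (c : ℝ) (v v' : TangentSpace (𝓡∂ 3) q) :
    g.inner q v (c • v') = c * g.inner q v v' := map_smul (g.inner q v) c v'

theorem grad_conformal (f : M → ℝ) (q : M) :
    grad (conformal g hw) f q = Real.exp (-(2 * w q)) • grad g f q := by
  refine eq_of_inner (conformal g hw) fun v => ?_
  rw [inner_grad, conformal_inner, inner_smul_left, inner_grad, ← mul_assoc, ← Real.exp_add]
  simp

theorem scalarCurvature_conformal (q : M) (hq : (𝓡∂ 3).IsInteriorPoint q) :
    scalarCurvature (conformal g hw) q =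
      Real.exp (-(2 * w q)) * (scalarCurvature g q - 4 * lap g w q - 2 * gsq g w q) := by
  have hm := mem_extChartAt_target (I := 𝓡∂ 3) q
  have h0 := extChartAt_zero_pos hq
  unfold scalarCurvature
  rw [show gram (conformal g hw) q = conf _ (gram g q) from funext (gram_conformal g hw q),
    scalar_conf (dom_target q) (met_gram g q) (sm_target_of_contMDiff hw q) hm h0, extChartAt_to_inv]
  rfl

/-- The volume density is multiplied by `e^{3w}`. In terms of `christoffel_conf`, the trace of the
correction is `3 dw`, because its last two terms cancel. -/
theorem div_conformal {X : ∀ q : M, TangentSpace (𝓡∂ 3) q} {U : Set M} (hU : IsOpen U)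
    (hX : ContMDiffOn (𝓡∂ 3) (𝓡∂ 3).tangent ∞ (fun q => (⟨q, X q⟩ : TangentBundle (𝓡∂ 3) M)) U)
    {q : M} (hq : q ∈ U) : div (conformal g hw) X q = div g X q + 3 * dd w q (X q) := by
  have hm : extChartAt (𝓡∂ 3) q q ∈ chartDom q U := mem_chartDom (mem_extChartAt_source q) hq
  have hD := dom_chartDom q hU
  have hd := dd_apply (mem_extChartAt_target (I := 𝓡∂ 3) q)
    ((hw _).mdifferentiableAt (by simp)) X
  rw [extChartAt_to_inv] at hd
  rw [div_eq_sum _ hU hX hq, div_eq_sum _ hU hX hq, hd, Finset.mul_sum, ← Finset.sum_add_distrib]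
  refine Finset.sum_congr rfl fun k _ => ?_
  rw [add_assoc]
  congr 1
  rw [← Finset.sum_mul, ← Finset.sum_mul, mul_comm (components _ _ _ _), ← mul_assoc, ← add_mul]
  congr 1
  rw [show gram (conformal g hw) q = conf _ (gram g q) from funext (gram_conformal g hw q),
    Finset.sum_congr rfl fun l _ => christoffel_conf (dom_target q) (met_gram g q)
      (sm_target_of_contMDiff hw q) (mem_extChartAt_target (I := 𝓡∂ 3) q) l k l, Finset.sum_add_distrib]
  congr 1
  simp only [Finset.sum_sub_distrib, Finset.sum_add_distrib, Finset.mul_sum, ← mul_assoc]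
  rw [Finset.sum_comm]
  simp only [← Finset.sum_mul, (met_gram g q).sum_mul_inv (mem_extChartAt_target (I := 𝓡∂ 3) q)]
  simp

end

open MeasureTheory

/-! ### The Riemannian volume -/

theorem measurableSet_HS : MeasurableSet HS := by
  have : HS = {y : E3 | 0 ≤ y 0} := by ext y; exact mem_HS
  rw [this]
  exact (isClosed_le continuous_const (by fun_prop)).measurableSet

theorem Dom.measurableSet {D : Set E3} (hD : Dom D) : MeasurableSet D := by
  obtain ⟨O, hO, rfl⟩ := hD
  exact measurableSet_HS.inter hO.measurableSet

theorem measurableSet_inter_preimage {M : Type*} [TopologicalSpace M] [MeasurableSpace M]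
    [BorelSpace M] {D : Set E3} (hD : MeasurableSet D) {φ : E3 → M} (hφ : ContinuousOn φ D)
    {E : Set M} (hE : MeasurableSet E) : MeasurableSet (D ∩ φ ⁻¹' E) := by
  have h := (continuousOn_iff_continuous_domRestrict.1 hφ).measurable hE
  have h2 := hD.subtype_image h
  convert h2 using 1
  ext y
  simp [Set.domRestrict_apply, and_comm]

theorem det_eq_jac_det {τ : E3 → E3} {y : E3} (L : E3 →L[ℝ] E3) (hL : HasFDerivWithinAt τ L HS y)
    (hy : y ∈ HS) : L.det = (jac τ y).det := by
  have h : LinearMap.toMatrix (EuclideanSpace.basisFun (Fin 3) ℝ).toBasis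
      (EuclideanSpace.basisFun (Fin 3) ℝ).toBasis (L : E3 →ₗ[ℝ] E3) = jac τ y := by
    ext a i
    have h6 := (EuclideanSpace.proj (𝕜 := ℝ) a).hasFDerivAt.comp_hasFDerivWithinAt y hL
    have h7 := h6.fderivWithin (uniqueDiffOn_HS y hy)
    rw [jac_apply, pd]
    have e : (fun z => τ z a) = (EuclideanSpace.proj (𝕜 := ℝ) a) ∘ τ := rfl
    rw [e, h7, LinearMap.toMatrix_apply]
    simp
  rw [← h, LinearMap.det_toMatrix]

section

variable {M : Type u} [TopologicalSpace M] [ChartedSpace (EuclideanHalfSpace 3) M]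
  [IsManifold (𝓡∂ 3) ∞ M] [MeasurableSpace M] [BorelSpace M] (g : RMetric M)

theorem chartVolume_apply (p : M) {E : Set M} (hE : MeasurableSet E) : chartVolume g p E =
    ∫⁻ y in (extChartAt (𝓡∂ 3) p).target ∩ (extChartAt (𝓡∂ 3) p).symm ⁻¹' E,
      ENNReal.ofReal √(gram g p y).det := by
  have ht := (dom_target p).measurableSet
  have hc := continuousOn_extChartAt_symm (I := 𝓡∂ 3) p
  have hm : AEMeasurable (extChartAt (𝓡∂ 3) p).symm
      ((volume.restrict (extChartAt (𝓡∂ 3) p).target).withDensity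
        (fun y => ENNReal.ofReal √(gram g p y).det)) :=
    (hc.aemeasurable ht).mono_ac (withDensity_absolutelyContinuous _ _)
  rw [chartVolume, Measure.map_apply_of_aemeasurable hm hE, withDensity_apply',
    Measure.restrict_restrict' ht, inter_comm]

theorem coordMap_id_image {p p' : M} {E : Set M} (hE : E ⊆ (extChartAt (𝓡∂ 3) p).source)
    (hE' : E ⊆ (extChartAt (𝓡∂ 3) p').source) :
    coordMap (fun q : M => q) p p' ''
      ((extChartAt (𝓡∂ 3) p).target ∩ (extChartAt (𝓡∂ 3) p).symm ⁻¹' E) =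
    (extChartAt (𝓡∂ 3) p').target ∩ (extChartAt (𝓡∂ 3) p').symm ⁻¹' E := by
  ext z
  constructor
  · rintro ⟨y, ⟨hy, hyE⟩, rfl⟩
    refine ⟨(extChartAt (𝓡∂ 3) p').map_source (hE' hyE), ?_⟩
    change (extChartAt (𝓡∂ 3) p').symm (extChartAt (𝓡∂ 3) p' _) ∈ E
    rw [(extChartAt (𝓡∂ 3) p').left_inv (hE' hyE)]
    exact hyE
  · rintro ⟨hz, hzE⟩
    refine ⟨extChartAt (𝓡∂ 3) p ((extChartAt (𝓡∂ 3) p').symm z),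
      ⟨(extChartAt (𝓡∂ 3) p).map_source (hE hzE), ?_⟩, ?_⟩
    · change (extChartAt (𝓡∂ 3) p).symm (extChartAt (𝓡∂ 3) p _) ∈ E
      rw [(extChartAt (𝓡∂ 3) p).left_inv (hE hzE)]
      exact hzE
    · rw [coordMap_apply (ι := fun q : M => q) (hE hzE), (extChartAt (𝓡∂ 3) p').right_inv hz]

/-- Change of variables: `√det(Jᵀ G J) = |det J| √det G`. -/
theorem chartVolume_eq {p p' : M} {E : Set M} (hE : MeasurableSet E)
    (h : E ⊆ (extChartAt (𝓡∂ 3) p).source) (h' : E ⊆ (extChartAt (𝓡∂ 3) p').source) :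
    chartVolume g p E = chartVolume g p' E := by
  rw [chartVolume_apply g p hE, chartVolume_apply g p' hE]
  have T := (IsoMap.id g).trans p p'
  obtain ⟨S, hS⟩ : ∃ S, S = (extChartAt (𝓡∂ 3) p).target ∩ (extChartAt (𝓡∂ 3) p).symm ⁻¹' E :=
    ⟨_, rfl⟩
  have hSm : MeasurableSet S := by
    rw [hS]
    exact measurableSet_inter_preimage (dom_target p).measurableSet
      (continuousOn_extChartAt_symm p) hE
  have hSD : S ⊆ coordDom (fun q : M => q) p p' := by
    rw [hS]; exact fun y hy => ⟨hy.1, h' hy.2⟩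
  have hd : ∀ y ∈ S, HasFDerivWithinAt (coordMap (fun q : M => q) p p')
      (fderivWithin ℝ (coordMap (fun q : M => q) p p') HS y) HS y := fun y hy => by
    have h1 := (T.sm.differentiableOn (by simp)) y (hSD hy)
    exact (h1.mono_of_mem_nhdsWithin (T.dom.mem_nhdsWithin (hSD hy))).hasFDerivWithinAt
  have hinj : InjOn (coordMap (fun q : M => q) p p') S := fun y hy z hz hyz => by
    have h1 := symm_coordMap (hSD hy)
    rw [hyz, symm_coordMap (hSD hz)] at h1
    rw [← (extChartAt (𝓡∂ 3) p).right_inv (hSD hy).1, ← h1,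
      (extChartAt (𝓡∂ 3) p).right_inv (hSD hz).1]
  rw [← coordMap_id_image h h', ← hS, lintegral_image_eq_lintegral_abs_det_fderiv_mul volume hSm
    (fun y hy => (hd y hy).mono ((hSD.trans T.dom.sub))) hinj]
  refine setLIntegral_congr_fun hSm fun y hy => ?_
  have hH := T.dom.sub (hSD hy)
  change ENNReal.ofReal √(gram g p y).det = _
  rw [det_eq_jac_det _ (hd y hy) hH, ← ENNReal.ofReal_mul (abs_nonneg _), T.pull y (hSD hy),
    Matrix.det_mul, Matrix.det_mul, Matrix.det_transpose]
  congr 1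
  rw [mul_comm _ (jac _ y).det, ← mul_assoc, Real.sqrt_mul (mul_self_nonneg _),
    Real.sqrt_mul_self_eq_abs]

theorem chartVolume_restrict_eq {p p' : M} {E : Set M} (hE : MeasurableSet E)
    (h : E ⊆ (extChartAt (𝓡∂ 3) p).source) (h' : E ⊆ (extChartAt (𝓡∂ 3) p').source) :
    (chartVolume g p).restrict E = (chartVolume g p').restrict E := by
  ext F hF
  rw [Measure.restrict_apply hF, Measure.restrict_apply hF]
  exact chartVolume_eq g (hF.inter hE) (inter_subset_right.trans h) (inter_subset_right.trans h')

theorem measurableSet_source (p : M) : MeasurableSet (extChartAt (𝓡∂ 3) p).source :=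
  (isOpen_extChartAt_source p).measurableSet

theorem chartVolume_restrict_source (p : M) :
    (chartVolume g p).restrict (extChartAt (𝓡∂ 3) p).source = chartVolume g p := by
  ext E hE
  rw [Measure.restrict_apply hE, chartVolume_apply g p hE,
    chartVolume_apply g p (hE.inter (measurableSet_source p))]
  congr 2
  ext y
  exact ⟨fun h => ⟨h.1, h.2.1⟩, fun h => ⟨h.1, h.2, (extChartAt (𝓡∂ 3) p).map_target h.1⟩⟩

variable [SecondCountableTopology M]

/-- Countably many charts split `M` into disjoint Borel pieces, each inside one chart domain. On
each piece every chart volume is at most the one of that chart, so the supremum is bounded by the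
sum of the pieces. Restricted to the chart at `p`, this sum is `chartVolume g p`. -/
theorem riemVolume_restrict_source (p : M) :
    (riemVolume g).restrict (extChartAt (𝓡∂ 3) p).source = chartVolume g p := by
  obtain ⟨s, hs, hsU⟩ := TopologicalSpace.countable_cover_nhds
    (fun q : M => extChartAt_source_mem_nhds (I := 𝓡∂ 3) q)
  have hne : s.Nonempty := by
    by_contra h
    rw [not_nonempty_iff_eq_empty] at h
    have : p ∈ ⋃ x ∈ s, (extChartAt (𝓡∂ 3) x).source := hsU ▸ mem_univ p
    simp [h] at this
  obtain ⟨c, hc⟩ := hs.exists_eq_range hne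
  let D : ℕ → Set M := disjointed fun n => (extChartAt (𝓡∂ 3) (c n)).source
  have hDm : ∀ n, MeasurableSet (D n) := fun n =>
    MeasurableSet.disjointed (fun n => measurableSet_source (c n)) n
  have hDs : ∀ n, D n ⊆ (extChartAt (𝓡∂ 3) (c n)).source := fun n => disjointed_subset _ n
  have hDd : Pairwise (Function.onFun Disjoint D) := disjoint_disjointed _
  have hDu : ⋃ n, D n = univ := by
    rw [iUnion_disjointed, ← hsU, hc, biUnion_range]
  have hsum : ∀ ν : Measure M, ν = Measure.sum fun n => ν.restrict (D n) := fun ν => by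
    rw [← Measure.restrict_iUnion hDd hDm, hDu, Measure.restrict_univ]
  have key : ∀ q n, (chartVolume g q).restrict (D n) ≤ (chartVolume g (c n)).restrict (D n) := by
    intro q n
    conv_lhs => rw [← chartVolume_restrict_source g q, Measure.restrict_restrict (hDm n)]
    rw [chartVolume_restrict_eq g ((hDm n).inter (measurableSet_source q)) inter_subset_right
      (inter_subset_left.trans (hDs n))]
    exact Measure.restrict_mono_set _ inter_subset_left
  have hle : riemVolume g ≤ Measure.sum fun n => (chartVolume g (c n)).restrict (D n) := by
    refine iSup_le fun q => ?_
    rw [hsum (chartVolume g q)]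
    refine Measure.le_iff.2 fun E hE => ?_
    rw [Measure.sum_apply _ hE, Measure.sum_apply _ hE]
    exact ENNReal.tsum_le_tsum fun n => key q n E
  have hge : ∀ q, chartVolume g q ≤ riemVolume g := fun q => le_iSup (chartVolume g) q
  refine le_antisymm ?_ ?_
  · calc (riemVolume g).restrict (extChartAt (𝓡∂ 3) p).source
        ≤ (Measure.sum fun n => (chartVolume g (c n)).restrict (D n)).restrict
            (extChartAt (𝓡∂ 3) p).source := Measure.restrict_mono subset_rfl hle
      _ = Measure.sum fun n => ((chartVolume g (c n)).restrict (D n)).restrict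
            (extChartAt (𝓡∂ 3) p).source := Measure.restrict_sum _ (measurableSet_source p)
      _ = Measure.sum fun n => (chartVolume g p).restrict (D n) := by
          congr 1
          funext n
          rw [Measure.restrict_restrict (measurableSet_source p), chartVolume_restrict_eq g
            ((measurableSet_source p).inter (hDm n)) (inter_subset_right.trans (hDs n))
            inter_subset_left, inter_comm, ← Measure.restrict_restrict (hDm n),
            chartVolume_restrict_source]
      _ = chartVolume g p := (hsum _).symm
  · conv_lhs => rw [← chartVolume_restrict_source g p]
    exact Measure.restrict_mono subset_rfl (hge p)

theorem setIntegral_riemVolume (p : M) {u : M → ℝ} (hu : Continuous u) :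
    ∫ q in (extChartAt (𝓡∂ 3) p).source, u q ∂(riemVolume g) =
      ∫ y in (extChartAt (𝓡∂ 3) p).target, √(gram g p y).det * u ((extChartAt (𝓡∂ 3) p).symm y) := by
  have ht := (dom_target p).measurableSet
  have hd : AEMeasurable (fun y => ENNReal.ofReal √(gram g p y).det)
      (volume.restrict (extChartAt (𝓡∂ 3) p).target) :=
    (((met_gram g p).sm_sqrt_det).continuousOn.aemeasurable ht).ennreal_ofReal
  rw [riemVolume_restrict_source, chartVolume, integral_map
    (((continuousOn_extChartAt_symm p).aemeasurable ht).mono_ac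
      (withDensity_absolutelyContinuous _ _)) hu.aestronglyMeasurable,
    integral_withDensity_eq_integral_toReal_smul₀ hd (ae_of_all _ fun _ => ENNReal.ofReal_lt_top)]
  simp [ENNReal.toReal_ofReal (Real.sqrt_nonneg _)]

instance : IsLocallyFiniteMeasure (riemVolume g) := by
  refine ⟨fun p => ?_⟩
  have hmem := mem_extChartAt_target (I := 𝓡∂ 3) p
  have hc := ((met_gram g p).sm_sqrt_det).continuousOn _ hmem
  have hc' : ContinuousWithinAt (fun y => √(gram g p y).det) HS (extChartAt (𝓡∂ 3) p p) :=
    hc.mono_of_mem_nhdsWithin ((dom_target p).mem_nhdsWithin hmem)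
  have h1 := hc'.eventually (Iio_mem_nhds (lt_add_one _))
  obtain ⟨r, hr, hr'⟩ := Metric.mem_nhdsWithin_iff.1 h1
  refine ⟨(extChartAt (𝓡∂ 3) p).source ∩ extChartAt (𝓡∂ 3) p ⁻¹' Metric.ball
    (extChartAt (𝓡∂ 3) p p) r, ?_, ?_⟩
  · exact Filter.inter_mem (extChartAt_source_mem_nhds p)
      ((continuousAt_extChartAt p).preimage_mem_nhds (Metric.ball_mem_nhds _ hr))
  have hm : MeasurableSet ((extChartAt (𝓡∂ 3) p).source ∩ extChartAt (𝓡∂ 3) p ⁻¹' Metric.ball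
      (extChartAt (𝓡∂ 3) p p) r) :=
    ((continuousOn_extChartAt p).isOpen_inter_preimage (isOpen_extChartAt_source p)
      Metric.isOpen_ball).measurableSet
  rw [← inter_eq_self_of_subset_left (inter_subset_left (s := (extChartAt (𝓡∂ 3) p).source)
    (t := extChartAt (𝓡∂ 3) p ⁻¹' Metric.ball (extChartAt (𝓡∂ 3) p p) r)),
    ← Measure.restrict_apply hm, riemVolume_restrict_source, chartVolume_apply g p hm]
  -- The radius `r` was chosen so that the continuous density stays below its value at the centre
  -- plus one.
  obtain ⟨C, hC⟩ : ∃ C, C = √(gram g p (extChartAt (𝓡∂ 3) p p)).det + 1 := ⟨_, rfl⟩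
  have hsub : (extChartAt (𝓡∂ 3) p).target ∩ (extChartAt (𝓡∂ 3) p).symm ⁻¹'
      ((extChartAt (𝓡∂ 3) p).source ∩ extChartAt (𝓡∂ 3) p ⁻¹' Metric.ball
        (extChartAt (𝓡∂ 3) p p) r) ⊆ Metric.ball (extChartAt (𝓡∂ 3) p p) r := fun y hy => by
    have := hy.2.2
    rwa [mem_preimage, (extChartAt (𝓡∂ 3) p).right_inv hy.1] at this
  refine lt_of_le_of_lt (setLIntegral_mono' (g := fun _ => ENNReal.ofReal C)
    (measurableSet_inter_preimage (dom_target p).measurableSet (continuousOn_extChartAt_symm p) hm)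
    fun y hy => ?_) ?_
  · refine ENNReal.ofReal_le_ofReal ?_
    rw [hC]
    exact le_of_lt (hr' ⟨hsub hy, target_subset_HS p hy.1⟩)
  · rw [setLIntegral_const]
    exact ENNReal.mul_lt_top ENNReal.ofReal_lt_top
      ((measure_mono hsub).trans_lt measure_ball_lt_top)

end

/-! ### The divergence theorem for fields with compact support -/

/-- Integration by parts against the constant function 1. -/
theorem integral_fderiv_eq_zero {u : E3 → ℝ} (hu : ContDiff ℝ ∞ u) (hs : HasCompactSupport u)
    (v : E3) : Integrable (fun y => fderiv ℝ u y v) ∧ ∫ y, fderiv ℝ u y v = 0 := by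
  have hi : Integrable (fun y => fderiv ℝ u y v) := by
    refine Continuous.integrable_of_hasCompactSupport ?_ (hs.fderiv_apply ℝ v)
    exact (hu.continuous_fderiv (by simp)).clm_apply continuous_const
  refine ⟨hi, ?_⟩
  have h := integral_mul_fderiv_eq_neg_fderiv_mul_of_integrable (μ := (volume : Measure E3))
    (f := fun _ : E3 => (1 : ℝ)) (g := u) (v := v) (by simp) (by simpa using hi)
    (by simpa using hu.continuous.integrable_of_hasCompactSupport hs) (by simp)
    (fun y _ => (hu.differentiable (by simp)) y)
  simpa using h

section

variable {M : Type u} [TopologicalSpace M] [ChartedSpace (EuclideanHalfSpace 3) M]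
  [IsManifold (𝓡∂ 3) ∞ M] (g : RMetric M)

theorem div_congr {X Y : ∀ q : M, TangentSpace (𝓡∂ 3) q} {U : Set M} (hU : IsOpen U)
    (h : ∀ q ∈ U, X q = Y q) {q : M} (hq : q ∈ U) : div g X q = div g Y q := by
  refine divergence_congr (dom_chartDom q hU) (fun y hy => ?_)
    (mem_chartDom (mem_extChartAt_source q) hq)
  funext k
  unfold components
  rw [h _ hy.2]

theorem div_zero (q : M) : div g (fun _ => 0) q = 0 := by
  have : components (fun q : M => (0 : TangentSpace (𝓡∂ 3) q)) q = fun _ _ => 0 := by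
    funext y k
    have := components_smul (fun _ => 0) (fun q : M => (0 : TangentSpace (𝓡∂ 3) q)) q y k
    simpa using this
  rw [div, this, divergence]
  simp [Dom.pd_const]

theorem components_sum {κ : Type*} (s : Finset κ) (X : κ → ∀ q : M, TangentSpace (𝓡∂ 3) q) (p : M)
    (y : E3) (k : Fin 3) :
    components (fun q => ∑ i ∈ s, X i q) p y k = ∑ i ∈ s, components (X i) p y k := by
  have key := map_sum (mfderiv (𝓡∂ 3) 𝓘(ℝ, E3) (extChartAt (𝓡∂ 3) p)
    ((extChartAt (𝓡∂ 3) p).symm y)) (fun i => X i ((extChartAt (𝓡∂ 3) p).symm y)) s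
  have h2 := congrArg (fun v : E3 => EuclideanSpace.proj (𝕜 := ℝ) k v) key
  exact h2.trans (map_sum (EuclideanSpace.proj (𝕜 := ℝ) k : E3 →L[ℝ] ℝ) _ s)

theorem div_sum {κ : Type*} (s : Finset κ) {X : κ → ∀ q : M, TangentSpace (𝓡∂ 3) q} {U : Set M}
    (hU : IsOpen U) (hX : ∀ i ∈ s, ContMDiffOn (𝓡∂ 3) (𝓡∂ 3).tangent ∞
      (fun q => (⟨q, X i q⟩ : TangentBundle (𝓡∂ 3) M)) U) {q : M} (hq : q ∈ U) :
    div g (fun q => ∑ i ∈ s, X i q) q = ∑ i ∈ s, div g (X i) q := by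
  have hm := mem_chartDom (mem_extChartAt_source (I := 𝓡∂ 3) q) hq
  have hD := dom_chartDom q hU
  have hS : ContMDiffOn (𝓡∂ 3) (𝓡∂ 3).tangent ∞
      (fun q => (⟨q, ∑ i ∈ s, X i q⟩ : TangentBundle (𝓡∂ 3) M)) U :=
    contMDiffOn_of_components hU fun p k =>
      (ContDiffOn.sum fun i hi => sm_components (hX i hi) p k).congr
        fun y _ => components_sum s X p y k
  rw [div_eq_sum g hU hS hq, Finset.sum_congr rfl fun i hi => div_eq_sum g hU (hX i hi) hq,
    Finset.sum_comm]
  refine Finset.sum_congr rfl fun k _ => ?_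
  rw [hD.pd_congr (fun y _ => components_sum s X q y k) k hm,
    hD.pd_sum s (fun i hi => sm_components (hX i hi) q k) k hm, components_sum,
    Finset.sum_add_distrib]
  simp only [Finset.mul_sum]
  rw [Finset.sum_comm]

/-- The manifold has no boundary. -/
def NoBoundary (M : Type u) [TopologicalSpace M] [ChartedSpace (EuclideanHalfSpace 3) M] : Prop :=
  ∀ q : M, (𝓡∂ 3).IsInteriorPoint q

theorem target_subset_pos (hM : NoBoundary M) (p : M) {y : E3}
    (hy : y ∈ (extChartAt (𝓡∂ 3) p).target) : 0 < y 0 := by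
  have hq : (extChartAt (𝓡∂ 3) p).symm y ∈ (chartAt (EuclideanHalfSpace 3) p).source := by
    rw [← extChartAt_source (𝓡∂ 3)]; exact (extChartAt (𝓡∂ 3) p).map_target hy
  have h1 := (ModelWithCorners.isInteriorPoint_iff_of_mem_atlas (I := 𝓡∂ 3) (n := ∞) (by simp)
    (chart_mem_atlas _ p) hq).1 (hM _)
  have h2 : y ∈ interior (extChartAt (𝓡∂ 3) p).target := by
    have e : extChartAt (𝓡∂ 3) p ((extChartAt (𝓡∂ 3) p).symm y) = y :=
      (extChartAt (𝓡∂ 3) p).right_inv hy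
    rw [← e]; exact h1
  have h3 : y ∈ interior (range (𝓡∂ 3)) := interior_mono (target_subset_HS p) h2
  rwa [interior_range_modelWithCornersEuclideanHalfSpace] at h3

theorem isOpen_target (hM : NoBoundary M) (p : M) : IsOpen (extChartAt (𝓡∂ 3) p).target := by
  obtain ⟨O, hO, h⟩ := dom_target p
  have : (extChartAt (𝓡∂ 3) p).target = {y : E3 | 0 < y 0} ∩ O := by
    ext y
    constructor
    · intro hy
      exact ⟨target_subset_pos hM p hy, (h ▸ hy : y ∈ HS ∩ O).2⟩
    · rintro ⟨hy, hyO⟩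
      rw [h]
      exact ⟨mem_HS.2 (le_of_lt hy), hyO⟩
  rw [this]
  exact (isOpen_lt continuous_const (by fun_prop)).inter hO

variable [MeasurableSpace M] [BorelSpace M] [SecondCountableTopology M] [T2Space M]

/-- Inside one chart, `√det G div Z` is a Euclidean divergence. As there is no boundary, the chart
target is open in `E3`, and the weighted components extend by zero to smooth functions with compact
support on the whole space. -/
theorem integral_div_eq_zero_of_subset (hM : NoBoundary M) {Z : ∀ q : M, TangentSpace (𝓡∂ 3) q}
    (hZ : ContMDiff (𝓡∂ 3) (𝓡∂ 3).tangent ∞ (fun q => (⟨q, Z q⟩ : TangentBundle (𝓡∂ 3) M)))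
    {K : Set M} (hK : IsCompact K) {p : M} (hKp : K ⊆ (extChartAt (𝓡∂ 3) p).source)
    (h0 : ∀ q ∉ K, Z q = 0) : ∫ q, div g Z q ∂(riemVolume g) = 0 := by
  have hc : Continuous (div g Z) :=
    (contMDiffOn_univ.1 (contMDiffOn_div g isOpen_univ hZ.contMDiffOn)).continuous
  have hd0 : ∀ q ∉ K, div g Z q = 0 := fun q hq => by
    rw [div_congr g hK.isClosed.isOpen_compl (Y := fun _ => 0) h0 hq, div_zero]
  rw [← setIntegral_eq_integral_of_forall_compl_eq_zero
    (s := (extChartAt (𝓡∂ 3) p).source) fun q hq => hd0 q fun h => hq (hKp h),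
    setIntegral_riemVolume g p hc]
  obtain ⟨T, hT⟩ : ∃ T, T = (extChartAt (𝓡∂ 3) p).target := ⟨_, rfl⟩
  have hTo : IsOpen T := hT ▸ isOpen_target hM p
  have hTd : Dom T := hT ▸ dom_target p
  have hmet : Met T (gram g p) := hT ▸ met_gram g p
  have hsc : ∀ k, Sm T (fun y => components Z p y k) := fun k => by
    have := sm_components (U := univ) hZ.contMDiffOn p k
    rw [preimage_univ, inter_univ] at this
    rwa [hT]
  obtain ⟨L, hL⟩ : ∃ L, L = extChartAt (𝓡∂ 3) p '' K := ⟨_, rfl⟩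
  have hLc : IsCompact L := hL ▸ hK.image_of_continuousOn ((continuousOn_extChartAt p).mono hKp)
  have hLT : L ⊆ T := by
    rw [hL, hT]
    rintro _ ⟨q, hq, rfl⟩
    exact (extChartAt (𝓡∂ 3) p).map_source (hKp hq)
  have hc0 : ∀ y ∈ T, y ∉ L → ∀ k, components Z p y k = 0 := fun y hy hyL k => by
    have : (extChartAt (𝓡∂ 3) p).symm y ∉ K := fun h => hyL (by
      rw [hL]
      exact ⟨_, h, (extChartAt (𝓡∂ 3) p).right_inv (hT ▸ hy)⟩)
    have h2 := components_eq_iff Z p (hT ▸ hy) (fun _ => 0) (by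
      rw [h0 _ this]; exact (Finset.sum_eq_zero fun k _ => zero_smul ℝ _).symm) k
    exact h2
  obtain ⟨w, hw⟩ : ∃ w : Fin 3 → E3 → ℝ, ∀ k, w k =
    T.indicator (fun y => √(gram g p y).det * components Z p y k) := ⟨_, fun _ => rfl⟩
  have hw0 : ∀ k, ∀ y ∉ L, w k y = 0 := fun k y hy => by
    rw [hw]
    by_cases h : y ∈ T
    · rw [indicator_of_mem h, hc0 y h hy, mul_zero]
    · rw [indicator_of_notMem h]
  have hwT : ∀ k, ∀ y ∈ T, w k y = √(gram g p y).det * components Z p y k := fun k y hy => by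
    rw [hw, indicator_of_mem hy]
  have hws : ∀ k, ContDiff ℝ ∞ (w k) := fun k => by
    rw [contDiff_iff_contDiffAt]
    intro y
    by_cases hy : y ∈ T
    · exact ((((hmet.sm_sqrt_det).mul (hsc k)).congr (hwT k)).contDiffAt (hTo.mem_nhds hy))
    · refine (contDiffAt_const (c := (0 : ℝ))).congr_of_eventuallyEq ?_
      filter_upwards [hLc.isClosed.isOpen_compl.mem_nhds fun h => hy (hLT h)] with z hz
      exact hw0 k z hz
  have hwc : ∀ k, HasCompactSupport (w k) := fun k => HasCompactSupport.intro hLc (hw0 k)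
  have key : ∀ y ∈ T, √(gram g p y).det * div g Z ((extChartAt (𝓡∂ 3) p).symm y) =
      ∑ k, fderiv ℝ (w k) y (EuclideanSpace.single k 1) := fun y hy => by
    have hy' : y ∈ (extChartAt (𝓡∂ 3) p).target := hT ▸ hy
    rw [div_eq g isOpen_univ hZ.contMDiffOn ((extChartAt (𝓡∂ 3) p).map_target hy') (mem_univ _),
      (extChartAt (𝓡∂ 3) p).right_inv hy', divergence, ← mul_assoc, mul_inv_cancel₀
      (Real.sqrt_pos.2 (hmet.det_pos hy)).ne', one_mul]
    refine Finset.sum_congr rfl fun k _ => ?_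
    rw [← hTd.pd_congr (hwT k) k hy, pd, fderivWithin_of_mem_nhds]
    exact Filter.mem_of_superset (hTo.mem_nhds hy) hTd.sub
  rw [← hT, setIntegral_congr_fun hTo.measurableSet key,
    setIntegral_eq_integral_of_forall_compl_eq_zero, integral_finsetSum]
  · exact Finset.sum_eq_zero fun k _ => (integral_fderiv_eq_zero (hws k) (hwc k) _).2
  · exact fun k _ => (integral_fderiv_eq_zero (hws k) (hwc k) _).1
  · intro y hy
    refine Finset.sum_eq_zero fun k _ => ?_
    have : w k =ᶠ[𝓝 y] fun _ => 0 := by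
      filter_upwards [hLc.isClosed.isOpen_compl.mem_nhds fun h => hy (hLT h)] with z hz
      exact hw0 k z hz
    rw [this.fderiv_eq]
    simp

theorem continuous_div {Z : ∀ q : M, TangentSpace (𝓡∂ 3) q}
    (hZ : ContMDiff (𝓡∂ 3) (𝓡∂ 3).tangent ∞ (fun q => (⟨q, Z q⟩ : TangentBundle (𝓡∂ 3) M))) :
    Continuous (div g Z) :=
  (contMDiffOn_univ.1 (contMDiffOn_div g isOpen_univ hZ.contMDiffOn)).continuous

theorem integrable_div {Z : ∀ q : M, TangentSpace (𝓡∂ 3) q}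
    (hZ : ContMDiff (𝓡∂ 3) (𝓡∂ 3).tangent ∞ (fun q => (⟨q, Z q⟩ : TangentBundle (𝓡∂ 3) M)))
    {K : Set M} (hK : IsCompact K) (h0 : ∀ q ∉ K, Z q = 0) :
    Integrable (div g Z) (riemVolume g) := by
  refine (continuous_div g hZ).integrable_of_hasCompactSupport (HasCompactSupport.intro hK ?_)
  intro q hq
  rw [div_congr g hK.isClosed.isOpen_compl (Y := fun _ => 0) h0 hq, div_zero]

/-- A partition of unity subordinate to the charts reduces to fields supported in a single chart;
only finitely many of its members meet the compact set `K`. -/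
theorem integral_div_eq_zero (hM : NoBoundary M) {Z : ∀ q : M, TangentSpace (𝓡∂ 3) q}
    (hZ : ContMDiff (𝓡∂ 3) (𝓡∂ 3).tangent ∞ (fun q => (⟨q, Z q⟩ : TangentBundle (𝓡∂ 3) M)))
    {K : Set M} (hK : IsCompact K) (h0 : ∀ q ∉ K, Z q = 0) :
    ∫ q, div g Z q ∂(riemVolume g) = 0 := by
  have : LocallyCompactSpace M := Manifold.locallyCompact_of_finiteDimensional (𝓡∂ 3)
  obtain ⟨ρ, hρ⟩ := SmoothPartitionOfUnity.exists_isSubordinate_chartAt_source (𝓡∂ 3) M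
  obtain ⟨s, hs⟩ : ∃ s : Finset M, ∀ i, (Function.support (ρ i) ∩ K).Nonempty → i ∈ s :=
    ⟨(ρ.locallyFinite.finite_nonempty_inter_compact hK).toFinset, fun i hi => by simpa using hi⟩
  have hsum : ∀ q, ∑ i ∈ s, ρ i q • Z q = Z q := fun q => by
    by_cases hq : q ∈ K
    · have h1 : ∑ i ∈ s, ρ i q = 1 := ρ.toPartitionOfUnity.sum_finsupport' (mem_univ q)
        fun i hi => hs i ⟨q, (ρ.mem_finsupport q).1 hi, hq⟩
      rw [← Finset.sum_smul, h1, one_smul]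
    · rw [h0 q hq]; simp
  have hsm : ∀ i ∈ s, ContMDiffOn (𝓡∂ 3) (𝓡∂ 3).tangent ∞
      (fun q => (⟨q, ρ i q • Z q⟩ : TangentBundle (𝓡∂ 3) M)) univ := fun i _ =>
    contMDiffOn_smul_field isOpen_univ (ρ i).contMDiff.contMDiffOn hZ.contMDiffOn
  have hcp : ∀ i, IsCompact (tsupport (ρ i) ∩ K) := fun i => hK.inter_left (isClosed_tsupport _)
  have hz : ∀ i, ∀ q ∉ tsupport (ρ i) ∩ K, ρ i q • Z q = 0 := fun i q hq => by
    by_cases h : q ∈ K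
    · rw [image_eq_zero_of_notMem_tsupport fun h' => hq ⟨h', h⟩, zero_smul]
    · rw [h0 q h, smul_zero]
  have hdiv : ∀ q, div g Z q = ∑ i ∈ s, div g (fun q => ρ i q • Z q) q := fun q => by
    rw [← div_sum g s isOpen_univ hsm (mem_univ q)]
    exact div_congr g isOpen_univ (fun q _ => (hsum q).symm) (mem_univ q)
  simp_rw [hdiv]
  rw [integral_finsetSum _ fun i hi => integrable_div g (contMDiffOn_univ.1 (hsm i hi)) (hcp i)
    (hz i)]
  refine Finset.sum_eq_zero fun i hi => integral_div_eq_zero_of_subset g hM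
    (contMDiffOn_univ.1 (hsm i hi)) (hcp i) (p := i) (fun q hq => ?_) (hz i)
  rw [extChartAt_source]
  exact hρ i hq.1

end

/-! ### Calibrated regions are outer-minimising -/

theorem deriv_smoothTransition_nonneg (x : ℝ) : 0 ≤ deriv Real.smoothTransition x :=
  Real.smoothTransition.monotone.deriv_nonneg

theorem deriv_smoothTransition_of_nonpos {x : ℝ} (hx : x ≤ 0) : deriv Real.smoothTransition x = 0 :=
  IsLocalMin.deriv_eq_zero (Filter.Eventually.of_forall fun y => by
    rw [Real.smoothTransition.zero_of_nonpos hx]; exact Real.smoothTransition.nonneg y)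

theorem deriv_smoothTransition_of_one_le {x : ℝ} (hx : 1 ≤ x) : deriv Real.smoothTransition x = 0 :=
  IsLocalMax.deriv_eq_zero (Filter.Eventually.of_forall fun y => by
    rw [Real.smoothTransition.one_of_one_le hx]; exact Real.smoothTransition.le_one y)

section

variable {M : Type u} [TopologicalSpace M] [ChartedSpace (EuclideanHalfSpace 3) M]
  [IsManifold (𝓡∂ 3) ∞ M] (g : RMetric M)

/-- The unit normal of the level sets of `s`. -/
def unitNormal (s : M → ℝ) (q : M) : TangentSpace (𝓡∂ 3) q := (√(gsq g s q))⁻¹ • grad g s q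

theorem contMDiffOn_unitNormal {s : M → ℝ} {U : Set M} (hU : IsOpen U)
    (hs : ContMDiffOn (𝓡∂ 3) 𝓘(ℝ, ℝ) ∞ s U) (hpos : ∀ q ∈ U, 0 < gsq g s q) :
    ContMDiffOn (𝓡∂ 3) (𝓡∂ 3).tangent ∞
      (fun q => (⟨q, unitNormal g s q⟩ : TangentBundle (𝓡∂ 3) M)) U := by
  refine contMDiffOn_smul_field hU ?_ (contMDiffOn_grad g hU hs)
  refine contMDiffOn_comp_real (V := Ioi 0) (φ := fun x => (√x)⁻¹) (contMDiffOn_gsq g hU hs) ?_ hpos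
  exact (contDiffOn_id.sqrt fun x hx => (ne_of_gt hx)).inv fun x hx =>
    (Real.sqrt_pos.2 hx).ne'

theorem inner_unitNormal {s : M → ℝ} {q : M} (hs : MDifferentiableAt (𝓡∂ 3) 𝓘(ℝ, ℝ) s q)
    (hpos : 0 < gsq g s q) : g.inner q (unitNormal g s q) (unitNormal g s q) = 1 := by
  rw [unitNormal, inner_smul_left, inner_smul_right, ← gsq_eq_inner g hs, ← mul_assoc, ← mul_inv,
    Real.mul_self_sqrt hpos.le, inv_mul_cancel₀ hpos.ne']

theorem dd_unitNormal {s : M → ℝ} {q : M} (hs : MDifferentiableAt (𝓡∂ 3) 𝓘(ℝ, ℝ) s q) :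
    dd s q (unitNormal g s q) = √(gsq g s q) := by
  rw [unitNormal, dd_smul, ← gsq_eq_dd g hs, inv_mul_eq_div, Real.div_sqrt]

variable [MeasurableSpace M] [BorelSpace M] [SecondCountableTopology M] [T2Space M]

/-- A form of the divergence theorem on `{s ≤ 0}` that needs no boundary integral. The cutoffs `χₙ`,
equal to 1 on `{s ≤ 0}` and to 0 on `{s ≥ 1/n}`, satisfy `0 = ∫ div(χₙ Z) = ∫ χₙ div Z + ∫ dχₙ(Z)`.
For large `n` the last term is nonpositive, and `χₙ` tends to the indicator of `{s ≤ 0}`. -/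
theorem setIntegral_div_nonneg (hM : NoBoundary M) {s : M → ℝ}
    (hs : ContMDiff (𝓡∂ 3) 𝓘(ℝ, ℝ) ∞ s) {Z : ∀ q : M, TangentSpace (𝓡∂ 3) q}
    (hZ : ContMDiff (𝓡∂ 3) (𝓡∂ 3).tangent ∞ (fun q => (⟨q, Z q⟩ : TangentBundle (𝓡∂ 3) M)))
    {K : Set M} (hK : IsCompact K) (h0 : ∀ q ∉ K, Z q = 0) {δ : ℝ} (hδ : 0 < δ)
    (hds : ∀ q, 0 < s q → s q < δ → 0 ≤ dd s q (Z q)) :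
    0 ≤ ∫ q in {q | s q ≤ 0}, div g Z q ∂(riemVolume g) := by
  have hAm : MeasurableSet {q | s q ≤ 0} := (isClosed_le hs.continuous continuous_const).measurableSet
  let χ : ℕ → M → ℝ := fun n q => 1 - Real.smoothTransition (n * s q)
  have hχ : ∀ n, ContMDiff (𝓡∂ 3) 𝓘(ℝ, ℝ) ∞ (χ n) := fun n => by
    have h1 : ContDiff ℝ ∞ fun x : ℝ => 1 - Real.smoothTransition (n * x) :=
      contDiff_const.sub (Real.smoothTransition.contDiff.comp (contDiff_const.mul contDiff_id))
    exact h1.contMDiff.comp hs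
  have hdχ : ∀ n q, dd (χ n) q (Z q) = -(n * deriv Real.smoothTransition (n * s q)) * dd s q (Z q) :=
    fun n q => by
    refine dd_comp (hs.mdifferentiableAt (by simp)) (φ := fun x => 1 - Real.smoothTransition (n * x))
      ?_ _
    have h1 : HasDerivAt Real.smoothTransition (deriv Real.smoothTransition (n * s q)) (n * s q) :=
      ((Real.smoothTransition.contDiff (n := 1)).differentiable (by simp) _).hasDerivAt
    have h2 := (h1.comp (s q) ((hasDerivAt_id (s q)).const_mul (n : ℝ))).const_sub 1
    rw [mul_one, mul_comm (deriv _ _)] at h2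
    exact h2
  have hint := integrable_div g hZ hK h0
  have hle : ∀ᶠ n : ℕ in Filter.atTop, 0 ≤ ∫ q, χ n q * div g Z q ∂(riemVolume g) := by
    obtain ⟨n₀, hn₀⟩ := exists_nat_gt δ⁻¹
    filter_upwards [Filter.eventually_ge_atTop n₀] with n hn
    have hn' : δ⁻¹ < n := hn₀.trans_le (by exact_mod_cast hn)
    have hn0 : (0 : ℝ) < n := (inv_pos.2 hδ).trans hn'
    have hsm := contMDiffOn_univ.1
      (contMDiffOn_smul_field isOpen_univ (hχ n).contMDiffOn hZ.contMDiffOn)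
    have hz : ∀ q ∉ K, χ n q • Z q = 0 := fun q hq => by rw [h0 q hq, smul_zero]
    have h1 := integral_div_eq_zero g hM hsm hK hz
    rw [← h1]
    refine integral_mono (integrable_div g hsm hK hz) ?_ fun q => ?_
    · refine hint.bdd_mul (c := 1) (hχ n).continuous.aestronglyMeasurable (ae_of_all _ fun q => ?_)
      rw [Real.norm_eq_abs, abs_le]
      have := Real.smoothTransition.nonneg (n * s q)
      have := Real.smoothTransition.le_one (n * s q)
      constructor <;> simp only [χ] <;> linarith
    · change div g (fun q => χ n q • Z q) q ≤ χ n q * div g Z q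
      rw [div_smul g isOpen_univ hZ.contMDiffOn (hχ n).contMDiffOn (mem_univ q), hdχ]
      suffices h : 0 ≤ n * deriv Real.smoothTransition (n * s q) * dd s q (Z q) by linarith
      rcases le_or_gt (s q) 0 with h | h
      · rw [deriv_smoothTransition_of_nonpos (mul_nonpos_of_nonneg_of_nonpos hn0.le h)]; simp
      rcases le_or_gt 1 (n * s q) with h' | h'
      · rw [deriv_smoothTransition_of_one_le h']; simp
      · refine mul_nonneg (mul_nonneg hn0.le (deriv_smoothTransition_nonneg _)) (hds q h ?_)
        rw [mul_comm, ← lt_div_iff₀ hn0, one_div] at h'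
        exact h'.trans (inv_lt_of_inv_lt₀ hδ hn')
  have hlim : Filter.Tendsto (fun n => ∫ q, χ n q * div g Z q ∂(riemVolume g)) Filter.atTop
      (𝓝 (∫ q, {q | s q ≤ 0}.indicator (div g Z) q ∂(riemVolume g))) := by
    refine tendsto_integral_of_dominated_convergence (fun q => |div g Z q|) (fun n => ?_) hint.abs
      (fun n => ae_of_all _ fun q => ?_) (ae_of_all _ fun q => ?_)
    · exact ((hχ n).continuous.mul (continuous_div g hZ)).aestronglyMeasurable
    · rw [Real.norm_eq_abs, abs_mul]
      refine mul_le_of_le_one_left (abs_nonneg _) (abs_le.2 ?_)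
      have := Real.smoothTransition.nonneg (n * s q)
      have := Real.smoothTransition.le_one (n * s q)
      constructor <;> simp only [χ] <;> linarith
    · by_cases h : s q ≤ 0
      · rw [indicator_of_mem (by exact h)]
        refine tendsto_const_nhds.congr fun n => ?_
        simp only [χ]
        rw [Real.smoothTransition.zero_of_nonpos
          (mul_nonpos_of_nonneg_of_nonpos (Nat.cast_nonneg n) h), sub_zero, one_mul]
      · rw [indicator_of_notMem (by exact h)]
        push Not at h
        refine tendsto_const_nhds.congr' ?_
        obtain ⟨n₀, hn₀⟩ := exists_nat_gt (s q)⁻¹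
        filter_upwards [Filter.eventually_ge_atTop n₀] with n hn
        have hn' : (s q)⁻¹ < n := hn₀.trans_le (by exact_mod_cast hn)
        simp only [χ]
        rw [Real.smoothTransition.one_of_one_le, sub_self, zero_mul]
        rw [inv_lt_iff_one_lt_mul₀ h] at hn'
        linarith
  rw [← integral_indicator hAm]
  exact ge_of_tendsto hlim hle

theorem isTestField_zero : IsTestField g (fun _ : M => 0) :=
  ⟨by
    have h : ContMDiffOn (𝓡∂ 3) (𝓡∂ 3).tangent ∞
        (fun q => (⟨q, (0 : TangentSpace (𝓡∂ 3) q)⟩ : TangentBundle (𝓡∂ 3) M)) univ := by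
      refine contMDiffOn_of_components isOpen_univ fun p k => ?_
      refine (contDiffOn_const (c := (0 : ℝ))).congr fun y hy => ?_
      have := components_smul (fun _ => 0) (fun q : M => (0 : TangentSpace (𝓡∂ 3) q)) p y k
      simpa using this
    exact contMDiffOn_univ.1 h, ⟨∅, isCompact_empty, fun _ _ => rfl⟩, fun q => by simp⟩

/-- Just outside the region `X` crosses the level sets of `s` at least as fast as any other test
field `Y`, so `setIntegral_div_nonneg` applies to `X - Y`. -/
theorem perimeter_le_of_calibration (hM : NoBoundary M) {s : M → ℝ}
    (hs : ContMDiff (𝓡∂ 3) 𝓘(ℝ, ℝ) ∞ s)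
    {X : ∀ q : M, TangentSpace (𝓡∂ 3) q} (hX : IsTestField g X) {δ : ℝ} (hδ : 0 < δ)
    (hds : ∀ q, 0 < s q → s q < δ → ∀ v, g.inner q v v ≤ 1 → dd s q v ≤ dd s q (X q)) :
    0 ≤ ∫ q in {q | s q ≤ 0}, div g X q ∂(riemVolume g) ∧ perimeter g {q | s q ≤ 0} ≤
      ENNReal.ofReal (∫ q in {q | s q ≤ 0}, div g X q ∂(riemVolume g)) := by
  have key : ∀ Y, IsTestField g Y → ∫ q in {q | s q ≤ 0}, div g Y q ∂(riemVolume g) ≤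
      ∫ q in {q | s q ≤ 0}, div g X q ∂(riemVolume g) := by
    intro Y hY
    obtain ⟨K, hK, hK0⟩ := hX.compactSupport
    obtain ⟨L, hL, hL0⟩ := hY.compactSupport
    have h := setIntegral_div_nonneg g hM hs (Z := fun q => X q - Y q) (contMDiffOn_univ.1
      (contMDiffOn_sub_field isOpen_univ hX.smooth.contMDiffOn hY.smooth.contMDiffOn)) (hK.union hL)
      (fun q hq => by
        rw [hK0 q fun h => hq (Or.inl h), hL0 q fun h => hq (Or.inr h), sub_zero]) hδ
      (fun q h1 h2 => by
        rw [dd_sub]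
        exact sub_nonneg.2 (hds q h1 h2 _ (hY.length_le q)))
    rw [← sub_nonneg, ← integral_sub (integrable_div g hX.smooth hK hK0).integrableOn
      (integrable_div g hY.smooth hL hL0).integrableOn]
    refine h.trans_eq (integral_congr_ae (ae_of_all _ fun q => ?_))
    exact div_sub g isOpen_univ hX.smooth.contMDiffOn hY.smooth.contMDiffOn (mem_univ q)
  -- Nonnegativity is the comparison with `Y = 0`; it ensures that `ENNReal.ofReal` does not
  -- truncate the integral.
  refine ⟨?_, iSup₂_le fun Y hY => ENNReal.ofReal_le_ofReal (key Y hY)⟩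
  refine le_trans (le_of_eq ?_) (key _ (isTestField_zero g))
  simp_rw [div_zero]
  simp

/-- The field `X` tests the perimeter of `F` from below, and its flux through `F` exceeds the flux
through the sublevel set by the integral of a positive function over a set of positive volume. -/
theorem perimeter_lt_of_calibration (hM : NoBoundary M) {s : M → ℝ}
    (hs : ContMDiff (𝓡∂ 3) 𝓘(ℝ, ℝ) ∞ s)
    {X : ∀ q : M, TangentSpace (𝓡∂ 3) q} (hX : IsTestField g X) {δ : ℝ} (hδ : 0 < δ)
    (hds : ∀ q, 0 < s q → s q < δ → ∀ v, g.inner q v v ≤ 1 → dd s q v ≤ dd s q (X q))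
    {F : Set M} (hF : MeasurableSet F) (hAF : {q | s q ≤ 0} ⊆ F)
    (hvol : riemVolume g (F \ {q | s q ≤ 0}) ≠ 0)
    (hdiv : ∀ q ∈ F, 0 < s q → 0 < div g X q) :
    perimeter g {q | s q ≤ 0} < perimeter g F := by
  obtain ⟨h0, h1⟩ := perimeter_le_of_calibration g hM hs hX hδ hds
  obtain ⟨K, hK, hK0⟩ := hX.compactSupport
  have hint := integrable_div g hX.smooth hK hK0
  have hAm : MeasurableSet {q | s q ≤ 0} := (isClosed_le hs.continuous continuous_const).measurableSet
  have hpos : 0 < ∫ q in F \ {q | s q ≤ 0}, div g X q ∂(riemVolume g) := by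
    rw [setIntegral_pos_iff_support_of_nonneg_ae _ hint.integrableOn]
    · rw [inter_eq_self_of_subset_right]
      · exact pos_iff_ne_zero.2 hvol
      · exact fun q hq => (hdiv q hq.1 (not_le.1 hq.2)).ne'
    · exact (ae_restrict_iff' (hF.diff hAm)).2
        (ae_of_all _ fun q hq => (hdiv q hq.1 (not_le.1 hq.2)).le)
  have h2 : ENNReal.ofReal (∫ q in F, div g X q ∂(riemVolume g)) ≤ perimeter g F :=
    le_iSup₂ (f := fun (X : ∀ q : M, TangentSpace (𝓡∂ 3) q)
      (_ : X ∈ {X : ∀ q : M, TangentSpace (𝓡∂ 3) q | IsTestField g X}) =>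
        ENNReal.ofReal (∫ q in F, div g X q ∂(riemVolume g))) X hX
  refine h1.trans_lt (lt_of_lt_of_le ?_ h2)
  rw [← sdiff_union_of_subset hAF, setIntegral_union disjoint_sdiff_left hAm hint.integrableOn
    hint.integrableOn, ENNReal.ofReal_lt_ofReal_iff (by linarith)]
  linarith

/-- The calibration is the unit normal of the level sets of `s`, cut off deep inside the region,
where the gradient may vanish, and beyond `F`, to make the support compact. -/
theorem isStrictlyOuterMinimising_sublevel (hM : NoBoundary M) {s : M → ℝ}
    (hs : ContMDiff (𝓡∂ 3) 𝓘(ℝ, ℝ) ∞ s) {s₀ : ℝ} (hs₀ : 0 < s₀) (hlt : ∀ q, s q < s₀)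
    (hc : ∀ t < s₀, IsCompact {q | s q ≤ t}) (hgs : ∀ q, 0 ≤ s q → 0 < gsq g s q)
    (hdiv : ∀ q, 0 < s q → 0 < div g (unitNormal g s) q) :
    IsStrictlyOuterMinimising g {q | s q ≤ 0} := by
  intro F hF hAF hFc hvol
  -- On the compact closure of `F` the function `s` attains a maximum, which is below `s₀`; this
  -- leaves room for the outer cutoff.
  obtain ⟨t₁, ht₁, ht₁s, hFt⟩ : ∃ t, 0 < t ∧ t < s₀ ∧ ∀ q ∈ F, s q < t := by
    obtain ⟨m, hm, hFm⟩ : ∃ m < s₀, ∀ q ∈ F, s q ≤ m := by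
      rcases F.eq_empty_or_nonempty with h | h
      · exact ⟨0, hs₀, by simp [h]⟩
      · obtain ⟨q₁, -, hq₁⟩ := hFc.exists_isMaxOn h.closure hs.continuous.continuousOn
        exact ⟨s q₁, hlt q₁, fun q hq => hq₁ (subset_closure hq)⟩
    obtain ⟨t, ht, ht'⟩ := exists_between (max_lt hm hs₀)
    exact ⟨t, (le_max_right _ _).trans_lt ht, ht',
      fun q hq => (hFm q hq).trans_lt ((le_max_left _ _).trans_lt ht)⟩
  obtain ⟨t₂, ht₁₂, ht₂⟩ := exists_between ht₁s
  have hmd : ∀ q, MDifferentiableAt (𝓡∂ 3) 𝓘(ℝ, ℝ) s q := fun q => hs.mdifferentiableAt (by simp)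
  have hgc : Continuous (gsq g s) :=
    (contMDiffOn_univ.1 (contMDiffOn_gsq g isOpen_univ hs.contMDiffOn)).continuous
  -- The critical points in `{s ≤ 0}` form a compact set on which `s < 0`; the maximum of `s` there
  -- is `-δ`. If there are none, any `δ` works.
  obtain ⟨δ, hδ, hδg⟩ : ∃ δ > 0, ∀ q, -δ < s q → 0 < gsq g s q := by
    have hB : IsCompact ({q | s q ≤ 0} ∩ {q | gsq g s q ≤ 0}) :=
      (hc 0 hs₀).inter_right (isClosed_le hgc continuous_const)
    rcases ({q | s q ≤ 0} ∩ {q | gsq g s q ≤ 0}).eq_empty_or_nonempty with h | h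
    · refine ⟨1, one_pos, fun q _ => ?_⟩
      by_contra hn
      have hq : q ∈ ({q | s q ≤ 0} ∩ {q | gsq g s q ≤ 0}) :=
        ⟨le_of_not_ge fun h' => hn (hgs q h'), not_lt.1 hn⟩
      rw [h] at hq
      exact hq
    · obtain ⟨q₁, hq₁, hmax⟩ := hB.exists_isMaxOn h hs.continuous.continuousOn
      have h1 : s q₁ < 0 := lt_of_not_ge fun h' => (hgs q₁ h').not_ge hq₁.2
      refine ⟨-s q₁, neg_pos.2 h1, fun q hq => ?_⟩
      rw [neg_neg] at hq
      by_contra hn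
      have hq2 : q ∈ ({q | s q ≤ 0} ∩ {q | gsq g s q ≤ 0}) :=
        ⟨le_of_not_ge fun h' => hn (hgs q h'), not_lt.1 hn⟩
      exact hq.not_ge (hmax hq2)
  -- `η` is 1 on `[0, t₁)` and vanishes below `-δ/2` and above `t₂`.
  let η : ℝ → ℝ := fun x => Real.smoothTransition (1 + 2 * x / δ) *
    (1 - Real.smoothTransition ((x - t₁) / (t₂ - t₁)))
  have hηs : ContDiff ℝ ∞ η :=
    (Real.smoothTransition.contDiff.comp (contDiff_const.add
      ((contDiff_const.mul contDiff_id).div_const δ))).mul (contDiff_const.sub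
      (Real.smoothTransition.contDiff.comp ((contDiff_id.sub contDiff_const).div_const _)))
  have hη0 : ∀ x, 0 ≤ η x := fun x => mul_nonneg (Real.smoothTransition.nonneg _)
    (sub_nonneg.2 (Real.smoothTransition.le_one _))
  have hη1 : ∀ x, η x ≤ 1 := fun x => mul_le_one₀ (Real.smoothTransition.le_one _)
    (sub_nonneg.2 (Real.smoothTransition.le_one _))
    (sub_le_self _ (Real.smoothTransition.nonneg _))
  have hηl : ∀ x, x < -δ / 2 → η x = 0 := fun x hx => by
    simp only [η]
    rw [Real.smoothTransition.zero_of_nonpos, zero_mul]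
    have : 2 * x / δ ≤ -1 := by rw [div_le_iff₀ hδ]; linarith
    linarith
  have hηm : ∀ x, 0 ≤ x → x < t₁ → η x = 1 := fun x hx hx' => by
    simp only [η]
    rw [Real.smoothTransition.one_of_one_le, Real.smoothTransition.zero_of_nonpos]
    · simp
    · exact div_nonpos_of_nonpos_of_nonneg (by linarith) (by linarith)
    · have : 0 ≤ 2 * x / δ := by positivity
      linarith
  have hηr : ∀ x, t₂ < x → η x = 0 := fun x hx => by
    simp only [η]
    rw [Real.smoothTransition.one_of_one_le (x := (x - t₁) / (t₂ - t₁)), sub_self, mul_zero]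
    rw [le_div_iff₀ (by linarith)]; linarith
  obtain ⟨X, hXd⟩ : ∃ X : ∀ q : M, TangentSpace (𝓡∂ 3) q, ∀ q, X q = η (s q) • unitNormal g s q :=
    ⟨_, fun _ => rfl⟩
  have hXν : ∀ q, 0 ≤ s q → s q < t₁ → X q = unitNormal g s q := fun q h1 h2 => by
    rw [hXd, hηm _ h1 h2, one_smul]
  have hX : IsTestField g X := by
    refine ⟨?_, ⟨{q | s q ≤ t₂}, hc t₂ ht₂, fun q hq => ?_⟩, fun q => ?_⟩
    · have hU : IsOpen {q | -δ < s q} := isOpen_lt continuous_const hs.continuous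
      have hV : IsOpen {q | s q < -δ / 2} := isOpen_lt hs.continuous continuous_const
      have h1 : ContMDiffOn (𝓡∂ 3) (𝓡∂ 3).tangent ∞
          (fun q => (⟨q, X q⟩ : TangentBundle (𝓡∂ 3) M)) {q | -δ < s q} := by
        simp_rw [hXd]
        exact contMDiffOn_smul_field hU (hηs.contMDiff.comp hs).contMDiffOn
          (contMDiffOn_unitNormal g hU hs.contMDiffOn hδg)
      have h2 : ContMDiffOn (𝓡∂ 3) (𝓡∂ 3).tangent ∞
          (fun q => (⟨q, X q⟩ : TangentBundle (𝓡∂ 3) M)) {q | s q < -δ / 2} :=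
        (isTestField_zero g).smooth.contMDiffOn.congr fun q hq => by
          rw [hXd, hηl _ hq, zero_smul]
      intro q
      rcases lt_or_ge (-δ) (s q) with h | h
      · exact h1.contMDiffAt (hU.mem_nhds h)
      · exact h2.contMDiffAt (hV.mem_nhds (show s q < -δ / 2 by linarith))
    · rw [hXd, hηr _ (not_le.1 hq), zero_smul]
    · rw [hXd, inner_smul_left, inner_smul_right]
      rcases lt_or_ge (-δ) (s q) with h | h
      · rw [inner_unitNormal g (hmd q) (hδg q h), mul_one]
        exact mul_le_one₀ (hη1 _) (hη0 _) (hη1 _)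
      · rw [hηl _ (by linarith), zero_mul]
        exact zero_le_one
  refine perimeter_lt_of_calibration g hM hs hX ht₁ (fun q h1 h2 v hv => ?_) hF hAF hvol
    fun q hq h1 => ?_
  · rw [hXν q h1.le h2, dd_unitNormal g (hmd q)]
    exact dd_le_sqrt_gsq g (hmd q) (hgs q h1.le) hv
  · have hU : IsOpen {q | 0 < s q ∧ s q < t₁} :=
      (isOpen_lt continuous_const hs.continuous).inter (isOpen_lt hs.continuous continuous_const)
    rw [div_congr g hU (fun q hq => hXν q hq.1.le hq.2) ⟨h1, hFt q hq⟩]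
    exact hdiv q h1

end

/-! ### A conformal family of metrics contains a metric that is not static -/

section

variable {M : Type u} [TopologicalSpace M] [ChartedSpace (EuclideanHalfSpace 3) M]
  [IsManifold (𝓡∂ 3) ∞ M] (g : RMetric M)

theorem dd_fun_add {a b : M → ℝ} {q : M} (ha : MDifferentiableAt (𝓡∂ 3) 𝓘(ℝ, ℝ) a q)
    (hb : MDifferentiableAt (𝓡∂ 3) 𝓘(ℝ, ℝ) b q) (v : TangentSpace (𝓡∂ 3) q) :
    dd (fun x => a x + b x) q v = dd a q v + dd b q v :=
  congrArg (fun L : E3 →L[ℝ] ℝ => L v) (ha.hasMFDerivAt.add hb.hasMFDerivAt).mfderiv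

theorem dd_fun_mul {a b : M → ℝ} {q : M} (ha : MDifferentiableAt (𝓡∂ 3) 𝓘(ℝ, ℝ) a q)
    (hb : MDifferentiableAt (𝓡∂ 3) 𝓘(ℝ, ℝ) b q) (v : TangentSpace (𝓡∂ 3) q) :
    dd (fun x => a x * b x) q v = a q * dd b q v + b q * dd a q v :=
  congrArg (fun L : E3 →L[ℝ] ℝ => L v) (ha.hasMFDerivAt.mul hb.hasMFDerivAt).mfderiv

theorem dd_const_mul {a : M → ℝ} {q : M} (ha : MDifferentiableAt (𝓡∂ 3) 𝓘(ℝ, ℝ) a q) (c : ℝ)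
    (v : TangentSpace (𝓡∂ 3) q) : dd (fun x => c * a x) q v = c * dd a q v := by
  have h := (hasDerivAt_id (a q)).const_mul c
  rw [mul_one] at h
  exact dd_comp ha (φ := fun x => c * x) h v

theorem lap_const_mul {f : M → ℝ} (hf : ContMDiff (𝓡∂ 3) 𝓘(ℝ, ℝ) ∞ f) (c : ℝ) (q : M) :
    lap g (fun x => c * f x) q = c * lap g f q := by
  have hm := mem_extChartAt_target (I := 𝓡∂ 3) q
  have hD := dom_target q
  have hF := sm_target_of_contMDiff hf q
  unfold lap laplacian hessian
  simp only [Finset.mul_sum]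
  refine Finset.sum_congr rfl fun i _ => Finset.sum_congr rfl fun j _ => ?_
  rw [hD.pd_congr (fun y hy => hD.pd_const_mul c hF j hy) i hm,
    hD.pd_const_mul c (hD.sm_pd hF j) i hm,
    Finset.sum_congr rfl fun k _ => by rw [hD.pd_const_mul c hF k hm, mul_left_comm],
    ← Finset.mul_sum]
  ring

theorem gsq_const_mul {f : M → ℝ} (hf : ContMDiff (𝓡∂ 3) 𝓘(ℝ, ℝ) ∞ f) (c : ℝ) (q : M) :
    gsq g (fun x => c * f x) q = c ^ 2 * gsq g f q := by
  have hm := mem_extChartAt_target (I := 𝓡∂ 3) q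
  have hD := dom_target q
  have hF := sm_target_of_contMDiff hf q
  unfold gsq gradSq
  simp only [Finset.mul_sum]
  refine Finset.sum_congr rfl fun i _ => Finset.sum_congr rfl fun j _ => ?_
  rw [hD.pd_const_mul c hF i hm, hD.pd_const_mul c hF j hm]
  ring

theorem dd_eq_zero_of_pd {f : M → ℝ} {q : M} (hf : MDifferentiableAt (𝓡∂ 3) 𝓘(ℝ, ℝ) f q)
    (h : ∀ k, pd k (fun z => f ((extChartAt (𝓡∂ 3) q).symm z)) (extChartAt (𝓡∂ 3) q q) = 0)
    (v : TangentSpace (𝓡∂ 3) q) : dd f q v = 0 := by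
  classical
  have hqi := extChartAt_to_inv (I := 𝓡∂ 3) q
  have hd := dd_apply (mem_extChartAt_target (I := 𝓡∂ 3) q) (by rwa [hqi])
    (Function.update (fun q : M => (0 : TangentSpace (𝓡∂ 3) q)) q v)
  rw [hqi, Function.update_self] at hd
  rw [hd]
  exact Finset.sum_eq_zero fun k _ => by rw [h k, mul_zero]

theorem dd_scalarCurvature_of_static {U : Set M} (hU : IsOpen U) {f : M → ℝ}
    (hf : ContMDiffOn (𝓡∂ 3) 𝓘(ℝ, ℝ) ∞ f U)
    (h0 : ∀ q ∈ U, ∀ i j, adjointLinScal g f q i j = 0) {q : M} (hq : q ∈ U)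
    (hqi : (𝓡∂ 3).IsInteriorPoint q) (hfq : f q ≠ 0) (v : TangentSpace (𝓡∂ 3) q) :
    dd (scalarCurvature g) q v = 0 := by
  have hm := mem_chartDom (mem_extChartAt_source (I := 𝓡∂ 3) q) hq
  refine dd_eq_zero_of_pd ((contMDiff_scalarCurvature g).mdifferentiableAt (by simp)) (fun k => ?_) v
  rw [(dom_target q).pd_congr (f := fun z => scalarCurvature g ((extChartAt (𝓡∂ 3) q).symm z))
    (g := scalar (gram g q)) (fun y hy => ?_) k (mem_extChartAt_target (I := 𝓡∂ 3) q)]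
  · refine static_pd_scalar (dom_chartDom q hU) (met_chartDom g q U) (sm_chartDom hf) hm
      (extChartAt_zero_pos hqi) (adjLin_eq_zero_of_adjointLinScal g hU hf h0 q) ?_ k
    rwa [extChartAt_to_inv]
  · change scalarCurvature g ((extChartAt (𝓡∂ 3) q).symm y) = scalar (gram g q) y
    rw [scalarCurvature_eq g ((extChartAt (𝓡∂ 3) q).map_target hy),
      (extChartAt (𝓡∂ 3) q).right_inv hy]

/-- The metric `e^{-2cψ} g`. -/
def confFamily {ψ : M → ℝ} (hψ : ContMDiff (𝓡∂ 3) 𝓘(ℝ, ℝ) ∞ ψ) (c : ℝ) : RMetric M :=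
  conformal g (w := fun q => -c * ψ q) (contMDiff_const.mul hψ)

theorem scalarCurvature_confFamily {ψ : M → ℝ} (hψ : ContMDiff (𝓡∂ 3) 𝓘(ℝ, ℝ) ∞ ψ) (c : ℝ)
    (hM : NoBoundary M) (q : M) : scalarCurvature (confFamily g hψ c) q =
      Real.exp (2 * c * ψ q) *
        (scalarCurvature g q + (4 * c * lap g ψ q + (-2 * c ^ 2) * gsq g ψ q)) := by
  rw [confFamily, scalarCurvature_conformal g _ q (hM q), lap_const_mul g hψ, gsq_const_mul g hψ]
  congr 1
  · congr 1; ring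
  · ring

/-- Arranged by powers of `c`: apart from a nonvanishing exponential the dependence on `c` is cubic,
and the top coefficient involves only first derivatives of `ψ`. -/
theorem dd_scalarCurvature_confFamily {ψ : M → ℝ} (hψ : ContMDiff (𝓡∂ 3) 𝓘(ℝ, ℝ) ∞ ψ) (c : ℝ)
    (hM : NoBoundary M) (q : M) (v : TangentSpace (𝓡∂ 3) q) :
    dd (scalarCurvature (confFamily g hψ c)) q v = Real.exp (2 * c * ψ q) *
      (-4 * gsq g ψ q * dd ψ q v * c ^ 3 +
        (8 * lap g ψ q * dd ψ q v - 2 * dd (gsq g ψ) q v) * c ^ 2 +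
        (2 * scalarCurvature g q * dd ψ q v + 4 * dd (lap g ψ) q v) * c +
        dd (scalarCurvature g) q v) := by
  have hmd : ∀ {a : M → ℝ}, ContMDiff (𝓡∂ 3) 𝓘(ℝ, ℝ) ∞ a → MDifferentiableAt (𝓡∂ 3) 𝓘(ℝ, ℝ) a q :=
    fun h => h.mdifferentiableAt (by simp)
  have hR := contMDiff_scalarCurvature g
  have hL := contMDiffOn_univ.1 (contMDiffOn_lap g isOpen_univ hψ.contMDiffOn)
  have hG := contMDiffOn_univ.1 (contMDiffOn_gsq g isOpen_univ hψ.contMDiffOn)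
  have hE : ContMDiff (𝓡∂ 3) 𝓘(ℝ, ℝ) ∞ fun q => Real.exp (2 * c * ψ q) :=
    (Real.contDiff_exp.comp (contDiff_const.mul contDiff_id)).contMDiff.comp hψ
  have hL' : ContMDiff (𝓡∂ 3) 𝓘(ℝ, ℝ) ∞ fun q => 4 * c * lap g ψ q := contMDiff_const.mul hL
  have hG' : ContMDiff (𝓡∂ 3) 𝓘(ℝ, ℝ) ∞ fun q => -2 * c ^ 2 * gsq g ψ q := contMDiff_const.mul hG
  have hLG : ContMDiff (𝓡∂ 3) 𝓘(ℝ, ℝ) ∞ fun q => 4 * c * lap g ψ q + -2 * c ^ 2 * gsq g ψ q :=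
    hL'.add hG'
  have hRLG : ContMDiff (𝓡∂ 3) 𝓘(ℝ, ℝ) ∞ fun q =>
      scalarCurvature g q + (4 * c * lap g ψ q + -2 * c ^ 2 * gsq g ψ q) := hR.add hLG
  have hdE : dd (fun q => Real.exp (2 * c * ψ q)) q v =
      (Real.exp (2 * c * ψ q) * (2 * c)) * dd ψ q v := by
    refine dd_comp (hmd hψ) (φ := fun x => Real.exp (2 * c * x)) ?_ v
    have h := ((hasDerivAt_id (ψ q)).const_mul (2 * c)).exp
    rw [mul_one] at h
    exact h
  rw [show scalarCurvature (confFamily g hψ c) = _ from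
    funext fun q => scalarCurvature_confFamily g hψ c hM q,
    dd_fun_mul (hmd hE) (hmd hRLG), hdE, dd_fun_add (hmd hR) (hmd hLG),
    dd_fun_add (hmd hL') (hmd hG'), dd_const_mul (hmd hL), dd_const_mul (hmd hG)]
  ring

theorem eq_zero_of_infinite_cubic {a b c d : ℝ} {S : Set ℝ} (hS : S.Infinite)
    (h : ∀ x ∈ S, a * x ^ 3 + b * x ^ 2 + c * x + d = 0) : a = 0 := by
  have hp : Cubic.toPoly ⟨a, b, c, d⟩ = 0 := by
    refine Polynomial.eq_zero_of_infinite_isRoot _ (hS.mono fun x hx => ?_)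
    simpa [Polynomial.IsRoot, Cubic.toPoly] using h x hx
  have := congrArg (fun p => Polynomial.coeff p 3) hp
  simpa using this

/-- A counting argument. A potential for each `c` would be nonzero at some point of a fixed
countable dense set, so one point would serve infinitely many `c`, which the cubic of
`dd_scalarCurvature_confFamily` excludes. -/
theorem exists_not_isStaticOn_confFamily [SecondCountableTopology M] (hM : NoBoundary M)
    {ψ : M → ℝ} (hψ : ContMDiff (𝓡∂ 3) 𝓘(ℝ, ℝ) ∞ ψ) {U : Set M} (hU : IsOpen U)
    (hpos : ∀ q ∈ U, 0 < gsq g ψ q) :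
    ∃ c ∈ Ioc (0 : ℝ) 1, ¬ IsStaticOn (confFamily g hψ c) U := by
  by_contra! hall
  obtain ⟨D, hDc, hDd⟩ := TopologicalSpace.exists_countable_dense M
  have h1 : ∀ c : ℝ, ∃ d : M, c ∈ Ioc (0 : ℝ) 1 → d ∈ D ∧ d ∈ U ∧
      ∀ v, dd (scalarCurvature (confFamily g hψ c)) d v = 0 := by
    intro c
    by_cases hc : c ∈ Ioc (0 : ℝ) 1
    · obtain ⟨f, hf, ⟨q, hq, hfq⟩, h0⟩ := hall c hc
      have ho : IsOpen (U ∩ f ⁻¹' {0}ᶜ) :=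
        hf.continuousOn.isOpen_inter_preimage hU isOpen_compl_singleton
      obtain ⟨d, hd, hdD⟩ := hDd.inter_open_nonempty _ ho ⟨q, hq, hfq⟩
      exact ⟨d, fun _ => ⟨hdD, hd.1, fun v =>
        dd_scalarCurvature_of_static _ hU hf h0 hd.1 (hM d) hd.2 v⟩⟩
    -- For `c` outside `(0, 1]` any point will do; staticity at `c = 1` shows that one exists.
    · obtain ⟨-, -, ⟨q, -⟩, -⟩ := hall 1 ⟨one_pos, le_rfl⟩
      exact ⟨q, fun h => absurd h hc⟩
  choose d hd using h1
  -- Otherwise `(0, 1]` would be a countable union of finite sets and have measure zero.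
  obtain ⟨x, hxD, hx⟩ : ∃ x ∈ D, (Ioc (0 : ℝ) 1 ∩ d ⁻¹' {x}).Infinite := by
    by_contra! hfin
    have h2 : Ioc (0 : ℝ) 1 ⊆ ⋃ x ∈ D, Ioc (0 : ℝ) 1 ∩ d ⁻¹' {x} := fun c hc => by
      simp only [mem_iUnion]
      exact ⟨d c, (hd c hc).1, hc, rfl⟩
    have h3 : (Ioc (0 : ℝ) 1).Countable :=
      (hDc.biUnion fun x hx => (hfin x hx).countable).mono h2
    have h4 := h3.measure_zero volume
    simp at h4
  have hxU : x ∈ U := by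
    obtain ⟨c, hc, hcx⟩ := hx.nonempty
    rw [← show d c = x from hcx]
    exact (hd c hc).2.1
  have hmd : MDifferentiableAt (𝓡∂ 3) 𝓘(ℝ, ℝ) ψ x := hψ.mdifferentiableAt (by simp)
  -- In the direction `v = ∇ψ` the leading coefficient is `-4|∇ψ|⁴`, which is not zero on `U`.
  have h5 := eq_zero_of_infinite_cubic (a := -4 * gsq g ψ x * dd ψ x (grad g ψ x))
    (b := 8 * lap g ψ x * dd ψ x (grad g ψ x) - 2 * dd (gsq g ψ) x (grad g ψ x))
    (c := 2 * scalarCurvature g x * dd ψ x (grad g ψ x) + 4 * dd (lap g ψ) x (grad g ψ x))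
    (d := dd (scalarCurvature g) x (grad g ψ x)) hx fun c hc => by
      have h6 := (hd c hc.1).2.2
      rw [show d c = x from hc.2] at h6
      have h7 := h6 (grad g ψ x)
      rw [dd_scalarCurvature_confFamily g hψ c hM] at h7
      exact (mul_eq_zero.1 h7).resolve_left (Real.exp_ne_zero _)
  rw [← gsq_eq_dd g hmd] at h5
  have := hpos x hxU
  nlinarith

end

/-! ### The conformal factor -/

theorem hasDerivAt_expNegInvGlue {x : ℝ} (hx : 0 < x) :
    HasDerivAt expNegInvGlue (expNegInvGlue x / x ^ 2) x := by
  have h1 : HasDerivAt (fun y : ℝ => Real.exp (-y⁻¹)) (Real.exp (-x⁻¹) * -(-(x ^ 2)⁻¹)) x :=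
    ((hasDerivAt_inv hx.ne').fun_neg).exp
  have h2 : expNegInvGlue =ᶠ[𝓝 x] fun y : ℝ => Real.exp (-y⁻¹) := by
    filter_upwards [Ioi_mem_nhds hx] with y hy
    rw [expNegInvGlue, if_neg (not_le.2 (mem_Ioi.1 hy))]
  have h3 := h1.congr_of_eventuallyEq h2
  have h4 : expNegInvGlue x = Real.exp (-x⁻¹) := h2.self_of_nhds
  rw [neg_neg, ← h4, ← div_eq_mul_inv] at h3
  exact h3

theorem deriv_deriv_expNegInvGlue {x : ℝ} (hx : 0 < x) :
    deriv (deriv expNegInvGlue) x = expNegInvGlue x * (1 - 2 * x) / x ^ 4 := by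
  have h2 : deriv expNegInvGlue =ᶠ[𝓝 x] fun y : ℝ => expNegInvGlue y / y ^ 2 := by
    filter_upwards [Ioi_mem_nhds hx] with y hy
    exact (hasDerivAt_expNegInvGlue hy).deriv
  have h3 := (hasDerivAt_expNegInvGlue hx).fun_div (hasDerivAt_pow 2 x) (pow_ne_zero 2 hx.ne')
  rw [h2.deriv_eq, h3.deriv]
  have := hx.ne'
  field_simp
  ring

theorem deriv_expNegInvGlue_nonneg (x : ℝ) : 0 ≤ deriv expNegInvGlue x :=
  expNegInvGlue.monotone.deriv_nonneg

section

variable {M : Type u} [TopologicalSpace M] [ChartedSpace (EuclideanHalfSpace 3) M]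
  [IsManifold (𝓡∂ 3) ∞ M] (g : RMetric M)

section

variable {f : M → ℝ} (hf : ContMDiff (𝓡∂ 3) 𝓘(ℝ, ℝ) ∞ f) {φ : ℝ → ℝ} (hφ : ContDiff ℝ ∞ φ)
include hf hφ

theorem gsq_comp (q : M) : gsq g (fun x => φ (f x)) q = deriv φ (f q) ^ 2 * gsq g f q := by
  have hm := mem_extChartAt_target (I := 𝓡∂ 3) q
  have hD := dom_target q
  have hF := sm_target_of_contMDiff hf q
  have hd : ∀ x, HasDerivAt φ (deriv φ x) x := fun x =>
    (hφ.differentiable (by simp) x).hasDerivAt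
  unfold gsq gradSq
  simp only [Finset.mul_sum]
  refine Finset.sum_congr rfl fun i _ => Finset.sum_congr rfl fun j _ => ?_
  rw [hD.pd_comp_real hF (hd _) i hm, hD.pd_comp_real hF (hd _) j hm, extChartAt_to_inv]
  ring

theorem lap_comp (q : M) : lap g (fun x => φ (f x)) q =
    deriv φ (f q) * lap g f q + deriv (deriv φ) (f q) * gsq g f q := by
  have hm := mem_extChartAt_target (I := 𝓡∂ 3) q
  have hD := dom_target q
  have hF := sm_target_of_contMDiff hf q
  have hφ' : ContDiff ℝ ∞ (deriv φ) := (contDiff_infty_iff_deriv.1 hφ).2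
  have hd : ∀ x, HasDerivAt φ (deriv φ x) x := fun x =>
    (hφ.differentiable (by simp) x).hasDerivAt
  have hd' : ∀ x, HasDerivAt (deriv φ) (deriv (deriv φ) x) x := fun x =>
    (hφ'.differentiable (by simp) x).hasDerivAt
  have hF' : Sm (extChartAt (𝓡∂ 3) q).target
      (fun y => deriv φ (f ((extChartAt (𝓡∂ 3) q).symm y))) :=
    hφ'.comp_contDiffOn hF
  unfold lap gsq gradSq laplacian hessian
  simp only [Finset.mul_sum]
  rw [← Finset.sum_add_distrib]
  refine Finset.sum_congr rfl fun i _ => ?_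
  rw [← Finset.sum_add_distrib]
  refine Finset.sum_congr rfl fun j _ => ?_
  rw [hD.pd_congr (fun y hy => hD.pd_comp_real hF (hd _) j hy) i hm,
    hD.pd_mul hF' (hD.sm_pd hF j) i hm, hD.pd_comp_real hF (hd' _) i hm,
    Finset.sum_congr rfl fun k _ => by rw [hD.pd_comp_real hF (hd _) k hm, mul_left_comm],
    ← Finset.mul_sum, extChartAt_to_inv]
  ring

end

theorem unitNormal_conformal {w : M → ℝ} (hw : ContMDiff (𝓡∂ 3) 𝓘(ℝ, ℝ) ∞ w) (s : M → ℝ) (q : M) :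
    unitNormal (conformal g hw) s q = Real.exp (-w q) • unitNormal g s q := by
  have h1 : Real.exp (-(2 * w q)) = Real.exp (-w q) ^ 2 := by
    rw [← Real.exp_nat_mul]; congr 1; push_cast; ring
  have h2 := (Real.exp_pos (-w q)).ne'
  rw [unitNormal, unitNormal, gsq_conformal, grad_conformal, smul_smul, smul_smul, h1,
    Real.sqrt_mul (sq_nonneg _), Real.sqrt_sq (Real.exp_pos _).le, mul_inv]
  congr 1
  field_simp

/-- The new unit normal is `e^{-w} ν`. Its scaling contributes `-dw(ν)` and the volume form
contributes `3 dw(ν)`, which together give the factor 2. -/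
theorem div_unitNormal_conformal {w s : M → ℝ} (hw : ContMDiff (𝓡∂ 3) 𝓘(ℝ, ℝ) ∞ w)
    (hs : ContMDiff (𝓡∂ 3) 𝓘(ℝ, ℝ) ∞ s) {U : Set M} (hU : IsOpen U)
    (hpos : ∀ q ∈ U, 0 < gsq g s q) {q : M} (hq : q ∈ U) :
    div (conformal g hw) (unitNormal (conformal g hw) s) q =
      Real.exp (-w q) * (div g (unitNormal g s) q + 2 * dd w q (unitNormal g s q)) := by
  have hν := contMDiffOn_unitNormal g hU hs.contMDiffOn hpos
  have he : ContMDiff (𝓡∂ 3) 𝓘(ℝ, ℝ) ∞ fun q => Real.exp (-w q) :=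
    (Real.contDiff_exp.comp contDiff_neg).contMDiff.comp hw
  have hde : dd (fun q => Real.exp (-w q)) q (unitNormal g s q) =
      -Real.exp (-w q) * dd w q (unitNormal g s q) := by
    refine dd_comp (hw.mdifferentiableAt (by simp)) (φ := fun x => Real.exp (-x)) ?_ _
    have h := ((hasDerivAt_id (w q)).fun_neg).exp
    rw [mul_neg, mul_one] at h
    exact h
  rw [div_congr _ hU (fun q _ => unitNormal_conformal g hw s q) hq,
    div_conformal g hw hU (contMDiffOn_smul_field hU he.contMDiffOn hν) hq,
    div_smul g hU hν he.contMDiffOn hq, hde, dd_smul]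
  ring

/-- The function `e^{-1/s}`, extended by zero. -/
def bump (s : M → ℝ) (q : M) : ℝ := expNegInvGlue (s q)

theorem contMDiff_bump {s : M → ℝ} (hs : ContMDiff (𝓡∂ 3) 𝓘(ℝ, ℝ) ∞ s) :
    ContMDiff (𝓡∂ 3) 𝓘(ℝ, ℝ) ∞ (bump s) := (expNegInvGlue.contDiff (n := ⊤)).contMDiff.comp hs

/-- A point at which the conformal change by `bump s` makes the scalar curvature and the mean
curvature of the level sets of `s` positive. -/
structure GoodAt (s : M → ℝ) (q : M) : Prop where
  gsq_pos : 0 < gsq g s q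
  div_pos : 0 < div g (unitNormal g s) q - 2 * (deriv expNegInvGlue (s q) * √(gsq g s q))
  lap_pos : 0 < 2 * (1 - 2 * s q) * gsq g s q + 2 * s q ^ 2 * lap g s q -
    expNegInvGlue (s q) * gsq g s q

variable [MeasurableSpace M] [BorelSpace M] [SecondCountableTopology M] [T2Space M]

/-- `GoodAt` is the requirement for `c = 1` and implies the one for every `c` in `(0, 1]`. Thus `c`
is free to be chosen so that the metric is not static. -/
theorem exists_conformal (hM : NoBoundary M) (hR : ∀ q, 0 ≤ scalarCurvature g q) {s : M → ℝ}
    (hs : ContMDiff (𝓡∂ 3) 𝓘(ℝ, ℝ) ∞ s) {s₀ : ℝ} (hs₀ : 0 < s₀) (hlt : ∀ q, s q < s₀)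
    (hc : ∀ t < s₀, IsCompact {q | s q ≤ t}) (hgood : ∀ q, 0 ≤ s q → GoodAt g s q) :
    ∃ h : RMetric M, (∀ q, s q ≤ 0 → h.inner q = g.inner q) ∧
      (∀ q, 0 < s q → 0 < scalarCurvature h q) ∧ ¬ IsStaticOn h {q | 0 < s q} ∧
      IsStrictlyOuterMinimising h {q | s q ≤ 0} := by
  have hψ := contMDiff_bump hs
  have hU : IsOpen {q | 0 < s q} := isOpen_lt continuous_const hs.continuous
  have hgψ : ∀ q, gsq g (bump s) q = deriv expNegInvGlue (s q) ^ 2 * gsq g s q :=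
    gsq_comp g hs (expNegInvGlue.contDiff (n := ⊤))
  have hd : ∀ q, 0 < s q → deriv expNegInvGlue (s q) = expNegInvGlue (s q) / s q ^ 2 := fun q hq =>
    (hasDerivAt_expNegInvGlue hq).deriv
  obtain ⟨c, hc01, hstat⟩ := exists_not_isStaticOn_confFamily g hM hψ hU fun q hq => by
    rw [hgψ, hd q hq]
    have h1 := expNegInvGlue.pos_of_pos hq
    have h2 : 0 < s q := hq
    have h3 := (hgood q h2.le).gsq_pos
    positivity
  refine ⟨confFamily g hψ c, fun q hq => ?_, fun q hq => ?_, hstat, ?_⟩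
  · have h1 : bump s q = 0 := expNegInvGlue.zero_of_nonpos hq
    refine ContinuousLinearMap.ext fun v => ContinuousLinearMap.ext fun v' => ?_
    refine (conformal_inner g _ q v v').trans ?_
    simp [h1]
  · rw [scalarCurvature_confFamily g hψ c hM]
    refine mul_pos (Real.exp_pos _) ?_
    have hl := lap_comp g hs (expNegInvGlue.contDiff (n := ⊤)) q
    change lap g (bump s) q = _ at hl
    rw [hgψ, hl, deriv_deriv_expNegInvGlue hq, hd q hq]
    have h1 := (hgood q hq.le).lap_pos
    have h2 := (hgood q hq.le).gsq_pos
    have h3 := expNegInvGlue.pos_of_pos hq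
    have h4 := hR q
    obtain ⟨E, hE⟩ : ∃ E, E = expNegInvGlue (s q) := ⟨_, rfl⟩
    obtain ⟨G, hG⟩ : ∃ G, G = gsq g s q := ⟨_, rfl⟩
    obtain ⟨x, hx⟩ : ∃ x, x = s q := ⟨_, rfl⟩
    rw [← hE, ← hG, ← hx] at h1 ⊢
    rw [← hG] at h2
    rw [← hE] at h3
    rw [← hx] at hq
    -- After the positive factor `2cE/x⁴` is taken out, the bracket is the expression of
    -- `GoodAt.lap_pos` plus a term that is nonnegative for `c ≤ 1`.
    have e : 4 * c * (E / x ^ 2 * lap g s q + E * (1 - 2 * x) / x ^ 4 * G) +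
        -2 * c ^ 2 * ((E / x ^ 2) ^ 2 * G) = 2 * c * (E / x ^ 4) *
        ((2 * (1 - 2 * x) * G + 2 * x ^ 2 * lap g s q - E * G) + (1 - c) * (E * G)) := by
      field_simp
      ring
    rw [e]
    have h5 : 0 < 2 * c * (E / x ^ 4) := by
      have := hc01.1
      positivity
    have h6 : 0 ≤ (1 - c) * (E * G) := mul_nonneg (sub_nonneg.2 hc01.2) (by positivity)
    have := mul_pos h5 (add_pos_of_pos_of_nonneg h1 h6)
    linarith
  · refine isStrictlyOuterMinimising_sublevel _ hM hs hs₀ hlt hc (fun q hq => ?_) fun q hq => ?_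
    · rw [confFamily, gsq_conformal]
      exact mul_pos (Real.exp_pos _) (hgood q hq).gsq_pos
    · rw [confFamily, div_unitNormal_conformal g _ hs hU (fun q hq => (hgood q (le_of_lt hq)).gsq_pos)
        hq]
      refine mul_pos (Real.exp_pos _) ?_
      have hmd : MDifferentiableAt (𝓡∂ 3) 𝓘(ℝ, ℝ) s q := hs.mdifferentiableAt (by simp)
      rw [dd_const_mul (hψ.mdifferentiableAt (by simp))]
      have h1 : dd (bump s) q (unitNormal g s q) = deriv expNegInvGlue (s q) * √(gsq g s q) := by
        rw [← dd_unitNormal g hmd]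
        exact dd_comp hmd ((expNegInvGlue.contDiff (n := ⊤)).differentiable (by simp) _).hasDerivAt _
      rw [h1]
      have h2 := (hgood q hq.le).div_pos
      have h3 : 0 ≤ (1 - c) * (deriv expNegInvGlue (s q) * √(gsq g s q)) :=
        mul_nonneg (sub_nonneg.2 hc01.2) (mul_nonneg (deriv_expNegInvGlue_nonneg _)
          (Real.sqrt_nonneg _))
      nlinarith

end

/-! ### Local defining functions of embedded regions -/

section LocalDefining

variable {M : Type u} [TopologicalSpace M] [ChartedSpace (EuclideanHalfSpace 3) M]
  [IsManifold (𝓡∂ 3) ∞ M]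

theorem mem_interior_HS {y : E3} : y ∈ interior HS ↔ 0 < y 0 := by
  rw [HS, interior_range_modelWithCornersEuclideanHalfSpace]; rfl

/-- A positive boundary coordinate in a chart of the maximal atlas detects interior points. -/
theorem isInteriorPoint_of_pos {φ : OpenPartialHomeomorph M (EuclideanHalfSpace 3)}
    (hφ : φ ∈ IsManifold.maximalAtlas (𝓡∂ 3) ∞ M) {p : M} (hp : p ∈ φ.source)
    (h : 0 < (φ.extend (𝓡∂ 3) p : E3) 0) : (𝓡∂ 3).IsInteriorPoint p := by
  have h1 : ContMDiffAt (𝓡∂ 3) (𝓡∂ 3) ∞ φ.symm (φ p) :=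
    contMDiffAt_symm_of_mem_maximalAtlas hφ (φ.map_source hp)
  have h2 : ContMDiffAt (𝓡∂ 3) (𝓡∂ 3) ∞ φ p := contMDiffAt_of_mem_maximalAtlas hφ hp
  have h3 : (𝓡∂ 3).IsInteriorPoint (φ p) := by
    rw [ModelWithCorners.IsInteriorPoint]
    exact mem_interior_HS.2 h
  -- The inverse chart has surjective derivative, and such a map takes interior points to interior
  -- points.
  have h4 := (h1.mdifferentiableAt (by simp)).isInteriorPoint_of_surjective_mfderiv ?_ h3
  · rwa [φ.left_inv hp] at h4
  have h5 : MDifferentiableAt (𝓡∂ 3) (𝓡∂ 3) φ (φ.symm (φ p)) := by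
    rw [φ.left_inv hp]; exact h2.mdifferentiableAt (by simp)
  have h6 := mfderiv_comp_of_eq (x := p) (y := φ p) (h1.mdifferentiableAt (by simp))
    (h2.mdifferentiableAt (by simp)) rfl
  have h7 : mfderiv (𝓡∂ 3) (𝓡∂ 3) (φ.symm ∘ φ) p = mfderiv (𝓡∂ 3) (𝓡∂ 3) (fun x => x) p := by
    refine Filter.EventuallyEq.mfderiv_eq ?_
    filter_upwards [φ.open_source.mem_nhds hp] with x hx using φ.left_inv hx
  intro v
  refine ⟨mfderiv (𝓡∂ 3) (𝓡∂ 3) φ p v, ?_⟩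
  have h8 := h6.symm.trans (h7.trans mfderiv_id)
  exact congrArg (fun L : E3 →L[ℝ] E3 => L v) h8

theorem uniqueDiffOn_extend_target (φ : OpenPartialHomeomorph M (EuclideanHalfSpace 3)) :
    UniqueDiffOn ℝ (φ.extend (𝓡∂ 3)).target := by
  rw [OpenPartialHomeomorph.extend_target', ModelWithCorners.image_eq]
  exact (𝓡∂ 3).uniqueDiffOn_preimage φ.open_target

/-- The linear form of a function that is linear in a chart is its differential. -/
theorem exists_dd_eq {ψ : OpenPartialHomeomorph M (EuclideanHalfSpace 3)}
    (hψ : ψ ∈ IsManifold.maximalAtlas (𝓡∂ 3) ∞ M) {q : M} (hq : q ∈ ψ.source) (l : E3 →L[ℝ] ℝ)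
    (w : E3) : ∃ v : TangentSpace (𝓡∂ 3) q, dd (fun x => l (ψ.extend (𝓡∂ 3) x)) q v = l w := by
  obtain ⟨e, he⟩ : ∃ e, e = ψ.extend (𝓡∂ 3) := ⟨_, rfl⟩
  obtain ⟨f, hf⟩ : ∃ f : M → ℝ, f = fun x => l (ψ.extend (𝓡∂ 3) x) := ⟨_, rfl⟩
  have hqe : q ∈ e.source := by rw [he, OpenPartialHomeomorph.extend_source]; exact hq
  have hy : e q ∈ e.target := e.map_source hqe
  have hs : MDifferentiableWithinAt 𝓘(ℝ, E3) (𝓡∂ 3) e.symm e.target (e q) := by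
    have := contMDiffOn_extend_symm (I := 𝓡∂ 3) (n := ∞) hψ
    rw [← OpenPartialHomeomorph.extend_target', ← he] at this
    exact (this _ hy).mdifferentiableWithinAt (by simp)
  have h2 : ContMDiffOn (𝓡∂ 3) 𝓘(ℝ, E3) ∞ e ψ.source := by
    rw [he]; exact ψ.contMDiffOn_extend hψ
  have hfd : MDifferentiableAt (𝓡∂ 3) 𝓘(ℝ, ℝ) f (e.symm (e q)) := by
    rw [e.left_inv hqe, hf]
    have h3 := (h2.contMDiffAt (ψ.open_source.mem_nhds hq)).mdifferentiableAt (by simp)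
    rw [← he]
    exact (l.mdifferentiableAt (x := e q)).comp q h3
  have hu : UniqueMDiffWithinAt 𝓘(ℝ, E3) e.target (e q) := by
    rw [uniqueMDiffWithinAt_iff_uniqueDiffWithinAt, he]
    exact uniqueDiffOn_extend_target ψ _ (he ▸ hy)
  have hc := mfderiv_comp_mfderivWithin (x := e q) hfd hs hu
  have hl : mfderivWithin 𝓘(ℝ, E3) 𝓘(ℝ, ℝ) (f ∘ e.symm) e.target (e q) = l := by
    rw [mfderivWithin_eq_fderivWithin, fderivWithin_congr (f₁ := f ∘ e.symm) (f := l)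
      (fun y hy => by simp only [hf, Function.comp_apply, ← he, e.right_inv hy])
      (by simp only [hf, Function.comp_apply, ← he, e.right_inv hy]), l.fderivWithin]
    exact uniqueMDiffWithinAt_iff_uniqueDiffWithinAt.1 hu
  have h5 := hc.symm.trans hl
  have h6 := congrArg (fun L : E3 →L[ℝ] ℝ => L w) h5
  -- The vector is found in the tangent space at `e.symm (e q)`, which equals `q` only
  -- propositionally.
  have key : ∀ q' (_ : q' = q) (v : TangentSpace (𝓡∂ 3) q'), ∃ v' : TangentSpace (𝓡∂ 3) q,
      dd f q v' = dd f q' v := by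
    rintro _ rfl v; exact ⟨v, rfl⟩
  obtain ⟨v, hv⟩ := key _ (e.left_inv hqe)
    (mfderivWithin 𝓘(ℝ, E3) (𝓡∂ 3) e.symm e.target (e q) w)
  refine ⟨v, ?_⟩
  rw [← hf, hv]
  exact h6

end LocalDefining

section

variable {Ω : Type u} [TopologicalSpace Ω] [ChartedSpace (EuclideanHalfSpace 3) Ω]
  [IsManifold (𝓡∂ 3) ∞ Ω]
  {M : Type v} [TopologicalSpace M] [ChartedSpace (EuclideanHalfSpace 3) M]
  [IsManifold (𝓡∂ 3) ∞ M]

/-- The range of a smooth embedding of codimension zero has local defining functions. -/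
theorem exists_local_defining {ι : Ω → M} (hι : Manifold.IsSmoothEmbedding (𝓡∂ 3) (𝓡∂ 3) ∞ ι)
    (p : Ω) : ∃ (U : Set M) (f : M → ℝ), IsOpen U ∧ ι p ∈ U ∧
      ContMDiffOn (𝓡∂ 3) 𝓘(ℝ, ℝ) ∞ f U ∧ (∀ q ∈ U, f q ≤ 0 ↔ q ∈ range ι) ∧
      (∀ q ∈ U, ∃ v, 0 < dd f q v) ∧ (p ∈ (𝓡∂ 3).boundary Ω → f (ι p) = 0) := by
  have h := hι.isImmersion.isImmersionAt p
  obtain ⟨φ, hφ⟩ : ∃ φ, φ = h.domChart := ⟨_, rfl⟩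
  obtain ⟨ψ, hψ⟩ : ∃ ψ, ψ = h.codChart := ⟨_, rfl⟩
  have hφa := h.domChart_mem_maximalAtlas
  have hψa := h.codChart_mem_maximalAtlas
  have hpφ := h.mem_domChart_source
  have hpψ := h.mem_codChart_source
  have hsub := h.source_subset_preimage_source
  have hw := h.writtenInCharts
  rw [← hφ] at hφa hpφ hsub hw
  rw [← hψ] at hψa hpψ hsub hw
  -- Source and target have equal dimension, so the injective linear part of the local form of the
  -- immersion is an isomorphism.
  obtain ⟨L, hL⟩ : ∃ L : E3 ≃L[ℝ] E3, ∀ z, L z = h.equiv (z, 0) := by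
    refine ⟨(LinearEquiv.ofInjectiveEndo
      (h.equiv.toLinearEquiv.toLinearMap ∘ₗ LinearMap.inl ℝ E3 h.complement) ?_).toContinuousLinearEquiv,
      fun z => rfl⟩
    exact h.equiv.injective.comp LinearMap.inl_injective
  obtain ⟨φe, hφe⟩ : ∃ e, e = φ.extend (𝓡∂ 3) := ⟨_, rfl⟩
  obtain ⟨ψe, hψe⟩ : ∃ e, e = ψ.extend (𝓡∂ 3) := ⟨_, rfl⟩
  rw [← hφe, ← hψe] at hw
  have hφs : φe.source = φ.source := by rw [hφe, OpenPartialHomeomorph.extend_source]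
  have hψs : ψe.source = ψ.source := by rw [hψe, OpenPartialHomeomorph.extend_source]
  have hw1 : ∀ x ∈ φ.source, ψe (ι x) = L (φe x) := by
    intro x hx
    have := hw (φe.map_source (hφs ▸ hx))
    simp only [Function.comp_apply, φe.left_inv (hφs ▸ hx)] at this
    rw [this, hL]
  -- As `ι` is a topological embedding, inside `W` its range is only the image of the chart domain;
  -- no other part of `Ω` comes near.
  obtain ⟨W, hWo, hW⟩ := hι.isEmbedding.isOpen_iff.1 φ.open_source
  have ht : φe.target ∈ 𝓝[HS] (φe p) := by
    rw [hφe]; exact φ.extend_target_mem_nhdsWithin hpφ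
  obtain ⟨O, hO, hpO, hOs⟩ := mem_nhdsWithin.1 ht
  -- Minus the boundary coordinate of `Ω`, continued linearly across the boundary to a neighbourhood
  -- in `M`.
  obtain ⟨l, hl⟩ : ∃ l : E3 →L[ℝ] ℝ, ∀ y, l y = -(L.symm y 0) :=
    ⟨-((EuclideanSpace.proj (𝕜 := ℝ) 0).comp (L.symm : E3 →L[ℝ] E3)), fun y => rfl⟩
  have hHS : ∀ x, φe x ∈ HS := by
    intro x; rw [hφe]; exact mem_range_self _
  refine ⟨ψ.source ∩ ψe ⁻¹' (L.symm ⁻¹' O) ∩ W, fun x => l (ψe x), ?_, ⟨⟨hpψ, ?_⟩, ?_⟩, ?_, ?_, ?_, ?_⟩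
  · refine IsOpen.inter ?_ hWo
    rw [hψe]
    exact ψ.isOpen_extend_preimage (hO.preimage L.symm.continuous)
  · rw [mem_preimage, mem_preimage, hw1 p hpφ, L.symm_apply_apply]; exact hpO
  · exact (hW ▸ hpφ : p ∈ ι ⁻¹' W)
  · have := l.contMDiff.comp_contMDiffOn (ψ.contMDiffOn_extend (I := 𝓡∂ 3) (n := ∞) hψa)
    rw [← hψe] at this
    exact this.mono fun x hx => hx.1.1
  · rintro q ⟨⟨hqψ, hqO⟩, hqW⟩
    dsimp only
    rw [hl, neg_nonpos, ← mem_HS]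
    constructor
    · intro hq
      have hz := hOs ⟨hqO, hq⟩
      have hx : φe.symm (L.symm (ψe q)) ∈ φ.source := hφs ▸ φe.map_target hz
      have h1 := hw1 _ hx
      rw [φe.right_inv hz, L.apply_symm_apply] at h1
      exact ⟨_, ψe.injOn (by rw [hψs]; exact hsub hx) (by rwa [hψs]) h1⟩
    · rintro ⟨x, rfl⟩
      have hx : x ∈ φ.source := hW ▸ hqW
      rw [hw1 x hx, L.symm_apply_apply]
      exact hHS x
  · rintro q ⟨⟨hqψ, hqO⟩, hqW⟩
    obtain ⟨v, hv⟩ := exists_dd_eq hψa hqψ l (-(L (EuclideanSpace.single 0 1)))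
    refine ⟨v, ?_⟩
    rw [hψe, hv, hl]
    simp
  · intro hp
    dsimp only
    rw [hl, hw1 p hpφ, L.symm_apply_apply, neg_eq_zero]
    by_contra hne
    have h1 : 0 < (φ.extend (𝓡∂ 3) p : E3) 0 := by
      rw [← hφe]; exact lt_of_le_of_ne (mem_HS.1 (hHS p)) (Ne.symm hne)
    exact ((𝓡∂ 3).isInteriorPoint_iff_not_isBoundaryPoint p).1
      (isInteriorPoint_of_pos hφa hpφ h1) hp

end

/-! ### Global defining functions of embedded regions -/

section

variable {M : Type u} [TopologicalSpace M] [ChartedSpace (EuclideanHalfSpace 3) M]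
  [IsManifold (𝓡∂ 3) ∞ M]

/-- Curves with prescribed velocity through an interior point. -/
theorem exists_curve {x : M} (hx : (𝓡∂ 3).IsInteriorPoint x) (v : TangentSpace (𝓡∂ 3) x) :
    ∃ c : ℝ → M, c 0 = x ∧ ContinuousAt c 0 ∧ ∀ f : M → ℝ, MDifferentiableAt (𝓡∂ 3) 𝓘(ℝ, ℝ) f x →
      HasDerivAt (fun t => f (c t)) (dd f x v) 0 := by
  classical
  obtain ⟨y, hy⟩ : ∃ y : E3, y = extChartAt (𝓡∂ 3) x x := ⟨_, rfl⟩
  have hxi : (extChartAt (𝓡∂ 3) x).symm y = x := by rw [hy]; exact extChartAt_to_inv x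
  have hyt : y ∈ (extChartAt (𝓡∂ 3) x).target := by rw [hy]; exact mem_extChartAt_target x
  obtain ⟨X, hX⟩ : ∃ X, X = Function.update (fun q : M => (0 : TangentSpace (𝓡∂ 3) q)) x v :=
    ⟨_, rfl⟩
  have hXx : X x = v := by rw [hX, Function.update_self]
  obtain ⟨w, hw⟩ : ∃ w : E3, w = WithLp.toLp 2 (components X x y) := ⟨_, rfl⟩
  have hline : HasDerivAt (fun t : ℝ => y + t • w) w 0 := by
    simpa using ((hasDerivAt_id (0 : ℝ)).smul_const w).const_add y
  have hy0 : y + (0 : ℝ) • w = y := by rw [zero_smul, add_zero]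
  refine ⟨fun t => (extChartAt (𝓡∂ 3) x).symm (y + t • w), by simp only [hy0, hxi], ?_,
    fun f hf => ?_⟩
  · have h1 : ContinuousAt (extChartAt (𝓡∂ 3) x).symm (y + (0 : ℝ) • w) := by
      rw [hy0, hy]; exact continuousAt_extChartAt_symm x
    exact ContinuousAt.comp (f := fun t : ℝ => y + t • w) h1 hline.continuousAt
  · have hHS : HS ∈ 𝓝 y := by rw [hy]; exact range_mem_nhds_isInteriorPoint hx
    have h1 : DifferentiableAt ℝ (fun z => f ((extChartAt (𝓡∂ 3) x).symm z)) y := by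
      have := hf.differentiableWithinAt_writtenInExtChartAt.differentiableAt (by rw [← hy]; exact hHS)
      rw [← hy] at this
      exact this
    have h2 : dd f x v = fderiv ℝ (fun z => f ((extChartAt (𝓡∂ 3) x).symm z)) y w := by
      rw [← fderivWithin_of_mem_nhds hHS, Dom.fderivWithin_apply, hw]
      have h3 := dd_apply hyt (by rwa [hxi]) X
      rw [hxi, hXx] at h3
      exact h3
    rw [h2]
    have h4 : HasFDerivAt (fun z => f ((extChartAt (𝓡∂ 3) x).symm z))
        (fderiv ℝ (fun z => f ((extChartAt (𝓡∂ 3) x).symm z)) y) (y + (0 : ℝ) • w) := by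
      rw [hy0]; exact h1.hasFDerivAt
    exact h4.comp_hasDerivAt (0 : ℝ) hline

/-- If `h` is nonnegative on `{0 < f}` near a common zero, then `dh` is nonnegative on the vectors
on which `df` is positive. -/
theorem dd_nonneg_of_dd_pos {x : M} (hx : (𝓡∂ 3).IsInteriorPoint x) {f h : M → ℝ}
    (hf : MDifferentiableAt (𝓡∂ 3) 𝓘(ℝ, ℝ) f x) (hh : MDifferentiableAt (𝓡∂ 3) 𝓘(ℝ, ℝ) h x)
    (hf0 : f x = 0) (hh0 : h x = 0) (hfh : ∀ᶠ q in 𝓝 x, 0 < f q → 0 ≤ h q)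
    {v : TangentSpace (𝓡∂ 3) x} (hv : 0 < dd f x v) : 0 ≤ dd h x v := by
  obtain ⟨c, hc0, hc, hcd⟩ := exists_curve hx v
  have key : ∀ f : M → ℝ, MDifferentiableAt (𝓡∂ 3) 𝓘(ℝ, ℝ) f x → f x = 0 →
      Filter.Tendsto (fun t => t⁻¹ * f (c t)) (𝓝[>] 0) (𝓝 (dd f x v)) := by
    intro f hf hf0
    have := (hasDerivAt_iff_tendsto_slope.1 (hcd f hf)).mono_left
      (nhdsWithin_mono 0 (fun t (ht : 0 < t) => ht.ne'))
    refine this.congr fun t => ?_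
    simp [slope, hc0, hf0]
  have hfh' : ∀ᶠ t in 𝓝[>] (0 : ℝ), 0 < f (c t) → 0 ≤ h (c t) := by
    rw [← hc0] at hfh
    exact (hc.eventually hfh).filter_mono nhdsWithin_le_nhds
  refine ge_of_tendsto (key h hh hh0) ?_
  filter_upwards [hfh', (key f hf hf0).eventually (lt_mem_nhds hv), self_mem_nhdsWithin]
    with t h1 h2 (h3 : 0 < t)
  exact mul_nonneg (inv_pos.2 h3).le (h1 ((pos_iff_pos_of_mul_pos h2).1 (inv_pos.2 h3)))

/-- A function with non-vanishing differential at an interior zero takes positive values nearby. -/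
theorem frequently_pos_of_dd_pos {x : M} (hx : (𝓡∂ 3).IsInteriorPoint x) {f : M → ℝ}
    (hf : MDifferentiableAt (𝓡∂ 3) 𝓘(ℝ, ℝ) f x) (hf0 : f x = 0)
    {v : TangentSpace (𝓡∂ 3) x} (hv : 0 < dd f x v) : ∃ᶠ q in 𝓝 x, 0 < f q := by
  intro hcon
  have h1 : MDifferentiableAt (𝓡∂ 3) 𝓘(ℝ, ℝ) (fun q => (-1) * f q) x :=
    (((contDiff_const.mul contDiff_id).contMDiff.mdifferentiableAt (n := ∞)
      (f := fun t : ℝ => (-1) * t) (x := f x) (by simp)).comp x hf)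
  -- If `f` were nowhere positive nearby, the hypothesis on `{0 < f}` would hold vacuously for `h =
  -- -f`, and `-df(v) ≥ 0`.
  have h2 := dd_nonneg_of_dd_pos hx hf h1 hf0 (by rw [hf0, mul_zero])
    (hcon.mono fun q hq h => absurd h hq) hv
  rw [dd_const_mul hf] at h2
  linarith

/-- Local defining functions of a closed set with interior points are glued to a global one. -/
theorem exists_defining_of_local [T2Space M] [SigmaCompactSpace M] {A : Set M} (hA : IsClosed A)
    (hint : ∀ x ∈ A, (𝓡∂ 3).IsInteriorPoint x)
    (hloc : ∀ x ∈ A, ∃ (U : Set M) (f : M → ℝ), IsOpen U ∧ x ∈ U ∧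
      ContMDiffOn (𝓡∂ 3) 𝓘(ℝ, ℝ) ∞ f U ∧ (∀ q ∈ U, f q ≤ 0 ↔ q ∈ A) ∧
      (∀ q ∈ U, ∃ v, 0 < dd f q v)) :
    ∃ s : M → ℝ, ContMDiff (𝓡∂ 3) 𝓘(ℝ, ℝ) ∞ s ∧ (∀ q, s q ≤ 0 ↔ q ∈ A) ∧
      ∀ q, s q = 0 → ∃ v, 0 < dd s q v := by
  have hloc' : ∀ x : M, ∃ (U : Set M) (f : M → ℝ), IsOpen U ∧ x ∈ U ∧
      ContMDiffOn (𝓡∂ 3) 𝓘(ℝ, ℝ) ∞ f U ∧ (∀ q ∈ U, f q ≤ 0 ↔ q ∈ A) ∧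
      (∀ q ∈ U, q ∈ A → ∃ v, 0 < dd f q v) := by
    intro x
    by_cases hx : x ∈ A
    · obtain ⟨U, f, h1, h2, h3, h4, h5⟩ := hloc x hx
      exact ⟨U, f, h1, h2, h3, h4, fun q hq _ => h5 q hq⟩
    -- Away from `A` the constant 1 has the right sign; a nonzero differential is needed only at
    -- points of `A`.
    · exact ⟨Aᶜ, fun _ => 1, hA.isOpen_compl, hx, contMDiffOn_const,
        fun q hq => iff_of_false (by norm_num) hq, fun q hq hq' => absurd hq' hq⟩
  choose U f hU hxU hf hfA hfd using hloc'
  obtain ⟨ρ, hρ⟩ := SmoothPartitionOfUnity.exists_isSubordinate (𝓡∂ 3) isClosed_univ U hU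
    (fun x _ => mem_iUnion.2 ⟨x, hxU x⟩)
  have hsm := hρ.contMDiff_finsum_smul hU hf
  have hmem : ∀ i q, ρ i q ≠ 0 → q ∈ U i := fun i q hq => hρ i (subset_tsupport _ hq)
  have hfin : ∀ q, (Function.support fun i => ρ i q • f i q).Finite := fun q =>
    (ρ.locallyFinite.point_finite q).subset fun i hi => by
      rw [Function.mem_support] at hi
      exact fun h0 => hi (by rw [h0, zero_smul])
  have hneg : ∀ q ∈ A, ∀ i, ρ i q • f i q ≤ 0 := by
    intro q hq i
    by_cases h0 : ρ i q = 0
    · rw [h0, zero_smul]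
    · exact mul_nonpos_of_nonneg_of_nonpos (ρ.nonneg i q) ((hfA i q (hmem i q h0)).2 hq)
  have hpos : ∀ q ∉ A, ∀ i, ρ i q ≠ 0 → 0 < ρ i q • f i q := by
    intro q hq i h0
    exact mul_pos (lt_of_le_of_ne (ρ.nonneg i q) (Ne.symm h0))
      (not_le.1 fun h => hq ((hfA i q (hmem i q h0)).1 h))
  have hpos' : ∀ q ∉ A, ∀ i, 0 ≤ ρ i q • f i q := by
    intro q hq i
    by_cases h0 : ρ i q = 0
    · rw [h0, zero_smul]
    · exact (hpos q hq i h0).le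
  have hsA : ∀ q, ∑ᶠ i, ρ i q • f i q ≤ 0 ↔ q ∈ A := by
    intro q
    constructor
    · intro h
      by_contra hq
      obtain ⟨i, hi⟩ := ρ.exists_pos_of_mem (mem_univ q)
      exact absurd h (not_le.2 (finsum_pos (hpos' q hq) ⟨i, hpos q hq i hi.ne'⟩ (hfin q)))
    · intro hq
      have := finsum_nonneg fun i => neg_nonneg.2 (hneg q hq i)
      rw [finsum_neg_distrib] at this
      exact neg_nonneg.1 this
  refine ⟨_, hsm, hsA, fun q hq => ?_⟩
  have hqA : q ∈ A := (hsA q).1 hq.le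
  obtain ⟨i, hi⟩ := ρ.exists_pos_of_mem (mem_univ q)
  have hqU := hmem i q hi.ne'
  -- At a point of `A` all summands are nonpositive, so a vanishing sum forces each of them to
  -- vanish.
  have hfi : f i q = 0 := by
    have h1 := single_le_finsum i (f := fun i => -(ρ i q • f i q))
      ((hfin q).subset fun j hj => by
        rw [Function.mem_support] at hj ⊢
        exact neg_ne_zero.1 hj) (fun j => neg_nonneg.2 (hneg q hqA j))
    rw [finsum_neg_distrib, hq, neg_zero, neg_nonpos] at h1
    exact (mul_eq_zero.1 (le_antisymm (hneg q hqA i) h1)).resolve_left hi.ne'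
  obtain ⟨v, hv⟩ := hfd i q hqU hqA
  refine ⟨v, ?_⟩
  obtain ⟨s, hs⟩ : ∃ s : M → ℝ, s = fun x => ∑ᶠ i, ρ i x • f i x := ⟨_, rfl⟩
  rw [← hs] at hsm ⊢
  have hsd : MDifferentiableAt (𝓡∂ 3) 𝓘(ℝ, ℝ) s q := hsm.mdifferentiableAt (by simp)
  have hfd' : MDifferentiableAt (𝓡∂ 3) 𝓘(ℝ, ℝ) (f i) q :=
    ((hf i).contMDiffAt ((hU i).mem_nhds hqU)).mdifferentiableAt (by simp)
  have hρd : MDifferentiableAt (𝓡∂ 3) 𝓘(ℝ, ℝ) (ρ i) q := (ρ i).contMDiff.mdifferentiableAt (by simp)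
  have hp : MDifferentiableAt (𝓡∂ 3) 𝓘(ℝ, ℝ) (fun x => ρ i x * f i x) q := hρd.mul hfd'
  have hp' : MDifferentiableAt (𝓡∂ 3) 𝓘(ℝ, ℝ) (fun x => (-1) * (ρ i x * f i x)) q :=
    mdifferentiableAt_const.mul hp
  -- Outside `A` all summands are nonnegative, so `s ≥ ρᵢ fᵢ` there. Comparing differentials gives
  -- `ds(v) ≥ ρᵢ dfᵢ(v) > 0` without differentiating the locally finite sum.
  have h1 := dd_nonneg_of_dd_pos (hint q hqA) (h := fun x => s x + (-1) * (ρ i x * f i x)) hfd'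
    (hsd.add hp') hfi (by rw [hfi, hs]; simp only; rw [hq]; ring) ?_ hv
  · rw [dd_fun_add hsd hp', dd_const_mul hp, dd_fun_mul hρd hfd', hfi] at h1
    have := mul_pos hi hv
    linarith
  · filter_upwards [(hU i).mem_nhds hqU] with x hx h0
    have hxA : x ∉ A := fun h => absurd ((hfA i x hx).2 h) (not_le.2 h0)
    have := single_le_finsum i (hfin x) (hpos' x hxA)
    rw [hs]
    simp only [smul_eq_mul] at this ⊢
    linarith

end

section

variable {Ω : Type u} [TopologicalSpace Ω] [ChartedSpace (EuclideanHalfSpace 3) Ω]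
  [IsManifold (𝓡∂ 3) ∞ Ω]
  {M : Type v} [TopologicalSpace M] [ChartedSpace (EuclideanHalfSpace 3) M]
  [IsManifold (𝓡∂ 3) ∞ M] {γ : RMetric Ω} {g : RMetric M} {ι : Ω → M}

theorem dd_comp_map {s : M → ℝ} {p : Ω} (hs : MDifferentiableAt (𝓡∂ 3) 𝓘(ℝ, ℝ) s (ι p))
    (hι : MDifferentiableAt (𝓡∂ 3) (𝓡∂ 3) ι p) (v : TangentSpace (𝓡∂ 3) p) :
    dd (fun x => s (ι x)) p v = dd s (ι p) (mfderiv (𝓡∂ 3) (𝓡∂ 3) ι p v) :=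
  congrArg (fun L : E3 →L[ℝ] ℝ => L v) (mfderiv_comp p hs hι)

theorem IsoMap.mfderiv_injective (H : IsoMap γ g ι) (p : Ω) :
    Function.Injective (mfderiv (𝓡∂ 3) (𝓡∂ 3) ι p) := by
  rw [injective_iff_map_eq_zero]
  intro v hv
  by_contra hne
  have h1 := γ.pos p v hne
  rw [← H.isometric p v v, hv] at h1
  simp at h1

theorem IsoMap.mfderiv_surjective (H : IsoMap γ g ι) (p : Ω) :
    Function.Surjective (mfderiv (𝓡∂ 3) (𝓡∂ 3) ι p) :=
  (LinearMap.injective_iff_surjective (f := (show E3 →L[ℝ] E3 from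
    mfderiv (𝓡∂ 3) (𝓡∂ 3) ι p).toLinearMap)).1 (H.mfderiv_injective p)

theorem IsoMap.isInteriorPoint (H : IsoMap γ g ι) {p : Ω} (hp : (𝓡∂ 3).IsInteriorPoint p) :
    (𝓡∂ 3).IsInteriorPoint (ι p) :=
  ((H.smooth p).mdifferentiableAt (by simp)).isInteriorPoint_of_surjective_mfderiv
    (H.mfderiv_surjective p) hp

theorem not_mem_boundary_of_distToBoundary_pos {A : Set M} (h : 0 < distToBoundary g A) {x : M}
    (hx : x ∈ A) : x ∉ (𝓡∂ 3).boundary M := by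
  intro hb
  refine h.not_ge ?_
  refine (iInf₂_le x hx).trans ((iInf₂_le x hb).trans ?_)
  let _ : Bundle.RiemannianBundle (fun x : M => TangentSpace (𝓡∂ 3) x) := ⟨g.toRiemannianMetric⟩
  exact (Manifold.riemannianEDist_self (I := 𝓡∂ 3) (x := x)).le

/-- A smooth defining function of the image of `Ω`, with zero set the image of `∂Ω`. -/
theorem exists_defining [CompactSpace Ω] [T2Space M] [SigmaCompactSpace M]
    (hι : IsIsometricEmbedding γ g ι)
    (hdist : 0 < distToBoundary g (ι '' (𝓡∂ 3).boundary Ω)) :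
    ∃ s : M → ℝ, ContMDiff (𝓡∂ 3) 𝓘(ℝ, ℝ) ∞ s ∧ (∀ q, s q ≤ 0 ↔ q ∈ range ι) ∧
      (∀ q, s q = 0 → ∃ v, 0 < dd s q v) ∧
      (∀ p, s (ι p) = 0 ↔ p ∈ (𝓡∂ 3).boundary Ω) ∧ (∀ p, (𝓡∂ 3).IsInteriorPoint (ι p)) := by
  have hint : ∀ p, (𝓡∂ 3).IsInteriorPoint (ι p) := by
    intro p
    rcases (𝓡∂ 3).isInteriorPoint_or_isBoundaryPoint p with hp | hp
    · exact hι.isoMap.isInteriorPoint hp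
    · exact ((𝓡∂ 3).isInteriorPoint_iff_not_isBoundaryPoint _).2
        (not_mem_boundary_of_distToBoundary_pos hdist (mem_image_of_mem ι hp))
  have hl := exists_local_defining hι.isSmoothEmbedding
  obtain ⟨s, hs, hsA, hsd⟩ := exists_defining_of_local (A := range ι)
    (isCompact_range hι.isSmoothEmbedding.isEmbedding.continuous).isClosed
    (by rintro _ ⟨p, rfl⟩; exact hint p)
    (by rintro _ ⟨p, rfl⟩
        obtain ⟨U, f, h1, h2, h3, h4, h5, -⟩ := hl p
        exact ⟨U, f, h1, h2, h3, h4, h5⟩)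
  refine ⟨s, hs, hsA, hsd, fun p => ⟨fun h0 => ?_, fun hp => ?_⟩, hint⟩
  -- At an interior point of `Ω` the function `s ∘ ι`, which is nowhere positive, would have a zero
  -- with nonvanishing differential.
  · by_contra hp
    have hpi := ((𝓡∂ 3).isInteriorPoint_iff_not_isBoundaryPoint p).2 hp
    have hιd := (hι.isoMap.smooth p).mdifferentiableAt (by simp)
    have hsd' := hs.mdifferentiableAt (x := ι p) (by simp)
    obtain ⟨v, hv⟩ := hsd _ h0
    obtain ⟨w, rfl⟩ := hι.isoMap.mfderiv_surjective p v
    rw [← dd_comp_map hsd' hιd] at hv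
    obtain ⟨q, hq⟩ := (frequently_pos_of_dd_pos hpi (hsd'.comp p hιd) h0 hv).exists
    exact absurd ((hsA _).2 (mem_range_self q)) (not_le.2 hq)
  · refine le_antisymm ((hsA _).2 (mem_range_self p)) (not_lt.1 fun hlt => ?_)
    -- If `s < 0` at the image of a boundary point, a whole neighbourhood lies in the range; but a
    -- local defining function vanishes at that point with nonzero differential and takes positive
    -- values nearby.
    obtain ⟨U, f, hU, hpU, hf, hfA, hfd, hfb⟩ := hl p
    obtain ⟨v, hv⟩ := hfd _ hpU
    refine frequently_pos_of_dd_pos (hint p)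
      ((hf.contMDiffAt (hU.mem_nhds hpU)).mdifferentiableAt (by simp)) (hfb hp) hv ?_
    filter_upwards [hU.mem_nhds hpU, hs.continuous.continuousAt.eventually (gt_mem_nhds hlt)]
      with q hq hq' hpos
    exact absurd ((hfA q hq).2 ((hsA q).1 hq'.le)) (not_le.2 hpos)

end

/-! ### The mean curvature as the divergence of a unit normal field -/

section
variable {D : Set E3} {G : E3 → Matrix (Fin 3) (Fin 3) ℝ}

theorem Dom.hasDerivWithinAt_line (hD : Dom D) {f : E3 → ℝ} (hf : Sm D f) (i : Fin 3) {y : E3}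
    (hy : y ∈ D) {T : Set ℝ} (hT : ∀ t ∈ T, y + t • (EuclideanSpace.single i (1 : ℝ) : E3) ∈ HS) :
    HasDerivWithinAt (fun t : ℝ => f (y + t • (EuclideanSpace.single i (1 : ℝ) : E3))) (pd i f y)
      T 0 ∧ ∀ᶠ t in 𝓝[T] (0 : ℝ), y + t • (EuclideanSpace.single i (1 : ℝ) : E3) ∈ D := by
  obtain ⟨e, he⟩ : ∃ e : E3, e = EuclideanSpace.single i (1 : ℝ) := ⟨_, rfl⟩
  rw [← he] at hT ⊢
  have h0 : y + (0 : ℝ) • e = y := by rw [zero_smul, add_zero]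
  have hline : HasDerivAt (fun t : ℝ => y + t • e) e 0 := by
    simpa using ((hasDerivAt_id (0 : ℝ)).smul_const e).const_add y
  have hev : ∀ᶠ t in 𝓝[T] (0 : ℝ), y + t • e ∈ D := by
    obtain ⟨O, hO, rfl⟩ := hD
    have h1 : ∀ᶠ z in 𝓝 (y + (0 : ℝ) • e), z ∈ O := by rw [h0]; exact hO.mem_nhds hy.2
    filter_upwards [(hline.continuousAt.eventually h1).filter_mono nhdsWithin_le_nhds,
      self_mem_nhdsWithin] with t h2 h3
    exact ⟨hT t h3, h2⟩
  refine ⟨?_, hev⟩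
  have h2 : HasFDerivWithinAt f (fderivWithin ℝ f D y) D (y + (0 : ℝ) • e) := by
    rw [h0]; exact (hf.differentiableOn (by simp) y hy).hasFDerivWithinAt
  have h3 : HasDerivWithinAt (fun t : ℝ => f (y + t • e)) (fderivWithin ℝ f D y e)
      {t | y + t • e ∈ D} 0 :=
    h2.comp_hasDerivWithinAt (0 : ℝ) (hline.hasDerivWithinAt (s := {t | y + t • e ∈ D}))
      fun t ht => ht
  rw [hD.pd_eq i hy, ← he]
  have h4 : {t | y + t • e ∈ D} ∈ 𝓝[T] (0 : ℝ) := hev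
  exact h3.mono_of_mem_nhdsWithin h4

/-- Tangential derivatives vanish where a function vanishes on the boundary of the half-space. -/
theorem Dom.pd_eq_zero_of_boundary (hD : Dom D) {f : E3 → ℝ} (hf : Sm D f)
    (h0 : ∀ z ∈ D, z 0 = 0 → f z = 0) {y : E3} (hy : y ∈ D) (hy0 : y 0 = 0) {i : Fin 3}
    (hi : i ≠ 0) : pd i f y = 0 := by
  have hz : ∀ t : ℝ, (y + t • (EuclideanSpace.single i (1 : ℝ) : E3)) 0 = 0 := by
    intro t
    simp [hy0, Ne.symm hi]
  obtain ⟨h1, h2⟩ := hD.hasDerivWithinAt_line hf i hy (T := univ) fun t _ => mem_HS.2 (hz t).ge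
  rw [hasDerivWithinAt_univ] at h1
  rw [nhdsWithin_univ] at h2
  have h3 := h1.congr_of_eventuallyEq (f₁ := fun _ => (0 : ℝ))
    (h2.mono fun t ht => (h0 _ ht (hz t)).symm)
  exact h3.unique (hasDerivAt_const 0 0)

/-- The inner derivative is nonpositive at a zero maximum on the boundary of the half-space. -/
theorem Dom.pd_zero_nonpos (hD : Dom D) {f : E3 → ℝ} (hf : Sm D f) (h0 : ∀ z ∈ D, f z ≤ 0) {y : E3}
    (hy : y ∈ D) (hfy : f y = 0) : pd 0 f y ≤ 0 := by
  obtain ⟨h1, h2⟩ := hD.hasDerivWithinAt_line hf 0 hy (T := Ioi 0) fun t (ht : 0 < t) => by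
    rw [mem_HS]
    have := mem_HS.1 (hD.sub hy)
    simp; linarith
  rw [hasDerivWithinAt_iff_tendsto_slope' (by simp)] at h1
  refine le_of_tendsto h1 ?_
  filter_upwards [h2, self_mem_nhdsWithin] with t h3 (h4 : 0 < t)
  simp only [slope, zero_smul, add_zero, hfy, vsub_eq_sub, sub_zero, smul_eq_mul]
  exact mul_nonpos_of_nonneg_of_nonpos (inv_pos.2 h4).le (h0 _ h3)

/-- The squared length of a covector. -/
def normSq (G : E3 → Matrix (Fin 3) (Fin 3) ℝ) (w : Fin 3 → ℝ) (y : E3) : ℝ :=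
  ∑ i, ∑ j, (G y)⁻¹ i j * (w i * w j)

/-- The unit vector dual to a covector. -/
def covNormal (G : E3 → Matrix (Fin 3) (Fin 3) ℝ) (w : Fin 3 → ℝ) (y : E3) (k : Fin 3) : ℝ :=
  (√(normSq G w y))⁻¹ * ∑ l, (G y)⁻¹ k l * w l

theorem lower_covNormal (h : Met D G) (w : Fin 3 → ℝ) {y : E3} (hy : y ∈ D) (i : Fin 3) :
    ∑ j, G y i j * covNormal G w y j = (√(normSq G w y))⁻¹ * w i := by
  have h1 : ∑ j, G y i j * covNormal G w y j =
      (√(normSq G w y))⁻¹ * ∑ l, (∑ j, G y i j * (G y)⁻¹ j l) * w l := by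
    simp only [covNormal, Fin.sum_univ_three]; ring
  rw [h1]
  simp only [h.sum_mul_inv hy, ite_mul, one_mul, zero_mul, Finset.sum_ite_eq, Finset.mem_univ,
    if_true]

theorem covNormal_unit (h : Met D G) (w : Fin 3 → ℝ) {y : E3} (hy : y ∈ D)
    (hw : 0 < normSq G w y) :
    ∑ i, (∑ j, G y i j * covNormal G w y j) * covNormal G w y i = 1 := by
  simp only [lower_covNormal h w hy]
  have h1 : ∑ i, (√(normSq G w y))⁻¹ * w i * covNormal G w y i =
      (√(normSq G w y))⁻¹ * (√(normSq G w y))⁻¹ * normSq G w y := by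
    obtain ⟨c, hc⟩ : ∃ c, c = (√(normSq G w y))⁻¹ := ⟨_, rfl⟩
    simp only [covNormal, ← hc]
    simp only [normSq, Fin.sum_univ_three]; ring
  rw [h1, ← mul_inv, Real.mul_self_sqrt hw.le, inv_mul_cancel₀ hw.ne']

theorem covNormal_smul (G : E3 → Matrix (Fin 3) (Fin 3) ℝ) (w : Fin 3 → ℝ) (y : E3) {c : ℝ}
    (hc : 0 < c) (k : Fin 3) : covNormal G (fun i => c * w i) y k = covNormal G w y k := by
  have h1 : normSq G (fun i => c * w i) y = c ^ 2 * normSq G w y := by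
    simp only [normSq, Fin.sum_univ_three]; ring
  have h2 : ∑ l, (G y)⁻¹ k l * (c * w l) = c * ∑ l, (G y)⁻¹ k l * w l := by
    simp only [Fin.sum_univ_three]; ring
  rw [covNormal, covNormal, h1, h2, Real.sqrt_mul (sq_nonneg c), Real.sqrt_sq hc.le, mul_inv]
  field_simp

/-- The covector `-dx⁰`. -/
def inwardCovector (i : Fin 3) : ℝ := if i = 0 then -1 else 0

theorem outwardNormal_eq (G : E3 → Matrix (Fin 3) (Fin 3) ℝ) (y : E3) (k : Fin 3) :
    outwardNormal G y k = covNormal G inwardCovector y k := by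
  rw [outwardNormal, covNormal, show normSq G inwardCovector y = (G y)⁻¹ 0 0 by
    simp [normSq, inwardCovector]]
  simp [inwardCovector, div_eq_inv_mul]

theorem normSq_inwardCovector (h : Met D G) {y : E3} (hy : y ∈ D) :
    0 < normSq G inwardCovector y := by
  rw [show normSq G inwardCovector y = (G y)⁻¹ 0 0 by
    simp [normSq, inwardCovector]]
  exact (h.pos y hy).inv.diag_pos

theorem sm_covNormal (h : Met D G) {w : E3 → Fin 3 → ℝ} (hw : ∀ i, Sm D (fun z => w z i))
    (hpos : ∀ z ∈ D, 0 < normSq G (w z) z) (k : Fin 3) :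
    Sm D (fun z => covNormal G (w z) z k) := by
  have h1 : Sm D (fun z => normSq G (w z) z) := ContDiffOn.sum fun i _ => ContDiffOn.sum fun j _ =>
    (h.sm_inv i j).mul ((hw i).mul (hw j))
  refine ((h1.sqrt fun z hz => (hpos z hz).ne').inv
    fun z hz => (Real.sqrt_pos.2 (hpos z hz)).ne').mul ?_
  exact ContDiffOn.sum fun l _ => (h.sm_inv k l).mul (hw l)

/-- Unit fields that agree with the outward unit normal on the boundary have its divergence. -/
theorem divergence_eq_of_boundary (hD : Dom D) (h : Met D G) {X N : E3 → Fin 3 → ℝ}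
    (hX : ∀ k, Sm D (fun z => X z k)) (hN : ∀ k, Sm D (fun z => N z k))
    (hX1 : ∀ z ∈ D, ∑ i, (∑ j, G z i j * X z j) * X z i = 1)
    (hN1 : ∀ z ∈ D, ∑ i, (∑ j, G z i j * N z j) * N z i = 1)
    (hXN : ∀ z ∈ D, z 0 = 0 → ∀ k, X z k = N z k) {y : E3} (hy : y ∈ D) (hy0 : y 0 = 0) {a : ℝ}
    (ha : a ≠ 0) (hNa : ∀ i, ∑ j, G y i j * N y j = if i = 0 then a else 0) :
    divergence G X y = divergence G N y := by
  have hδ : ∀ k, Sm D (fun z => X z k - N z k) := fun k => (hX k).sub (hN k)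
  have ht : ∀ k i, i ≠ 0 → pd i (fun z => X z k - N z k) y = 0 := fun k i hi =>
    hD.pd_eq_zero_of_boundary (hδ k) (fun z hz hz0 => by rw [hXN z hz hz0, sub_self]) hy hy0 hi
  have hδy : ∀ k, X y k - N y k = 0 := fun k => by rw [hXN y hy hy0, sub_self]
  have hW : ∀ i, Sm D (fun z => ∑ j, G z i j * (X z j + N z j)) := fun i =>
    ContDiffOn.sum fun j _ => (h.sm i j).mul ((hX j).add (hN j))
  -- The product is `|X|² - |N|² = 0`. On the boundary `X - N = 0` and `X + N = 2N` is conormal to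
  -- it, so the derivative of the product leaves only `∂₀(X⁰ - N⁰)`, the one normal derivative that
  -- the divergence contains.
  have hQ : pd 0 (fun z => ∑ i, (X z i - N z i) * ∑ j, G z i j * (X z j + N z j)) y = 0 := by
    rw [hD.pd_congr (g := fun _ => (0 : ℝ)) (fun z hz => ?_) 0 hy, Dom.pd_const]
    have h1 := hX1 z hz
    have h2 := hN1 z hz
    have s1 := h.symm hz 0 1
    have s2 := h.symm hz 0 2
    have s3 := h.symm hz 1 2
    simp only [Fin.sum_univ_three] at h1 h2 ⊢
    rw [s1, s2, s3] at *
    linear_combination h1 - h2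
  rw [hD.pd_sum Finset.univ (fun i _ => (hδ i).mul (hW i)) 0 hy] at hQ
  simp only [hD.pd_mul (hδ _) (hW _) 0 hy, hδy, zero_mul, add_zero] at hQ
  have hWy : ∀ i, ∑ j, G y i j * (X y j + N y j) = if i = 0 then 2 * a else 0 := by
    intro i
    have h1 : ∑ j, G y i j * (X y j + N y j) = 2 * ∑ j, G y i j * N y j := by
      simp only [hXN y hy hy0, Finset.mul_sum]
      exact Finset.sum_congr rfl fun j _ => by ring
    rw [h1, hNa]
    split_ifs <;> ring
  simp only [hWy, mul_ite, mul_zero, Finset.sum_ite_eq', Finset.mem_univ, if_true] at hQ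
  have h00 : pd 0 (fun z => X z 0 - N z 0) y = 0 :=
    (mul_eq_zero.1 hQ).resolve_right (mul_ne_zero two_ne_zero ha)
  have hall : ∀ k, pd k (fun z => X z k) y = pd k (fun z => N z k) y := by
    intro k
    rw [← sub_eq_zero, ← hD.pd_sub (hX k) (hN k) k hy]
    by_cases hk : k = 0
    · rw [hk]; exact h00
    · exact ht k k hk
  rw [Bartnik.divergence_eq hD h hX hy, Bartnik.divergence_eq hD h hN hy]
  simp only [hall, hXN y hy hy0]

end

section
variable {M : Type u} [TopologicalSpace M] [ChartedSpace (EuclideanHalfSpace 3) M]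
  [IsManifold (𝓡∂ 3) ∞ M] (g : RMetric M)

theorem symm_mem_boundary {p : M} {z : E3} (hz : z ∈ (extChartAt (𝓡∂ 3) p).target) (h0 : z 0 = 0) :
    (extChartAt (𝓡∂ 3) p).symm z ∈ (𝓡∂ 3).boundary M := by
  by_contra hcon
  have h1 := ((𝓡∂ 3).isInteriorPoint_iff_not_isBoundaryPoint _).2 hcon
  rw [(𝓡∂ 3).isInteriorPoint_iff_of_mem_atlas (n := ∞) (by simp)
    (chart_mem_atlas (EuclideanHalfSpace 3) p) (mapsTo_symm_target p hz)] at h1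
  have h2 := interior_mono (target_subset_HS p) h1
  rw [mem_interior_HS] at h2
  have h3 : (extChartAt (𝓡∂ 3) p) ((extChartAt (𝓡∂ 3) p).symm z) = z :=
    (extChartAt (𝓡∂ 3) p).right_inv hz
  have h4 : 0 < (extChartAt (𝓡∂ 3) p ((extChartAt (𝓡∂ 3) p).symm z)) 0 := h2
  rw [h3, h0] at h4
  exact lt_irrefl _ h4

theorem extChartAt_zero_of_boundary {p : M} (hp : p ∈ (𝓡∂ 3).boundary M) :
    extChartAt (𝓡∂ 3) p p 0 = 0 := by
  have h1 := mem_HS.1 (target_subset_HS p (mem_extChartAt_target (I := 𝓡∂ 3) p))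
  by_contra hne
  have h2 : (𝓡∂ 3).IsInteriorPoint p := mem_interior_HS.2 (lt_of_le_of_ne h1 (Ne.symm hne))
  exact ((𝓡∂ 3).isInteriorPoint_iff_not_isBoundaryPoint _).1 h2 hp

/-- The two unit fields come from different level sets, those of `σ` and those of the boundary
coordinate, and agree only on the boundary. By `divergence_eq_of_boundary` this is enough. -/
theorem meanCurvature_eq_div {σ : M → ℝ} (hσ : ContMDiff (𝓡∂ 3) 𝓘(ℝ, ℝ) ∞ σ)
    (hσ0 : ∀ q, σ q ≤ 0) (hσb : ∀ q ∈ (𝓡∂ 3).boundary M, σ q = 0) {p : M}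
    (hp : p ∈ (𝓡∂ 3).boundary M) (hpos : 0 < gsq g σ p) :
    meanCurvature g p = div g (unitNormal g σ) p := by
  have hU : IsOpen {q | 0 < gsq g σ q} :=
    isOpen_lt continuous_const
      (contMDiffOn_univ.1 (contMDiffOn_gsq g isOpen_univ hσ.contMDiffOn)).continuous
  obtain ⟨D, hDe⟩ : ∃ D, D = chartDom p {q | 0 < gsq g σ q} := ⟨_, rfl⟩
  have hD : Dom D := hDe ▸ dom_chartDom p hU
  have hm : Met D (gram g p) := hDe ▸ met_chartDom g p _
  have hDt : D ⊆ (extChartAt (𝓡∂ 3) p).target := by rw [hDe]; exact inter_subset_left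
  obtain ⟨F, hF⟩ : ∃ F : E3 → ℝ, F = fun z => σ ((extChartAt (𝓡∂ 3) p).symm z) := ⟨_, rfl⟩
  have hFs : Sm D F := by rw [hDe, hF]; exact sm_chartDom hσ.contMDiffOn
  have hy : extChartAt (𝓡∂ 3) p p ∈ D := by
    rw [hDe]; exact mem_chartDom (mem_extChartAt_source p) hpos
  have hn : ∀ z ∈ D, normSq (gram g p) (fun l => pd l F z) z =
      gsq g σ ((extChartAt (𝓡∂ 3) p).symm z) := by
    intro z hz
    rw [gsq_eq g isOpen_univ hσ.contMDiffOn ((extChartAt (𝓡∂ 3) p).map_target (hDt hz)) (mem_univ _),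
      (extChartAt (𝓡∂ 3) p).right_inv (hDt hz), ← hF]
    rfl
  have hnp : ∀ z ∈ D, 0 < normSq (gram g p) (fun l => pd l F z) z := by
    intro z hz
    rw [hn z hz]
    rw [hDe] at hz
    exact hz.2
  have hX : ∀ z ∈ D, ∀ k, components (unitNormal g σ) p z k =
      covNormal (gram g p) (fun l => pd l F z) z k := by
    intro z hz k
    have h1 := components_smul (fun q => (√(gsq g σ q))⁻¹) (grad g σ) p z k
    rw [components_grad g (hDt hz) (hσ.mdifferentiableAt (by simp)), ← hn z hz, ← hF] at h1
    exact h1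
  have hb : ∀ z ∈ D, z 0 = 0 → F z = 0 := by
    intro z hz hz0
    rw [hF]
    exact hσb _ (symm_mem_boundary (hDt hz) hz0)
  have hcov : ∀ z ∈ D, z 0 = 0 → ∀ k, covNormal (gram g p) (fun l => pd l F z) z k =
      outwardNormal (gram g p) z k := by
    intro z hz hz0 k
    have h1 : pd 1 F z = 0 := hD.pd_eq_zero_of_boundary hFs hb hz hz0 (by decide)
    have h2 : pd 2 F z = 0 := hD.pd_eq_zero_of_boundary hFs hb hz hz0 (by decide)
    have h3 : pd 0 F z ≤ 0 :=
      hD.pd_zero_nonpos hFs (fun z _ => by rw [hF]; exact hσ0 _) hz (hb z hz hz0)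
    -- On the boundary `dσ` is a positive multiple of `-dx⁰`: its tangential part vanishes, `σ ≤ 0`
    -- gives the sign, and `|∇σ| > 0` excludes zero.
    have h4 : 0 < -pd 0 F z := by
      refine lt_of_le_of_ne (neg_nonneg.2 h3) fun h5 => (hnp z hz).ne' ?_
      rw [eq_comm, neg_eq_zero] at h5
      simp [normSq, Fin.sum_univ_three, h1, h2, h5]
    rw [outwardNormal_eq, ← covNormal_smul _ inwardCovector _ h4]
    congr 1
    funext l
    fin_cases l <;> simp [inwardCovector, h1, h2]
  have hsmc := sm_covNormal hm (w := fun z l => pd l F z) (fun i => hD.sm_pd hFs i) hnp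
  have hsmo : ∀ k, Sm D (fun z => outwardNormal (gram g p) z k) := fun k =>
    (sm_covNormal hm (w := fun _ => inwardCovector) (fun i => contDiffOn_const)
      (fun z hz => normSq_inwardCovector hm hz) k).congr fun z _ => outwardNormal_eq _ _ _
  have hsq := Real.sqrt_pos.2 (normSq_inwardCovector hm hy)
  rw [meanCurvature, div]
  symm
  refine divergence_eq_of_boundary hD hm (a := -(√(normSq (gram g p) inwardCovector
    (extChartAt (𝓡∂ 3) p p)))⁻¹) (fun k => (hsmc k).congr fun z hz => hX z hz k) hsmo
    (fun z hz => ?_) (fun z hz => ?_)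
    (fun z hz hz0 k => by rw [hX z hz k, hcov z hz hz0 k]) hy (extChartAt_zero_of_boundary hp)
    (neg_ne_zero.2 (inv_ne_zero hsq.ne')) (fun i => ?_)
  · simp only [hX z hz]
    exact covNormal_unit hm _ hz (hnp z hz)
  · simp only [outwardNormal_eq]
    exact covNormal_unit hm _ hz (normSq_inwardCovector hm hz)
  · simp only [outwardNormal_eq]
    rw [lower_covNormal hm _ hy, inwardCovector]
    split_ifs <;> ring

end

/-! ### Level-set geometry under isometric maps -/

section

variable {Ω : Type u} [TopologicalSpace Ω] [ChartedSpace (EuclideanHalfSpace 3) Ω]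
  [IsManifold (𝓡∂ 3) ∞ Ω]
  {M : Type v} [TopologicalSpace M] [ChartedSpace (EuclideanHalfSpace 3) M]
  [IsManifold (𝓡∂ 3) ∞ M] {γ : RMetric Ω} {g : RMetric M} {ι : Ω → M}

theorem IsoMap.scalarCurvature_eq (H : IsoMap γ g ι) (q : Ω) :
    scalarCurvature γ q = scalarCurvature g (ι q) :=
  H.scalar_eq (mem_extChartAt_source q) (mem_extChartAt_source (ι q))

theorem IsoMap.gsq_eq (H : IsoMap γ g ι) {s : M → ℝ} (hs : ContMDiff (𝓡∂ 3) 𝓘(ℝ, ℝ) ∞ s) (q : Ω) :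
    gsq γ (fun x => s (ι x)) q = gsq g s (ι q) :=
  H.gradSq_eq isOpen_univ hs.contMDiffOn (mem_extChartAt_source q) (mem_extChartAt_source (ι q))
    (mem_univ _)

theorem IsoMap.lap_eq (H : IsoMap γ g ι) {s : M → ℝ} (hs : ContMDiff (𝓡∂ 3) 𝓘(ℝ, ℝ) ∞ s) (q : Ω) :
    lap γ (fun x => s (ι x)) q = lap g s (ι q) :=
  H.laplacian_eq isOpen_univ hs.contMDiffOn (mem_extChartAt_source q) (mem_extChartAt_source (ι q))
    (mem_univ _)

theorem IsoMap.mfderiv_unitNormal (H : IsoMap γ g ι) {s : M → ℝ}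
    (hs : ContMDiff (𝓡∂ 3) 𝓘(ℝ, ℝ) ∞ s) (q : Ω) :
    mfderiv (𝓡∂ 3) (𝓡∂ 3) ι q (unitNormal γ (fun x => s (ι x)) q) = unitNormal g s (ι q) := by
  have h1 : mfderiv (𝓡∂ 3) (𝓡∂ 3) ι q (grad γ (fun x => s (ι x)) q) = grad g s (ι q) := by
    refine eq_of_inner g fun w => ?_
    obtain ⟨w, rfl⟩ := H.mfderiv_surjective q w
    rw [H.isometric, inner_grad, inner_grad, dd_comp_map (hs.mdifferentiableAt (by simp))
      ((H.smooth q).mdifferentiableAt (by simp))]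
  rw [unitNormal, unitNormal, H.gsq_eq hs, ← h1]
  exact map_smul (mfderiv (𝓡∂ 3) (𝓡∂ 3) ι q) _ _

theorem IsoMap.div_unitNormal (H : IsoMap γ g ι) {s : M → ℝ}
    (hs : ContMDiff (𝓡∂ 3) 𝓘(ℝ, ℝ) ∞ s) {q : Ω} (hpos : 0 < gsq g s (ι q)) :
    div γ (unitNormal γ (fun x => s (ι x))) q = div g (unitNormal g s) (ι q) := by
  have hU : IsOpen {q | 0 < gsq g s q} := isOpen_lt continuous_const
      (contMDiffOn_univ.1 (contMDiffOn_gsq g isOpen_univ hs.contMDiffOn)).continuous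
  refine H.divergence_eq hU ?_ (contMDiffOn_unitNormal g hU hs.contMDiffOn fun _ h => h)
    (fun q _ => H.mfderiv_unitNormal hs q) (mem_extChartAt_source q) (mem_extChartAt_source (ι q))
    hpos
  refine contMDiffOn_unitNormal γ (hU.preimage H.smooth.continuous)
    (hs.comp H.smooth).contMDiffOn fun q hq => ?_
  rw [H.gsq_eq hs]
  exact hq

end

/-! ### Open submanifolds -/

section

variable {M : Type v} [TopologicalSpace M] [ChartedSpace (EuclideanHalfSpace 3) M]
  [IsManifold (𝓡∂ 3) ∞ M]

theorem subtypeRestr_mem_maximalAtlas {H : Type*} [TopologicalSpace H] {M : Type*}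
    [TopologicalSpace M] [ChartedSpace H M] {G : StructureGroupoid H} [HasGroupoid M G]
    [ClosedUnderRestriction G] {e : OpenPartialHomeomorph M H} (he : e ∈ G.maximalAtlas M)
    {s : TopologicalSpace.Opens M} (hs : Nonempty s) : e.subtypeRestr hs ∈ G.maximalAtlas s := by
  have key : ∀ {e e' : OpenPartialHomeomorph M H}, e ∈ G.maximalAtlas M → e' ∈ G.maximalAtlas M →
      (e.subtypeRestr hs).symm ≫ₕ e'.subtypeRestr hs ∈ G := fun {e e'} he he' =>
    G.mem_of_eqOnSource (closedUnderRestriction' (G.compatible_of_mem_maximalAtlas he he')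
      (e.isOpen_inter_preimage_symm s.2)) (e.subtypeRestr_symm_trans_subtypeRestr hs e')
  intro e' he'
  obtain ⟨x, hx⟩ := TopologicalSpace.Opens.chart_eq hs he'
  rw [hx]
  exact ⟨key he (G.chart_mem_maximalAtlas x.1), key (G.chart_mem_maximalAtlas x.1) he⟩

/-- The chart of the open submanifold is the composition of the inclusion with the ambient chart,
and its derivative is invertible. -/
theorem mfderiv_subtypeVal_injective (N : TopologicalSpace.Opens M) (q : N) :
    Function.Injective (mfderiv (𝓡∂ 3) (𝓡∂ 3) (Subtype.val : N → M) q) := by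
  have h1 : (extChartAt (𝓡∂ 3) q.1 ∘ (Subtype.val : N → M)) = extChartAt (𝓡∂ 3) q := rfl
  have h2 := mfderiv_comp q (g := extChartAt (𝓡∂ 3) q.1) (f := (Subtype.val : N → M))
    (I'' := 𝓘(ℝ, E3)) (mdifferentiableAt_extChartAt (mem_chart_source _ q.1))
    ((contMDiff_subtype_val (n := ∞) q).mdifferentiableAt (by simp))
  rw [h1] at h2
  have h3 := (isInvertible_mfderiv_extChartAt (I := 𝓡∂ 3) (mem_extChartAt_source q)).injective
  intro v w hvw
  refine h3 ?_
  rw [h2]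
  exact congrArg (mfderiv (𝓡∂ 3) 𝓘(ℝ, E3) (extChartAt (𝓡∂ 3) q.1) q.1) hvw

variable {Ω : Type u} [TopologicalSpace Ω] [ChartedSpace (EuclideanHalfSpace 3) Ω]
  [IsManifold (𝓡∂ 3) ∞ Ω]

/-- The local form of the immersion is unchanged when its chart in `M` is restricted to the open
subset. -/
theorem isSmoothEmbedding_codRestrict {N : TopologicalSpace.Opens M} {j : Ω → N}
    (h : Manifold.IsSmoothEmbedding (𝓡∂ 3) (𝓡∂ 3) ∞ (fun p => (j p : M))) :
    Manifold.IsSmoothEmbedding (𝓡∂ 3) (𝓡∂ 3) ∞ j := by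
  have hc : Continuous j := continuous_induced_rng.2 h.isEmbedding.continuous
  obtain ⟨F, i₁, i₂, hF⟩ := h.isImmersion
  refine ⟨⟨F, i₁, i₂, fun p => ?_⟩, h.isEmbedding.of_comp hc continuous_subtype_val⟩
  have hp := hF p
  refine Manifold.IsImmersionAtOfComplement.mk_of_continuousAt hc.continuousAt hp.equiv hp.domChart
    (hp.codChart.subtypeRestr ⟨j p⟩) hp.mem_domChart_source ?_ hp.domChart_mem_maximalAtlas
    (subtypeRestr_mem_maximalAtlas hp.codChart_mem_maximalAtlas ⟨j p⟩) hp.writtenInCharts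
  rw [OpenPartialHomeomorph.subtypeRestr_source]
  exact hp.mem_codChart_source

end

/-! ### Neighbourhoods of the region on which the deformation is possible -/

section

variable {M : Type v} [TopologicalSpace M] [ChartedSpace (EuclideanHalfSpace 3) M]
  [IsManifold (𝓡∂ 3) ∞ M] {g : RMetric M} {s : M → ℝ}

/-- Continuity of the divergence of the unit normal is available where the gradient of `s` is
nonzero, so openness is first obtained on that open set. -/
theorem isOpen_goodAt (hs : ContMDiff (𝓡∂ 3) 𝓘(ℝ, ℝ) ∞ s) : IsOpen {q | GoodAt g s q} := by
  have hgc : Continuous (gsq g s) :=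
    (contMDiffOn_univ.1 (contMDiffOn_gsq g isOpen_univ hs.contMDiffOn)).continuous
  have hlc : Continuous (lap g s) :=
    (contMDiffOn_univ.1 (contMDiffOn_lap g isOpen_univ hs.contMDiffOn)).continuous
  have hU : IsOpen {q | 0 < gsq g s q} := isOpen_lt continuous_const hgc
  have hd : ContinuousOn (div g (unitNormal g s)) {q | 0 < gsq g s q} :=
    (contMDiffOn_div g hU (contMDiffOn_unitNormal g hU hs.contMDiffOn fun _ h => h)).continuousOn
  have he : Continuous expNegInvGlue := (expNegInvGlue.contDiff (n := ⊤)).continuous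
  have he' : Continuous (deriv expNegInvGlue) :=
    (expNegInvGlue.contDiff (n := ⊤)).continuous_deriv (by simp)
  have hsc := hs.continuous
  have h1 : IsOpen ({q | 0 < gsq g s q} ∩ (fun q => div g (unitNormal g s) q -
      2 * (deriv expNegInvGlue (s q) * √(gsq g s q))) ⁻¹' Ioi 0) :=
    (hd.sub (by fun_prop)).isOpen_inter_preimage hU isOpen_Ioi
  have h2 : IsOpen {q | 0 < 2 * (1 - 2 * s q) * gsq g s q + 2 * s q ^ 2 * lap g s q -
      expNegInvGlue (s q) * gsq g s q} := isOpen_lt continuous_const (by fun_prop)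
  convert h1.inter h2 using 1
  ext q
  exact ⟨fun h => ⟨⟨h.gsq_pos, h.div_pos⟩, h.lap_pos⟩, fun h => ⟨h.1.1, h.1.2, h.2⟩⟩

/-- The function `e^{-1/s}` and its derivative vanish at `s = 0`, so the three conditions reduce to
the nonzero gradient and the positive divergence. -/
theorem goodAt_of_div_pos {q : M} (h0 : s q = 0) (hpos : 0 < gsq g s q)
    (hdiv : 0 < div g (unitNormal g s) q) : GoodAt g s q := by
  refine ⟨hpos, ?_, ?_⟩
  · have : deriv expNegInvGlue 0 = 0 := IsLocalMin.deriv_eq_zero (Filter.Eventually.of_forall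
      fun y => by rw [expNegInvGlue.zero_of_nonpos le_rfl]; exact expNegInvGlue.nonneg y)
    rw [h0, this]
    simpa using hdiv
  · rw [h0, expNegInvGlue.zero_of_nonpos le_rfl]
    simpa using hpos

theorem IsoMap.goodAt {Ω : Type u} [TopologicalSpace Ω] [ChartedSpace (EuclideanHalfSpace 3) Ω]
    [IsManifold (𝓡∂ 3) ∞ Ω] {γ : RMetric Ω} {ι : Ω → M} (H : IsoMap γ g ι)
    (hs : ContMDiff (𝓡∂ 3) 𝓘(ℝ, ℝ) ∞ s) {q : Ω} (h : GoodAt g s (ι q)) :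
    GoodAt γ (fun x => s (ι x)) q := by
  refine ⟨?_, ?_, ?_⟩
  · rw [H.gsq_eq hs]; exact h.gsq_pos
  · rw [H.gsq_eq hs, H.div_unitNormal hs h.gsq_pos]; exact h.div_pos
  · rw [H.gsq_eq hs, H.lap_eq hs]; exact h.lap_pos

/-- A compact sublevel set has relatively compact open neighbourhoods exhausted by the nearby
sublevel sets. -/
theorem exists_opens_sublevel [T2Space M] [LocallyCompactSpace M] (hs : Continuous s)
    (hA : IsCompact {q | s q ≤ 0}) {W : Set M} (hW : IsOpen W) (hAW : {q | s q ≤ 0} ⊆ W) :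
    ∃ (N : TopologicalSpace.Opens M) (s₀ : ℝ), 0 < s₀ ∧ {q | s q ≤ 0} ⊆ N ∧ (N : Set M) ⊆ W ∧
      (∀ q : N, s q < s₀) ∧ ∀ t < s₀, IsCompact {q : N | s q ≤ t} := by
  obtain ⟨K, hK, hAK, hKW⟩ := exists_compact_between hA hW hAW
  have hfr : ∀ q ∈ frontier K, 0 < s q := by
    intro q hq
    by_contra hcon
    exact hq.2 (hAK (not_lt.1 hcon))
  -- `s` is positive on the compact frontier of `K`; below its minimum there, sublevel sets within
  -- `K` do not reach the frontier and stay compact in the open set.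
  obtain ⟨s₀, hs₀, hle⟩ : ∃ s₀ : ℝ, 0 < s₀ ∧ ∀ q ∈ frontier K, s₀ ≤ s q := by
    rcases (frontier K).eq_empty_or_nonempty with h | h
    · exact ⟨1, one_pos, fun q hq => by rw [h] at hq; exact absurd hq (notMem_empty q)⟩
    · have hc : IsCompact (frontier K) :=
        hK.of_isClosed_subset isClosed_frontier (frontier_subset_iff_isClosed.2 hK.isClosed)
      obtain ⟨x, hx, hmin⟩ := hc.exists_isMinOn h hs.continuousOn
      exact ⟨s x, hfr x hx, fun q hq => hmin hq⟩
  refine ⟨⟨interior K ∩ {q | s q < s₀}, isOpen_interior.inter (isOpen_lt hs continuous_const)⟩,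
    s₀, hs₀, fun q hq => ⟨hAK hq, lt_of_le_of_lt hq hs₀⟩, fun q hq => hKW (interior_subset hq.1),
    fun q => q.2.2, fun t ht => ?_⟩
  rw [Subtype.isCompact_iff]
  convert hK.inter_right (isClosed_le hs (continuous_const (y := t))) using 1
  ext q
  constructor
  · rintro ⟨x, hx, rfl⟩
    exact ⟨interior_subset x.2.1, hx⟩
  · rintro ⟨hq, hqt⟩
    have hqt' : s q ≤ t := hqt
    have h1 : q ∈ interior K := by
      by_contra hcon
      exact absurd (hle q ⟨subset_closure hq, hcon⟩) (not_le.2 (hqt'.trans_lt ht))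
    exact ⟨⟨q, h1, hqt'.trans_lt ht⟩, hqt, rfl⟩

end

section

variable {Ω : Type u} [TopologicalSpace Ω] [ChartedSpace (EuclideanHalfSpace 3) Ω]
  [IsManifold (𝓡∂ 3) ∞ Ω] {γ : RMetric Ω}
  {M : Type v} [TopologicalSpace M] [ChartedSpace (EuclideanHalfSpace 3) M]
  [IsManifold (𝓡∂ 3) ∞ M] {g : RMetric M} {ι : Ω → M} {s : M → ℝ}

theorem goodAt_of_meanCurvature_pos (H : IsoMap γ g ι) (hs : ContMDiff (𝓡∂ 3) 𝓘(ℝ, ℝ) ∞ s)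
    (hsι : ∀ p, s (ι p) ≤ 0) (hb : ∀ p, s (ι p) = 0 ↔ p ∈ (𝓡∂ 3).boundary Ω)
    (hd : ∀ q, s q = 0 → ∃ v, 0 < dd s q v) {p : Ω} (hp : p ∈ (𝓡∂ 3).boundary Ω)
    (hH : 0 < meanCurvature γ p) : GoodAt g s (ι p) := by
  have h0 := (hb p).2 hp
  obtain ⟨v, hv⟩ := hd _ h0
  have hpos : 0 < gsq g s (ι p) := gsq_pos g (hs.mdifferentiableAt (by simp)) hv.ne'
  refine goodAt_of_div_pos h0 hpos ?_
  have h1 := meanCurvature_eq_div γ (σ := fun x => s (ι x)) (hs.comp H.smooth) hsι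
    (fun q hq => (hb q).2 hq) hp (by rw [H.gsq_eq hs]; exact hpos)
  rwa [← H.div_unitNormal hs hpos, ← h1]

/-- The deformed metric `h` equals the restricted ambient metric `k` at the points of the image, and
only its values there enter the isometry condition. -/
theorem isIsometricEmbedding_codRestrict (hι : IsIsometricEmbedding γ g ι)
    {N : TopologicalSpace.Opens M} {k h : RMetric N} (hk : IsoMap k g (Subtype.val : N → M))
    {j : Ω → N} (hj : ∀ p, (j p : M) = ι p) (hh : ∀ p, h.inner (j p) = k.inner (j p)) :
    IsIsometricEmbedding γ h j := by
  obtain rfl : ι = fun p => (j p : M) := funext fun p => (hj p).symm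
  have hje := isSmoothEmbedding_codRestrict hι.isSmoothEmbedding
  refine ⟨hje, fun p v w => ?_⟩
  have h1 := mfderiv_comp p ((hk.smooth (j p)).mdifferentiableAt (by simp))
    ((hje.contMDiff p).mdifferentiableAt (by simp))
  rw [hh, ← hk.isometric, ← hι.isometric p v w]
  have h2 : ∀ u : TangentSpace (𝓡∂ 3) p, mfderiv (𝓡∂ 3) (𝓡∂ 3) (fun p => (j p : M)) p u =
      mfderiv (𝓡∂ 3) (𝓡∂ 3) (Subtype.val : N → M) (j p) (mfderiv (𝓡∂ 3) (𝓡∂ 3) j p u) :=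
    fun u => congrArg (fun L : E3 →L[ℝ] E3 => L u) h1
  rw [h2, h2]

end

end Bartnik

end

/-! ### Construction of the extension -/

theorem mainTheorem6
    {Ω : Type u} [TopologicalSpace Ω] [T2Space Ω] [CompactSpace Ω]
    [ChartedSpace (EuclideanHalfSpace 3) Ω] [IsManifold (𝓡∂ 3) ∞ Ω]
    (γ : Bartnik.RMetric Ω)
    (hR : ∀ p, 0 ≤ Bartnik.scalarCurvature γ p)
    (hH : ∀ p ∈ (𝓡∂ 3).boundary Ω, 0 < Bartnik.meanCurvature γ p)
    {Ω₀ : Type v} [TopologicalSpace Ω₀] [T2Space Ω₀] [SecondCountableTopology Ω₀]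
    [ChartedSpace (EuclideanHalfSpace 3) Ω₀] [IsManifold (𝓡∂ 3) ∞ Ω₀]
    (γ₀ : Bartnik.RMetric Ω₀)
    (hR₀ : ∀ q, 0 ≤ Bartnik.scalarCurvature γ₀ q)
    (ι : Ω → Ω₀) (hι : Bartnik.IsIsometricEmbedding γ γ₀ ι)
    (hdist : 0 < Bartnik.distToBoundary γ₀ (ι '' (𝓡∂ 3).boundary Ω)) :
    ∃ (N : Type v) (_ : TopologicalSpace N) (_ : T2Space N) (_ : SecondCountableTopology N)
      (_ : ChartedSpace (EuclideanHalfSpace 3) N) (_ : IsManifold (𝓡∂ 3) ∞ N)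
      (_ : MeasurableSpace N) (_ : BorelSpace N)
      (g : Bartnik.RMetric N) (j : Ω → N),
      Bartnik.IsIsometricEmbedding γ g j ∧
      0 < Bartnik.distToBoundary g (j '' (𝓡∂ 3).boundary Ω) ∧
      (∀ q ∉ Set.range j, 0 < Bartnik.scalarCurvature g q) ∧
      ¬ Bartnik.IsStaticOn g (Set.range j)ᶜ ∧
      Bartnik.IsStrictlyOuterMinimising g (Set.range j) := by
  have : LocallyCompactSpace Ω₀ := Manifold.locallyCompact_of_finiteDimensional (𝓡∂ 3)
  obtain ⟨s, hs, hsA, hsd, hsb, hint⟩ := Bartnik.exists_defining hι hdist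
  have hAr : {q | s q ≤ 0} = Set.range ι := Set.ext hsA
  have hAc : IsCompact {q | s q ≤ 0} := by
    rw [hAr]; exact isCompact_range hι.isSmoothEmbedding.isEmbedding.continuous
  have hI := hι.isoMap
  have hsι : ∀ p, s (ι p) ≤ 0 := fun p => (hsA _).2 (Set.mem_range_self p)
  have hbd : ∀ p ∈ (𝓡∂ 3).boundary Ω, Bartnik.GoodAt γ₀ s (ι p) := fun p hp =>
    Bartnik.goodAt_of_meanCurvature_pos hI hs hsι hsb hsd hp (hH p hp)
  -- Points with `s < 0` need no condition, those on the zero set are good by mean convexity, and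
  -- goodness is open. Intersecting with the interior of `Ω₀` makes `N` a manifold without boundary.
  obtain ⟨N, s₀, hs₀, hAN, hNW, hlt, hcpt⟩ := Bartnik.exists_opens_sublevel hs.continuous hAc
    (W := ({q | s q < 0} ∪ {q | Bartnik.GoodAt γ₀ s q}) ∩ (𝓡∂ 3).interior Ω₀)
    (((isOpen_lt hs.continuous continuous_const).union (Bartnik.isOpen_goodAt hs)).inter
      ((𝓡∂ 3).isOpen_interior (n := ∞) (by simp)))
    (by
      intro q hq
      obtain ⟨p, rfl⟩ := (hsA q).1 hq
      refine ⟨?_, hint p⟩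
      rcases lt_or_eq_of_le (hsι p) with h | h
      · exact Or.inl h
      · exact Or.inr (hbd p ((hsb p).1 h)))
  let _ : MeasurableSpace N := borel N
  have : BorelSpace N := ⟨rfl⟩
  have hNi : Bartnik.NoBoundary N := fun q =>
    (𝓡∂ 3).isInteriorPoint_iff_isInteriorPoint_val.2 (hNW q.2).2
  have hk := Bartnik.isoMap_pullMetric γ₀ (ι := (Subtype.val : N → Ω₀)) contMDiff_subtype_val
    (Bartnik.mfderiv_subtypeVal_injective N)
  obtain ⟨h, hhA, hhR, hhS, hhM⟩ := Bartnik.exists_conformal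
    (Bartnik.pullMetric γ₀ contMDiff_subtype_val (Bartnik.mfderiv_subtypeVal_injective N)) hNi
    (fun q => by rw [hk.scalarCurvature_eq]; exact hR₀ _) (s := fun q : N => s q)
    (hs.comp contMDiff_subtype_val) hs₀ hlt hcpt
    (fun q hq => hk.goodAt hs ((hNW q.2).1.resolve_left (not_lt.2 hq)))
  have hj : Set.range (fun p => (⟨ι p, hAN (hsι p)⟩ : N)) = {q : N | s q ≤ 0} := by
    ext q
    constructor
    · rintro ⟨p, rfl⟩
      exact hsι p
    · intro hq
      obtain ⟨p, hp⟩ := (hsA q).1 hq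
      exact ⟨p, Subtype.ext hp⟩
  have hjc : (Set.range (fun p => (⟨ι p, hAN (hsι p)⟩ : N)))ᶜ = {q : N | 0 < s q} := by
    rw [hj]
    ext q
    exact not_le (a := s q) (b := 0)
  refine ⟨N, inferInstance, inferInstance, inferInstance, inferInstance, inferInstance, _, this, h,
    fun p => ⟨ι p, hAN (hsι p)⟩,
    Bartnik.isIsometricEmbedding_codRestrict hι hk (fun p => rfl) (fun p => hhA _ (hsι p)), ?_,
    fun q hq => hhR q (hjc ▸ hq : q ∈ {q : N | 0 < s q}), hjc ▸ hhS, hj ▸ hhM⟩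
  -- `N` has no boundary, so the distance is an infimum over the empty set, that is, `∞`.
  have hb : (𝓡∂ 3).boundary N = ∅ := Set.eq_empty_of_forall_notMem fun q hq =>
    ((𝓡∂ 3).isInteriorPoint_iff_not_isBoundaryPoint q).1 (hNi q) hq
  simp [Bartnik.distToBoundary, hb]
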